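/- Let $t\in\mathbb C$ with $t\neq 0$ and $t^{12}\neq 1$, and let $\zeta$ be a primitive third root of unity. Let $C_t$ be the smooth projective curve of genus $2$ over $\mathbb C$ with affine equation $y^2=(x^3-1)(x^3-t^{12})$, let $\sigma\colon (x,y)\mapsto(\zeta x,y)$, an automorphism of $C_t$, and let $0^+=(0,t^6)\in C_t$. Put \[ u=\Bigl(\frac{1-t^2}{1+t^2}\Bigr)^2,\quad v=\Bigl(\frac{\zeta-t^2}{\zeta+t^2}\Bigr)^2,\quad w=\Bigl(\frac{\zeta^2-t^2}{\zeta^2+t^2}\Bigr)^2, \] and let $E_1\colon y^2=(x-u)(x-v)(x-w)$, with origin the point at infinity, and $E_2\colon y^2=x(x-u)(x-v)(x-w)$, with origin $(0,0)$ (smooth projective models; both are elliptic curves). Let $\phi_1\colon C_t\to E_1$ and $\phi_2\colon C_t\to E_2$ be the morphisms \[ \phi_1(x,y)=\Bigl(\frac{(x-t^2)^2}{(x+t^2)^2},\ \frac{8t^3y}{(t^6+1)(x+t^2)^3}\Bigr),\qquad \phi_2(x,y)=\Bigl(\frac{(x-t^2)^2}{(x+t^2)^2},\ \frac{8t^3(x-t^2)y}{(t^6+1)(x+t^2)^4}\Bigr).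 \] Let $J(C_t)$ be the Jacobian of $C_t$ (divisors of degree $0$ modulo linear equivalence), let $\theta_j\colon J(C_t)\to E_j$ be the homomorphism induced by $\phi_j$ (push-forward of divisors), let $\theta_j^\vee\colon E_j\to J(C_t)$ be the homomorphism induced by pull-back of divisors under $\phi_j$, where $E_j$ with origin $O_j$ is identified with its Jacobian via $P\mapsto[P-O_j]$, and write $\sigma$ also for the automorphism of $J(C_t)$ induced by $\sigma$. Let $T_1=\phi_1(0^+)$ and $T_2=\phi_2(0^+)$. Then $T_1\in E_1$ and $T_2\in E_2$ have order $3$. Moreover, \[ \varphi_{12}=\theta_2\circ\sigma\circ\theta_1^\vee\colon E_1\to E_2 \qquad\text{and}\qquad \varphi_{21}=\theta_1\circ\sigma\circ\theta_2^\vee\colon E_2\to E_1 \] are isogenies with $\ker(\varphi_{12})=\langle T_1\rangle$ and $\ker(\varphi_{21})=\langle T_2\rangle$. -/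

import Mathlib

namespace PoonenCurve
open Polynomial

/-- A function field in one variable over `ℂ`. It stands for the smooth projective curve over `ℂ`
whose field of rational functions it is. -/
class IsCurveField (K : Type) [Field K] [Algebra ℂ K] : Prop where
  trdeg_eq_one : Algebra.trdeg ℂ K = 1
  fg : (⊤ : IntermediateField ℂ K).FG

/-- A point of the smooth projective curve with function field `K`: a discrete valuation ring of `K`
that contains the constants (the local ring of the curve at the point). -/
@[ext]
structure Place (K : Type) [Field K] [Algebra ℂ K] where
  ring : ValuationSubring K
  const_mem : ∀ c : ℂ, algebraMap ℂ K c ∈ ring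
  dvr : IsDiscreteValuationRing ring

section Curve

variable {K K' : Type} [Field K] [Algebra ℂ K] [Field K']

instance (P : Place K) : IsDiscreteValuationRing P.ring := P.dvr

/-- The valuation `K → ℤᵐ⁰` of a point, normalized to be surjective (and multiplicative). -/
noncomputable def Place.val (P : Place K) : Valuation K (WithZero (Multiplicative ℤ)) :=
  (IsDiscreteValuationRing.maximalIdeal P.ring).valuation K

/-- The order of vanishing of a nonzero rational function at a point (negative at poles). -/
noncomputable def Place.ord (P : Place K) (g : K) : ℤ := -WithZero.log (P.val g)

/-- The rational function `g` is regular at `P` with value `c`. -/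
def Place.HasValue (P : Place K) (g : K) (c : ℂ) : Prop := P.val (g - algebraMap ℂ K c) < 1

/-- The rational function `g` has a pole at `P`. -/
def Place.IsPole (P : Place K) (g : K) : Prop := 1 < P.val g

theorem Place.exists_uniformizer (P : Place K) : ∃ g : K, P.ord g = 1 := by
  obtain ⟨g, hg⟩ := (IsDiscreteValuationRing.maximalIdeal P.ring).valuation_exists_uniformizer K
  refine ⟨g, ?_⟩
  simp only [Place.ord, Place.val]
  rw [hg]
  simp

/-- A uniformizer at `P`. -/
noncomputable def Place.uniformizer (P : Place K) : K := P.exists_uniformizer.choose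

/-- Contracting a valuation ring along an algebraic field extension. -/
theorem comap_dvr (P : Place K) (φ : K' →+* K) (hφ : φ.IsIntegral) :
    IsDiscreteValuationRing (P.ring.comap φ) := by
  set V := P.ring.comap φ with hV
  -- the map on local rings
  let ψ : V →+* P.ring := (φ.comp V.subtype).codRestrict P.ring.toSubring (fun x => x.2)
  have hψ : ∀ x : V, ((ψ x : P.ring) : K) = φ x := fun x => rfl
  have hψinj : Function.Injective ψ := by
    intro a b hab
    apply Subtype.ext
    apply φ.injective
    rw [← hψ, ← hψ, hab]
  let v : V → ℕ∞ := fun x => IsDiscreteValuationRing.addVal P.ring (ψ x)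
  have hdvd : ∀ a b : V, v a ≤ v b → a ∣ b := by
    intro a b hab
    by_cases ha : a = 0
    · subst ha
      have : IsDiscreteValuationRing.addVal P.ring (ψ b) = ⊤ := by
        simpa [v] using hab
      have hb : ψ b = 0 := IsDiscreteValuationRing.addVal_eq_top_iff.1 this
      have : b = 0 := hψinj (by simpa using hb)
      simp [this]
    · have h := IsDiscreteValuationRing.addVal_le_iff_dvd.1 hab
      obtain ⟨c, hc⟩ := h
      have ha' : (a : K') ≠ 0 := fun h => ha (Subtype.ext h)
      have hφa : φ a ≠ 0 := (map_ne_zero φ).2 ha'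
      have hc' : φ b = φ a * c := by
        have := congrArg (fun z : P.ring => (z : K)) hc
        simpa [hψ] using this
      refine ⟨⟨(b : K') / a, ?_⟩, ?_⟩
      · show φ ((b : K') / a) ∈ P.ring
        rw [map_div₀, hc', mul_div_cancel_left₀ _ hφa]
        exact c.2
      · apply Subtype.ext
        simp [mul_div_cancel₀ _ ha']
  have hunit : ∀ a : V, IsUnit a ↔ v a = 0 := by
    intro a
    constructor
    · intro h
      have : IsUnit (ψ a) := h.map ψ
      exact IsDiscreteValuationRing.addVal_eq_zero_of_unit this.unit
    · intro h
      apply isUnit_of_dvd_one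
      apply hdvd
      rw [h]; exact bot_le
  -- not a field
  have hne : ∃ a : V, a ≠ 0 ∧ ¬ IsUnit a := by
    by_contra! hcon
    have hall : ∀ x : K', x ∈ V := by
      intro x
      rcases V.mem_or_inv_mem x with h | h
      · exact h
      · by_cases hx : x = 0
        · subst hx; exact V.zero_mem
        · have hu := hcon ⟨x⁻¹, h⟩ (fun hh => by
            have := congrArg (fun z : V => (z : K')) hh
            exact hx (by simpa using this))
          obtain ⟨u, hu⟩ := hu.exists_right_inv
          have := congrArg (fun z : V => (z : K')) hu
          have hxu : x⁻¹ * (u : K') = 1 := by simpa using this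
          have : x = u := by field_simp at hxu; exact hxu.symm
          rw [this]; exact u.2
    have htop : ∀ z : K, z ∈ P.ring := by
      intro z
      have hz := hφ z
      obtain ⟨p, hp, hpz⟩ := hz
      have hint : IsIntegral P.ring z := by
        let χ : K' →+* P.ring := φ.codRestrict P.ring.toSubring (fun x => hall x)
        refine ⟨p.map χ, hp.map χ, ?_⟩
        rw [eval₂_map]
        exact hpz
      obtain ⟨w, hw⟩ := IsIntegrallyClosed.isIntegral_iff.1 hint
      rw [← hw]; exact w.2
    apply IsDiscreteValuationRing.not_isField P.ring
    refine ⟨⟨0, 1, zero_ne_one⟩, mul_comm, ?_⟩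
    intro a ha
    have ha' : (a : K) ≠ 0 := fun h => ha (Subtype.ext h)
    exact ⟨⟨(a : K)⁻¹, htop _⟩, Subtype.ext (by simp [ha'])⟩
  -- an element of minimal positive order
  have hfin : ∀ a : V, a ≠ 0 → v a ≠ ⊤ := by
    intro a ha h
    exact ha (hψinj (by simpa using IsDiscreteValuationRing.addVal_eq_top_iff.1 h))
  let S : Set ℕ∞ := v '' {a : V | a ≠ 0 ∧ ¬ IsUnit a}
  have hS : S.Nonempty := by
    obtain ⟨a, ha⟩ := hne
    exact ⟨v a, a, ha, rfl⟩
  obtain ⟨π, ⟨hπ0, hπu⟩, hπ⟩ := WellFounded.min_mem wellFounded_lt S hS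
  have hmin : ∀ a : V, a ≠ 0 → ¬ IsUnit a → v π ≤ v a := by
    intro a ha hau
    rw [hπ]
    exact not_lt.1 (WellFounded.not_lt_min wellFounded_lt S ⟨a, ⟨ha, hau⟩, rfl⟩)
  have hmul : ∀ a b : V, v (a * b) = v a + v b := by
    intro a b
    simp [v]
  apply IsDiscreteValuationRing.ofHasUnitMulPowIrreducibleFactorization
  refine ⟨π, ⟨hπu, ?_⟩, ?_⟩
  · intro a b hab
    by_contra! hcon
    have ha0 : a ≠ 0 := by rintro rfl; simp at hab; exact hπ0 hab
    have hb0 : b ≠ 0 := by rintro rfl; simp at hab; exact hπ0 hab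
    have h1 := hmin a ha0 hcon.1
    have h2 : v b ≠ 0 := fun h => hcon.2 ((hunit b).2 h)
    have h3 := hmul a b
    rw [← hab] at h3
    rw [h3] at h1
    have h4 : v a + v b ≤ v a + 0 := by simpa using h1
    have h5 := (ENat.add_le_add_iff_left (hfin a ha0)).1 h4
    exact h2 (by simpa using h5)
  · have key : ∀ n : ℕ, ∀ a : V, v a = n → ∃ m : ℕ, Associated (π ^ m) a := by
      intro n
      induction n using Nat.strong_induction_on with
      | _ n ih =>
        intro a ha
        by_cases hu : IsUnit a
        · exact ⟨0, by simpa using (associated_one_iff_isUnit.2 hu).symm⟩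
        · have ha0 : a ≠ 0 := by
            rintro rfl
            have : v 0 = ⊤ := by simp [v]
            rw [this] at ha
            exact absurd ha.symm (ENat.natCast_ne_top n)
          obtain ⟨c, hc⟩ := hdvd π a (hmin a ha0 hu)
          have hc0 : c ≠ 0 := by rintro rfl; simp at hc; exact ha0 hc
          have hvc := hmul π c
          rw [← hc, ha] at hvc
          obtain ⟨k, hk⟩ := ENat.ne_top_iff_exists.1 (hfin c hc0)
          obtain ⟨l, hl⟩ := ENat.ne_top_iff_exists.1 (hfin π hπ0)
          have hl0 : l ≠ 0 := by
            rintro rfl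
            exact hπu ((hunit π).2 (by simpa using hl.symm))
          rw [← hk, ← hl] at hvc
          have hnk : n = l + k := by exact_mod_cast hvc
          obtain ⟨m, hm⟩ := ih k (by omega) c hk.symm
          refine ⟨m + 1, ?_⟩
          rw [hc, pow_succ']
          exact hm.mul_left π
    intro a ha
    obtain ⟨n, hn⟩ := ENat.ne_top_iff_exists.1 (hfin a ha)
    exact key n a hn.symm

variable [Algebra ℂ K']

/-- A homomorphism between function fields of curves is algebraic. -/
theorem isAlgebraic_of_hom [IsCurveField K] [IsCurveField K'] (φ : K' →ₐ[ℂ] K) :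
    φ.toRingHom.IsIntegral := by
  let _ := φ.toRingHom.toAlgebra
  have : IsScalarTower ℂ K' K := IsScalarTower.of_algebraMap_eq fun c => (φ.commutes c).symm
  have h := trdeg_add_eq ℂ K' (A := K)
  rw [IsCurveField.trdeg_eq_one, IsCurveField.trdeg_eq_one] at h
  have h0 : Algebra.trdeg K' K = 0 := by
    have h' : (1 : Cardinal) + Algebra.trdeg K' K = 1 + 0 := by simpa using h
    exact Cardinal.eq_of_add_eq_add_left h' Cardinal.one_lt_aleph0
  have := trdeg_eq_zero_iff.1 h0
  exact fun x => Algebra.IsIntegral.isIntegral (R := K') x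

variable [IsCurveField K] [IsCurveField K']

/-- The map on points of the nonconstant morphism of curves given by a homomorphism `φ` of function
fields: the image of a point `P` is the point at which `g` is regular iff `φ g` is regular
at `P`. -/
def Place.map (φ : K' →ₐ[ℂ] K) (P : Place K) : Place K' where
  ring := P.ring.comap φ.toRingHom
  const_mem c := by
    rw [ValuationSubring.mem_comap]
    have : φ.toRingHom (algebraMap ℂ K' c) = algebraMap ℂ K c := φ.commutes c
    rw [this]
    exact P.const_mem c
  dvr := comap_dvr P _ (isAlgebraic_of_hom φ)

/-- The ramification index at `P` of the morphism given by `φ`: the order at `P` of the pull-back of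
a uniformizer at the image point. -/
noncomputable def Place.ramificationIndex (φ : K' →ₐ[ℂ] K) (P : Place K) : ℤ :=
  P.ord (φ (P.map φ).uniformizer)

end Curve

section Divisors

variable (K K' : Type) [Field K] [Algebra ℂ K] [Field K'] [Algebra ℂ K']

/-- The group of divisors. -/
abbrev Divisor : Type := Place K →₀ ℤ

/-- The group of divisors of degree `0`. -/
noncomputable def divisorZero : AddSubgroup (Divisor K) := (Finsupp.degree : Divisor K →+ ℤ).ker

/-- The group of principal divisors. -/
noncomputable def principal : AddSubgroup (Divisor K) where
  carrier := {D | ∃ g : K, g ≠ 0 ∧ ∀ P : Place K, D P = P.ord g}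
  zero_mem' := ⟨1, one_ne_zero, fun P => by simp [Place.ord]⟩
  add_mem' := by
    rintro D D' ⟨g, hg, h⟩ ⟨g', hg', h'⟩
    refine ⟨g * g', mul_ne_zero hg hg', fun P => ?_⟩
    rw [Finsupp.add_apply, h, h', Place.ord, Place.ord, Place.ord, map_mul,
      WithZero.log_mul ((Valuation.ne_zero_iff _).2 hg) ((Valuation.ne_zero_iff _).2 hg')]
    ring
  neg_mem' := by
    rintro D ⟨g, hg, h⟩
    refine ⟨g⁻¹, inv_ne_zero hg, fun P => ?_⟩
    rw [Finsupp.neg_apply, h, Place.ord, Place.ord, map_inv₀, WithZero.log_inv]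

/-- The Jacobian (more precisely, its group of complex points): the group of divisors of degree `0`
modulo linear equivalence. -/
abbrev Jac : Type := divisorZero K ⧸ (principal K).addSubgroupOf (divisorZero K)

variable {K K'}

/-- The class of the divisor `P - O`. -/
noncomputable def abelJacobi (O P : Place K) : Jac K :=
  QuotientAddGroup.mk ⟨Finsupp.single P 1 - Finsupp.single O 1, by
    simp [divisorZero, AddMonoidHom.mem_ker]⟩

/-- The homomorphism `F` of divisor groups preserves degree `0` and linear equivalence. -/
structure Descends (F : Divisor K →+ Divisor K') : Prop where
  degree : divisorZero K ≤ (divisorZero K').comap F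
  principal : principal K ≤ (principal K').comap F

/-- The homomorphism of Jacobians induced by a homomorphism of divisor groups. -/
noncomputable def Descends.map {F : Divisor K →+ Divisor K'} (h : Descends F) : Jac K →+ Jac K' :=
  QuotientAddGroup.map _ _
    ((F.comp (divisorZero K).subtype).codRestrict (divisorZero K') fun D => h.degree D.2)
    fun _ hD => h.principal hD

variable [IsCurveField K] [IsCurveField K']

/-- The push-forward of divisors under the morphism given by `φ : K' → K`,
that is, `P ↦ φ(P)` extended additively. -/
noncomputable def pushforward (φ : K' →ₐ[ℂ] K) : Divisor K →+ Divisor K' :=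
  Finsupp.mapDomain.addMonoidHom (Place.map φ)

/-- The pull-back of divisors under the morphism given by `φ : K' → K`: a point is sent to the sum of
the points in its (finite) fibre, counted with ramification indices. -/
noncomputable def pullback (φ : K' →ₐ[ℂ] K) : Divisor K' →+ Divisor K :=
  Finsupp.liftAddHom fun P => zmultiplesHom (Divisor K)
    (∑ᶠ Q ∈ {Q : Place K | Q.map φ = P}, Finsupp.single Q (Q.ramificationIndex φ))

/-- Let `O` and `O'` be points on the curves with function fields `K` and `K'`, assumed to be elliptic
curves with these points as origins; their points are identified with their Jacobians
via `P ↦ [P - O]` and `P ↦ [P - O']`. The homomorphism `h` is an isogeny if it is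
given by a nonconstant morphism of curves. -/
def IsIsogeny (O : Place K) (O' : Place K') (h : Jac K →+ Jac K') : Prop :=
  ∃ ψ : K' →ₐ[ℂ] K, ∀ P : Place K, h (abelJacobi O P) = abelJacobi O' (P.map ψ)

end Divisors

/-- The polynomial `Y² - f` over `ℂ(X)`. -/
noncomputable abbrev quad (f : ℂ[X]) : (RatFunc ℂ)[X] := X ^ 2 - C (algebraMap ℂ[X] (RatFunc ℂ) f)

/-- The field `ℂ(x)[y] / (y² - f(x))`. -/
abbrev DoubleCover (f : ℂ[X]) : Type := AdjoinRoot (quad f)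

theorem quad_irreducible {f g : ℂ[X]} {a : ℂ} (hf : f = (X - C a) * g) (hg : g.eval a ≠ 0) :
    Irreducible (quad f) := by
  apply X_pow_sub_C_irreducible_of_prime Nat.prime_two
  intro b hb
  have hint : IsIntegral ℂ[X] b := by
    apply IsIntegral.of_pow (n := 2) two_pos
    rw [hb]; exact isIntegral_algebraMap
  obtain ⟨q, rfl⟩ := IsIntegrallyClosed.isIntegral_iff.1 hint
  rw [← map_pow] at hb
  have hq : q ^ 2 = f := IsFractionRing.injective ℂ[X] (RatFunc ℂ) hb
  have hdvd : X - C a ∣ q := by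
    apply (prime_X_sub_C a).dvd_of_dvd_pow (n := 2)
    rw [hq, hf]; exact dvd_mul_right _ _
  obtain ⟨r, rfl⟩ := hdvd
  have : g = (X - C a) * r ^ 2 := by
    apply mul_left_cancel₀ (X_sub_C_ne_zero a)
    rw [← hf, ← hq]; ring
  apply hg
  rw [this]; simp

namespace DoubleCover

variable {f : ℂ[X]}

/-- The coordinate function `x`. -/
noncomputable def x (f : ℂ[X]) : DoubleCover f := AdjoinRoot.of (quad f) RatFunc.X

/-- The coordinate function `y`. -/
noncomputable def y (f : ℂ[X]) : DoubleCover f := AdjoinRoot.root (quad f)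

theorem aeval_x (p : ℂ[X]) :
    aeval (x f) p = AdjoinRoot.of (quad f) (algebraMap ℂ[X] (RatFunc ℂ) p) := by
  have h : aeval (x f) = ((Algebra.ofId (RatFunc ℂ) (AdjoinRoot (quad f))).restrictScalars ℂ).comp
      (IsScalarTower.toAlgHom ℂ ℂ[X] (RatFunc ℂ)) := by
    apply Polynomial.algHom_ext
    simp [x, Algebra.ofId_apply, RatFunc.algebraMap_X]
  rw [h]; rfl

theorem y_sq : y f ^ 2 = aeval (x f) f := by
  have h := AdjoinRoot.eval₂_root (quad f)
  simp only [quad, eval₂_sub, eval₂_pow, eval₂_X, eval₂_C] at h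
  rw [aeval_x]
  exact sub_eq_zero.1 h

variable [Fact (Irreducible (quad f))]

theorem x_transcendental : Transcendental ℂ (x f) := by
  rw [transcendental_iff]
  intro p hp
  rw [aeval_x] at hp
  have h1 := (AdjoinRoot.of (quad f)).injective (hp.trans (map_zero _).symm)
  exact IsFractionRing.injective ℂ[X] (RatFunc ℂ) (h1.trans (map_zero _).symm)

instance : IsCurveField (DoubleCover f) where
  trdeg_eq_one := by
    have h1 := trdeg_add_eq ℂ (RatFunc ℂ) (A := DoubleCover f)
    have h2 := trdeg_add_eq ℂ ℂ[X] (A := RatFunc ℂ)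
    have h3 : Algebra.trdeg ℂ[X] (RatFunc ℂ) = 0 := by
      have : Algebra.IsAlgebraic ℂ[X] (RatFunc ℂ) := IsLocalization.isAlgebraic _ (nonZeroDivisors ℂ[X])
      exact trdeg_eq_zero
    have h4 : Algebra.trdeg (RatFunc ℂ) (DoubleCover f) = 0 := by
      have : FiniteDimensional (RatFunc ℂ) (DoubleCover f) :=
        (AdjoinRoot.powerBasis (Fact.out : Irreducible (quad f)).ne_zero).finite
      exact trdeg_eq_zero
    rw [← h1, ← h2, h3, h4]
    simp
  fg := by
    refine ⟨{x f, y f}, ?_⟩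
    rw [eq_top_iff]
    intro z _
    have hx : x f ∈ IntermediateField.adjoin ℂ (({x f, y f} : Finset (DoubleCover f)) : Set (DoubleCover f)) :=
      IntermediateField.subset_adjoin _ _ (by simp)
    have hy : y f ∈ IntermediateField.adjoin ℂ (({x f, y f} : Finset (DoubleCover f)) : Set (DoubleCover f)) :=
      IntermediateField.subset_adjoin _ _ (by simp)
    set L := IntermediateField.adjoin ℂ (({x f, y f} : Finset (DoubleCover f)) : Set (DoubleCover f))
    have hp : ∀ p : ℂ[X], AdjoinRoot.of (quad f) (algebraMap ℂ[X] (RatFunc ℂ) p) ∈ L := by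
      intro p
      rw [← aeval_x]
      exact Algebra.adjoin_le (S := L.toSubalgebra) (Set.singleton_subset_iff.2 hx)
        (aeval_mem_adjoin_singleton ℂ (x f))
    have hr : ∀ r : RatFunc ℂ, AdjoinRoot.of (quad f) r ∈ L := by
      intro r
      obtain ⟨p, q, _, rfl⟩ := IsFractionRing.div_surjective (A := ℂ[X]) r
      rw [map_div₀]
      exact L.div_mem (hp p) (hp q)
    induction z using AdjoinRoot.induction_on with
    | ih p =>
      induction p using Polynomial.induction_on' with
      | add p q hp hq => rw [map_add]; exact L.add_mem (hp trivial) (hq trivial)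
      | monomial n a =>
        rw [← C_mul_X_pow_eq_monomial, map_mul, map_pow, AdjoinRoot.mk_X, AdjoinRoot.mk_C]
        exact L.mul_mem (hr a) (pow_mem hy n)

/-- The homomorphism of `ℂ(x)[y] / (y² - f(x))` to a field `L` with `x ↦ a` and `y ↦ b`. -/
noncomputable def lift {L : Type} [Field L] [Algebra ℂ L] (a b : L) (ha : Transcendental ℂ a)
    (hab : b ^ 2 = aeval a f) : DoubleCover f →ₐ[ℂ] L :=
  AdjoinRoot.liftAlgHom (quad f)
    (RatFunc.liftAlgHom (aeval a)
      (nonZeroDivisors_le_comap_nonZeroDivisors_of_injective _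
        (transcendental_iff_injective.1 ha))) b (by
      simp only [quad, eval₂_sub, eval₂_pow, eval₂_X, eval₂_C]
      rw [hab, sub_eq_zero]
      have h := RatFunc.liftAlgHom_apply_div (aeval a)
        (nonZeroDivisors_le_comap_nonZeroDivisors_of_injective (aeval a : ℂ[X] →ₐ[ℂ] L)
        (transcendental_iff_injective.1 ha)) f 1
      simpa using h.symm)

theorem lift_x {L : Type} [Field L] [Algebra ℂ L] (a b : L) (ha : Transcendental ℂ a)
    (hab : b ^ 2 = aeval a f) : lift a b ha hab (x f) = a := by
  have h := RatFunc.liftAlgHom_apply_div (aeval a)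
    (nonZeroDivisors_le_comap_nonZeroDivisors_of_injective (aeval a : ℂ[X] →ₐ[ℂ] L)
    (transcendental_iff_injective.1 ha)) X 1
  rw [lift, x, AdjoinRoot.liftAlgHom_of]
  simpa using h

theorem lift_y {L : Type} [Field L] [Algebra ℂ L] (a b : L) (ha : Transcendental ℂ a)
    (hab : b ^ 2 = aeval a f) : lift a b ha hab (y f) = b :=
  AdjoinRoot.liftAlgHom_root ..

end DoubleCover
/-- The parameters of the family: `t` such that `(x³ - 1)(x³ - t¹²)` has six distinct nonzero roots,
and a primitive third root of unity `ζ`. -/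
structure Param where
  t : ℂ
  ζ : ℂ
  t_ne_zero : t ≠ 0
  t_pow_ne_one : t ^ 12 ≠ 1
  isPrimitiveRoot : IsPrimitiveRoot ζ 3

namespace Param

variable (p : Param)

/-- The numbers `u`, `v`, `w` are the squares of the values of `(x - t²) / (x + t²)` at `x = 1, ζ, ζ²`,
that is, the `x`-coordinates of the images on `E₁` and `E₂` of the Weierstrass points of `C`. -/
noncomputable def u : ℂ := ((1 - p.t ^ 2) / (1 + p.t ^ 2)) ^ 2
/-- The value belonging to `x = ζ`. -/
noncomputable def v : ℂ := ((p.ζ - p.t ^ 2) / (p.ζ + p.t ^ 2)) ^ 2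
/-- The value belonging to `x = ζ²`. -/
noncomputable def w : ℂ := ((p.ζ ^ 2 - p.t ^ 2) / (p.ζ ^ 2 + p.t ^ 2)) ^ 2

/-- `C : y² = (x³ - 1)(x³ - t¹²)` -/
noncomputable def polyC : ℂ[X] := (X ^ 3 - 1) * (X ^ 3 - C (p.t ^ 12))
/-- `E₁ : y² = (x - u)(x - v)(x - w)` -/
noncomputable def polyE₁ : ℂ[X] := (X - C p.u) * (X - C p.v) * (X - C p.w)
/-- `E₂ : y² = x(x - u)(x - v)(x - w)` -/
noncomputable def polyE₂ : ℂ[X] := X * (X - C p.u) * (X - C p.v) * (X - C p.w)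

/-- The function field of `C`. -/
abbrev FC : Type := DoubleCover p.polyC
/-- The function field of `E₁`. -/
abbrev FE₁ : Type := DoubleCover p.polyE₁
/-- The function field of `E₂`. -/
abbrev FE₂ : Type := DoubleCover p.polyE₂

theorem zeta_rel : p.ζ ^ 2 + p.ζ + 1 = 0 := by
  have h := p.isPrimitiveRoot.pow_eq_one
  have h1 := p.isPrimitiveRoot.ne_one (by norm_num)
  have : (p.ζ - 1) * (p.ζ ^ 2 + p.ζ + 1) = 0 := by linear_combination h
  exact (mul_eq_zero.1 this).resolve_left (sub_ne_zero.2 h1)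

theorem add_ne_zero_of_cube {a : ℂ} (ha : a ^ 3 = 1) : a + p.t ^ 2 ≠ 0 := by
  intro h
  apply p.t_pow_ne_one
  have h1 : p.t ^ 2 = -a := by linear_combination h
  have : p.t ^ 12 = (p.t ^ 2) ^ 6 := by ring
  rw [this, h1]
  linear_combination (a ^ 3 + 1) * ha

theorem sub_ne_zero_of_cube {a : ℂ} (ha : a ^ 3 = 1) : a - p.t ^ 2 ≠ 0 := by
  intro h
  apply p.t_pow_ne_one
  have h1 : p.t ^ 2 = a := by linear_combination -h
  have : p.t ^ 12 = (p.t ^ 2) ^ 6 := by ring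
  rw [this, h1]
  linear_combination (a ^ 3 + 1) * ha

theorem cube_ne {a : ℂ} (ha : a ^ 3 = 1) : p.t ^ 4 ≠ a := by
  intro h
  apply p.t_pow_ne_one
  have : p.t ^ 12 = (p.t ^ 4) ^ 3 := by ring
  rw [this, h, ha]

theorem zeta_cube : p.ζ ^ 3 = 1 := p.isPrimitiveRoot.pow_eq_one
theorem zeta_sq_cube : (p.ζ ^ 2) ^ 3 = 1 := by
  linear_combination (p.ζ ^ 3 + 1) * p.zeta_cube

theorem sq_sub_sq_ne_zero {a b : ℂ} (ha : a ^ 3 = 1) (hb : b ^ 3 = 1) (hab : a ≠ b) :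
    ((a - p.t ^ 2) / (a + p.t ^ 2)) ^ 2 - ((b - p.t ^ 2) / (b + p.t ^ 2)) ^ 2 ≠ 0 := by
  have h1 := p.add_ne_zero_of_cube ha
  have h2 := p.add_ne_zero_of_cube hb
  have h3 : p.t ^ 4 ≠ a * b := p.cube_ne (by rw [mul_pow, ha, hb, one_mul])
  have : ((a - p.t ^ 2) / (a + p.t ^ 2)) ^ 2 - ((b - p.t ^ 2) / (b + p.t ^ 2)) ^ 2 =
      4 * p.t ^ 2 * (a - b) * (a * b - p.t ^ 4) / ((a + p.t ^ 2) ^ 2 * (b + p.t ^ 2) ^ 2) := by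
    field_simp
    ring
  rw [this]
  exact div_ne_zero (mul_ne_zero (mul_ne_zero (mul_ne_zero (by norm_num)
    (pow_ne_zero 2 p.t_ne_zero)) (sub_ne_zero.2 hab)) (sub_ne_zero.2 h3.symm))
    (mul_ne_zero (pow_ne_zero 2 h1) (pow_ne_zero 2 h2))

theorem u_sub_v : p.u - p.v ≠ 0 :=
  p.sq_sub_sq_ne_zero (one_pow 3) p.zeta_cube (p.isPrimitiveRoot.ne_one (by norm_num)).symm

theorem u_sub_w : p.u - p.w ≠ 0 := by
  refine p.sq_sub_sq_ne_zero (one_pow 3) p.zeta_sq_cube fun h => ?_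
  exact p.isPrimitiveRoot.pow_ne_one_of_pos_of_lt (by norm_num) (by norm_num) h.symm

theorem u_ne_zero : p.u ≠ 0 :=
  pow_ne_zero _ (div_ne_zero (p.sub_ne_zero_of_cube (one_pow 3)) (p.add_ne_zero_of_cube (one_pow 3)))

instance : Fact (Irreducible (quad p.polyC)) := ⟨by
  apply quad_irreducible (a := 1) (g := (X ^ 2 + X + 1) * (X ^ 3 - C (p.t ^ 12)))
  · rw [polyC, C_1]; ring
  · simp only [eval_mul, eval_add, eval_sub, eval_pow, eval_X, eval_C, eval_one]
    have := sub_ne_zero.2 p.t_pow_ne_one.symm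
    refine mul_ne_zero (by norm_num) (by simpa using this)⟩

instance : Fact (Irreducible (quad p.polyE₁)) := ⟨by
  apply quad_irreducible (a := p.u) (g := (X - C p.v) * (X - C p.w))
  · rw [polyE₁]; ring
  · simpa using ⟨p.u_sub_v, p.u_sub_w⟩⟩

instance : Fact (Irreducible (quad p.polyE₂)) := ⟨by
  apply quad_irreducible (a := p.u) (g := X * (X - C p.v) * (X - C p.w))
  · rw [polyE₂]; ring
  · simpa using ⟨⟨p.u_ne_zero, p.u_sub_v⟩, p.u_sub_w⟩⟩

open DoubleCover

/-- A complex number as a constant function on `C`. -/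
noncomputable abbrev c (a : ℂ) : p.FC := algebraMap ℂ p.FC a

/-- The coordinate function `x` on `C`. -/
noncomputable abbrev xC : p.FC := x p.polyC
/-- The coordinate function `y` on `C`. -/
noncomputable abbrev yC : p.FC := y p.polyC

theorem yC_sq : p.yC ^ 2 = (p.xC ^ 3 - 1) * (p.xC ^ 3 - p.c (p.t ^ 12)) := by
  have h : ∀ a : p.FC, aeval a p.polyC = (a ^ 3 - 1) * (a ^ 3 - p.c (p.t ^ 12)) := by
    intro a; simp [polyC]
  rw [yC, y_sq, h]

theorem not_const (a : ℂ) : p.xC ≠ p.c a := fun h =>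
  x_transcendental (f := p.polyC) (by rw [← xC, h]; exact isAlgebraic_algebraMap a)

/-- The `x`-coordinate of `φ₁` and `φ₂`. -/
noncomputable def φx : p.FC := (p.xC - p.c (p.t ^ 2)) ^ 2 / (p.xC + p.c (p.t ^ 2)) ^ 2

/-- The `y`-coordinate of `φ₁`. -/
noncomputable def φy₁ : p.FC :=
  p.c (8 * p.t ^ 3) * p.yC / (p.c (p.t ^ 6 + 1) * (p.xC + p.c (p.t ^ 2)) ^ 3)

/-- The `y`-coordinate of `φ₂`. -/
noncomputable def φy₂ : p.FC :=
  p.c (8 * p.t ^ 3) * (p.xC - p.c (p.t ^ 2)) * p.yC /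
    (p.c (p.t ^ 6 + 1) * (p.xC + p.c (p.t ^ 2)) ^ 4)

theorem xC_add_ne_zero : p.xC + p.c (p.t ^ 2) ≠ 0 := fun h =>
  p.not_const (-p.t ^ 2) (by rw [c, map_neg]; exact eq_neg_of_add_eq_zero_left h)

theorem φx_transcendental : Transcendental ℂ p.φx := by
  intro h
  have hz : IsAlgebraic ℂ ((p.xC - p.c (p.t ^ 2)) / (p.xC + p.c (p.t ^ 2))) := by
    apply IsAlgebraic.of_pow (n := 2) two_pos
    rw [div_pow]; exact h
  have h1 := p.xC_add_ne_zero
  have : CharZero p.FC := charZero_of_injective_algebraMap (algebraMap ℂ p.FC).injective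
  have ht : p.c (p.t ^ 2) ≠ 0 := (_root_.map_ne_zero _).2 (pow_ne_zero 2 p.t_ne_zero)
  have hc : IsAlgebraic ℂ (p.c (p.t ^ 2)) := isAlgebraic_algebraMap _
  have h2 : p.xC = p.c (p.t ^ 2) * (1 + (p.xC - p.c (p.t ^ 2)) / (p.xC + p.c (p.t ^ 2))) *
      (1 - (p.xC - p.c (p.t ^ 2)) / (p.xC + p.c (p.t ^ 2)))⁻¹ := by
    have h3 : 1 - (p.xC - p.c (p.t ^ 2)) / (p.xC + p.c (p.t ^ 2)) =
        2 * p.c (p.t ^ 2) / (p.xC + p.c (p.t ^ 2)) := by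
      field_simp; ring
    rw [h3]
    field_simp
    ring
  apply x_transcendental (f := p.polyC)
  rw [← xC, h2]
  exact (hc.mul (isAlgebraic_one.add hz)).mul (isAlgebraic_one.sub hz).inv

theorem φx_sub {a : ℂ} (ha : a ^ 3 = 1) :
    p.φx - p.c (((a - p.t ^ 2) / (a + p.t ^ 2)) ^ 2) =
      4 * p.c p.t ^ 2 * (p.xC - p.c a) * (p.c a * p.xC - p.c p.t ^ 4) /
        ((p.xC + p.c p.t ^ 2) ^ 2 * (p.c a + p.c p.t ^ 2) ^ 2) := by
  have h1 := p.xC_add_ne_zero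
  have h2 : p.c (a + p.t ^ 2) ≠ 0 := (_root_.map_ne_zero _).2 (p.add_ne_zero_of_cube ha)
  simp only [φx, c, map_pow, map_add, map_sub, map_div₀] at h1 h2 ⊢
  field_simp
  ring

theorem equation_aux {F : Type} [Field F] (x s z : F) (hz : z ^ 2 + z + 1 = 0)
    (h1 : x + s ^ 2 ≠ 0) (h2 : 1 + s ^ 2 ≠ 0) (h3 : z + s ^ 2 ≠ 0) (h4 : z ^ 2 + s ^ 2 ≠ 0) :
    (8 * s ^ 3) ^ 2 * ((x ^ 3 - 1) * (x ^ 3 - s ^ 12)) / ((s ^ 6 + 1) * (x + s ^ 2) ^ 3) ^ 2 =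
      4 * s ^ 2 * (x - 1) * (1 * x - s ^ 4) / ((x + s ^ 2) ^ 2 * (1 + s ^ 2) ^ 2) *
      (4 * s ^ 2 * (x - z) * (z * x - s ^ 4) / ((x + s ^ 2) ^ 2 * (z + s ^ 2) ^ 2)) *
      (4 * s ^ 2 * (x - z ^ 2) * (z ^ 2 * x - s ^ 4) /
        ((x + s ^ 2) ^ 2 * (z ^ 2 + s ^ 2) ^ 2)) := by
  have e1 : x ^ 3 - 1 = (x - 1) * (x - z) * (x - z ^ 2) := by
    linear_combination -(x - 1) * (-x + z - 1) * hz
  have e2 : x ^ 3 - s ^ 12 = (1 * x - s ^ 4) * (z * x - s ^ 4) * (z ^ 2 * x - s ^ 4) := by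
    linear_combination -(x - s ^ 4) * ((z - 1) * x ^ 2 - s ^ 4 * x) * hz
  have e3 : s ^ 6 + 1 = (1 + s ^ 2) * (z + s ^ 2) * (z ^ 2 + s ^ 2) := by
    linear_combination -(1 + s ^ 2) * (s ^ 2 + z - 1) * hz
  rw [e1, e2, e3]
  field_simp
  ring

theorem φ₁_equation : p.φy₁ ^ 2 = aeval p.φx p.polyE₁ := by
  have h : aeval p.φx p.polyE₁ = (p.φx - p.c p.u) * (p.φx - p.c p.v) * (p.φx - p.c p.w) := by
    simp [polyE₁]
  have hu := p.φx_sub (one_pow 3)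
  have hv := p.φx_sub p.zeta_cube
  have hw := p.φx_sub p.zeta_sq_cube
  rw [← u] at hu
  rw [← v] at hv
  rw [← w] at hw
  rw [h, hu, hv, hw, φy₁, div_pow, mul_pow, yC_sq]
  have h1 := p.xC_add_ne_zero
  have h2 : p.c (1 + p.t ^ 2) ≠ 0 := (_root_.map_ne_zero _).2 (p.add_ne_zero_of_cube (one_pow 3))
  have h3 : p.c (p.ζ + p.t ^ 2) ≠ 0 := (_root_.map_ne_zero _).2 (p.add_ne_zero_of_cube p.zeta_cube)
  have h4 : p.c (p.ζ ^ 2 + p.t ^ 2) ≠ 0 := (_root_.map_ne_zero _).2 (p.add_ne_zero_of_cube p.zeta_sq_cube)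
  have hz : p.c p.ζ ^ 2 + p.c p.ζ + 1 = 0 := by
    rw [← map_pow, ← map_add, ← map_one (algebraMap ℂ p.FC), ← map_add, p.zeta_rel, map_zero]
  have h5 : p.c (p.t ^ 12) = p.c p.t ^ 12 := map_pow _ _ _
  rw [h5]
  simp only [c, map_pow, map_add, map_mul, map_one, map_ofNat] at h1 h2 h3 h4 hz ⊢
  exact equation_aux _ _ _ hz h1 h2 h3 h4

theorem φ₂_equation : p.φy₂ ^ 2 = aeval p.φx p.polyE₂ := by
  have h1 := p.xC_add_ne_zero
  have h : aeval p.φx p.polyE₂ = p.φx * aeval p.φx p.polyE₁ := by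
    simp [polyE₁, polyE₂, mul_assoc]
  have h2 : p.φy₂ = (p.xC - p.c (p.t ^ 2)) / (p.xC + p.c (p.t ^ 2)) * p.φy₁ := by
    rw [φy₁, φy₂, div_mul_div_comm]
    congr 1 <;> ring
  rw [h, ← φ₁_equation, h2, mul_pow, div_pow, φx]

theorem σ_transcendental : Transcendental ℂ (p.c p.ζ * p.xC) := by
  intro h
  apply x_transcendental (f := p.polyC)
  have hz : p.c p.ζ ≠ 0 := (_root_.map_ne_zero _).2 (p.isPrimitiveRoot.ne_zero (by norm_num))
  have h1 : xC p = (p.c p.ζ)⁻¹ * (p.c p.ζ * p.xC) := by field_simp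
  rw [← xC, h1]
  exact (isAlgebraic_algebraMap p.ζ).inv.mul h

theorem σ_equation : p.yC ^ 2 = aeval (p.c p.ζ * p.xC) p.polyC := by
  have h : p.c p.ζ ^ 3 = 1 := by rw [c, ← map_pow, p.zeta_cube, map_one]
  rw [yC_sq]
  simp [polyC, mul_pow, h]

/-- The morphism `φ₁ : C → E₁`, as a homomorphism of function fields
(see `φ₁_x`, `φ₁_y` for its values on the coordinates). -/
noncomputable def φ₁ : p.FE₁ →ₐ[ℂ] p.FC :=
  DoubleCover.lift p.φx p.φy₁ p.φx_transcendental p.φ₁_equation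

/-- The morphism `φ₂ : C → E₂`, as a homomorphism of function fields. -/
noncomputable def φ₂ : p.FE₂ →ₐ[ℂ] p.FC :=
  DoubleCover.lift p.φx p.φy₂ p.φx_transcendental p.φ₂_equation

/-- The automorphism `σ : (x, y) ↦ (ζx, y)` of `C`. -/
noncomputable def σ : p.FC →ₐ[ℂ] p.FC :=
  DoubleCover.lift (p.c p.ζ * p.xC) p.yC p.σ_transcendental p.σ_equation

theorem φ₁_x : p.φ₁ (x p.polyE₁) = (p.xC - p.c (p.t ^ 2)) ^ 2 / (p.xC + p.c (p.t ^ 2)) ^ 2 :=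
  lift_x ..

theorem φ₁_y : p.φ₁ (y p.polyE₁) =
    p.c (8 * p.t ^ 3) * p.yC / (p.c (p.t ^ 6 + 1) * (p.xC + p.c (p.t ^ 2)) ^ 3) :=
  lift_y ..

theorem φ₂_x : p.φ₂ (x p.polyE₂) = (p.xC - p.c (p.t ^ 2)) ^ 2 / (p.xC + p.c (p.t ^ 2)) ^ 2 :=
  lift_x ..

theorem φ₂_y : p.φ₂ (y p.polyE₂) = p.c (8 * p.t ^ 3) * (p.xC - p.c (p.t ^ 2)) * p.yC /
    (p.c (p.t ^ 6 + 1) * (p.xC + p.c (p.t ^ 2)) ^ 4) :=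
  lift_y ..

theorem σ_x : p.σ p.xC = p.c p.ζ * p.xC := lift_x ..

theorem σ_y : p.σ p.yC = p.yC := lift_y ..

end Param
end PoonenCurve

/-! Put `z = (x - t²)/(x + t²)`, let `Y` be the pull-back of `y` under `φ₁`, and set `r = 2t³/(1 +
t⁶)`, `n = r² - 1`. In these functions `C` is `Y² = (z² - 1)³ + r²(3z² + 1)²`. With `X = z²` this
makes `E₁` the member `m = 1` of the family `Y² = (X - m)³ + r²(3X + m)²`. Substituting `X = n/x`,
which moves `(0, 0)` to infinity, turns `E₂` into the member `m = n`. The lines `Y = ±r(3X + m)`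
meet the cubic only where `X = m`, so the points with `X = m` are flexes and have order three. Since
`z = -1` and `Y = 4r` at `0⁺`, both `T₁` and `T₂` are such flexes (`isPointC_zero_plus`,
`addOrderOf_flexForm`).

Each family member has an explicit 3-isogeny to the member with parameter `r² - m`, and this
exchanges `1` and `n`. Its `X`-coordinate has poles exactly at the origin and where `X = m`, so its
kernel is generated by a flex (`isPole_isogX_iff`, `ker_eq_zmultiples`). It remains to identify
`φ₁₂` and `φ₂₁` with these isogenies `ψ₁₂` and `ψ₂₁`.

The automorphism `σ` acts by `z ↦ (z + s)/(1 + sz)`, `Y ↦ -8Y/(1 + sz)³` with `s² = -3`. The general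
fibre of `φ₁` is `{Q, ιQ}`, where `ι` is `z ↦ -z`; that of `φ₂` is `{Q, τιQ}`, where `τ` is the
hyperelliptic involution. Hence `φ₁₂(P) = φ₂σQ + φ₂σιQ` up to a constant, and the constant is zero
because the two points over the origin are exchanged by `τ`. The third point on the chord through
`φ₂σQ` and `φ₂σιQ` turns out to be `-ψ₁₂(P)`; this is the polynomial identity `chord₁₂`, and
`chord₂₁` is its analogue in the other direction. The two homomorphisms agree at all but finitely
many points, hence everywhere (`hom_ext`).

Underneath lies the theory of curves given by function fields. Regular functions take complex values
(`exists_value`), and orders of norms are sums over fibres (`ord_norm`), which makes push-forward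
and pull-back descend to divisor classes. On a smooth cubic, chords and tangents make the
Abel–Jacobi map surjective (`abelJacobi_surjective`), and non-rationality makes it injective
(`abelJacobi_ne_zero`, `abelJacobi_injective`). -/

namespace PoonenCurve
open Polynomial IsDedekindDomain

set_option linter.unusedSectionVars false

/-! ### Orders, values and ramification at a point. -/

section Valuation

variable {K K' : Type} [Field K] [Algebra ℂ K] [Field K'] [Algebra ℂ K']

namespace Place

variable (P : Place K)

theorem val_le_one_iff {g : K} : P.val g ≤ 1 ↔ g ∈ P.ring := by
  constructor
  · intro h
    obtain ⟨a, rfl⟩ := IsDiscreteValuationRing.exists_lift_of_le_one (A := P.ring) h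
    exact a.2
  · intro h
    exact (IsDiscreteValuationRing.maximalIdeal P.ring).valuation_le_one (K := K) ⟨g, h⟩

theorem isPole_iff {g : K} : P.IsPole g ↔ g ∉ P.ring := by
  rw [IsPole, ← not_le, val_le_one_iff]

theorem val_const_le (c : ℂ) : P.val (algebraMap ℂ K c) ≤ 1 :=
  P.val_le_one_iff.2 (P.const_mem c)

theorem val_const {c : ℂ} (hc : c ≠ 0) : P.val (algebraMap ℂ K c) = 1 := by
  apply le_antisymm (P.val_const_le c)
  have h := P.val_const_le c⁻¹
  rw [map_inv₀, map_inv₀] at h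
  have h0 : P.val (algebraMap ℂ K c) ≠ 0 := by simpa using hc
  exact (inv_le_one₀ (zero_lt_iff.2 h0)).1 h

theorem val_eq_exp {g : K} (hg : g ≠ 0) : P.val g = WithZero.exp (-P.ord g) := by
  rw [ord, neg_neg, WithZero.exp_log ((Valuation.ne_zero_iff _).2 hg)]

theorem ord_eq_iff {g : K} (hg : g ≠ 0) {n : ℤ} : P.ord g = n ↔ P.val g = WithZero.exp (-n) := by
  rw [P.val_eq_exp hg, WithZero.exp_inj, neg_inj]

@[simp] theorem ord_zero : P.ord 0 = 0 := by simp [ord]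
@[simp] theorem ord_one : P.ord 1 = 0 := by simp [ord]

theorem ord_const (c : ℂ) : P.ord (algebraMap ℂ K c) = 0 := by
  rcases eq_or_ne c 0 with rfl | hc
  · simp
  · rw [ord, P.val_const hc]; simp

theorem ord_mul {g h : K} (hg : g ≠ 0) (hh : h ≠ 0) : P.ord (g * h) = P.ord g + P.ord h := by
  rw [ord, ord, ord, map_mul,
    WithZero.log_mul ((Valuation.ne_zero_iff _).2 hg) ((Valuation.ne_zero_iff _).2 hh)]
  ring

theorem ord_inv (g : K) : P.ord g⁻¹ = -P.ord g := by
  rw [ord, ord, map_inv₀, WithZero.log_inv]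

theorem ord_pow (g : K) (n : ℕ) : P.ord (g ^ n) = n * P.ord g := by
  rw [ord, ord, map_pow, WithZero.log_pow]; simp

theorem ord_neg (g : K) : P.ord (-g) = P.ord g := by
  rw [ord, ord, Valuation.map_neg]

theorem val_le_one_iff_ord {g : K} (hg : g ≠ 0) : P.val g ≤ 1 ↔ 0 ≤ P.ord g := by
  rw [P.val_eq_exp hg, ← WithZero.exp_zero, WithZero.exp_le_exp]; omega

theorem val_lt_one_iff_ord {g : K} (hg : g ≠ 0) : P.val g < 1 ↔ 0 < P.ord g := by
  rw [P.val_eq_exp hg, ← WithZero.exp_zero, WithZero.exp_lt_exp]; omega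

theorem one_lt_val_iff_ord {g : K} (hg : g ≠ 0) : 1 < P.val g ↔ P.ord g < 0 := by
  rw [P.val_eq_exp hg, ← WithZero.exp_zero, WithZero.exp_lt_exp]; omega

theorem IsPole.ne_zero {P : Place K} {g : K} (h : P.IsPole g) : g ≠ 0 := by
  rintro rfl; simp [IsPole] at h

theorem uniformizer_ord : P.ord P.uniformizer = 1 := P.exists_uniformizer.choose_spec

theorem uniformizer_ne_zero : P.uniformizer ≠ 0 := by
  intro h
  have := P.uniformizer_ord
  rw [h] at this; simp at this

/-- A surjective valuation with valuation ring `P.ring` is the normalized valuation of `P`. -/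
theorem val_unique (v : Valuation K (WithZero (Multiplicative ℤ))) (hs : Function.Surjective v)
    (h : ∀ g, v g ≤ 1 ↔ g ∈ P.ring) : v = P.val := by
  have hle : ∀ g, v g ≤ 1 ↔ P.val g ≤ 1 := fun g => (h g).trans P.val_le_one_iff.symm
  have heq1 : ∀ g, g ≠ 0 → (v g = 1 ↔ P.val g = 1) := by
    intro g hg
    have h1 := hle g
    have h2 := hle g⁻¹
    have a1 : 0 < v g := zero_lt_iff.2 ((Valuation.ne_zero_iff _).2 hg)
    have a2 : 0 < P.val g := zero_lt_iff.2 ((Valuation.ne_zero_iff _).2 hg)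
    rw [map_inv₀, map_inv₀, inv_le_one₀ a1, inv_le_one₀ a2] at h2
    constructor
    · intro hh; exact le_antisymm (h1.1 hh.le) (h2.1 hh.ge)
    · intro hh; exact le_antisymm (h1.2 hh.le) (h2.2 hh.ge)
  set π := P.uniformizer with hπ
  have hπ0 : π ≠ 0 := P.uniformizer_ne_zero
  have hvπ0 : v π ≠ 0 := (Valuation.ne_zero_iff _).2 hπ0
  set e := WithZero.log (v π) with he
  have hvπ : v π = WithZero.exp e := (WithZero.exp_log hvπ0).symm
  -- Dividing `g` by the right power of the uniformizer gives a unit of `P.ring`, and `v` is `1` on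
  -- units, so `v` is determined by its exponent `e` at the uniformizer.
  have key : ∀ g, g ≠ 0 → v g = WithZero.exp (P.ord g * e) := by
    intro g hg
    have h1 : P.val (g * π ^ (-P.ord g)) = 1 := by
      rw [map_mul, map_zpow₀, P.val_eq_exp hg, P.val_eq_exp hπ0, hπ, P.uniformizer_ord,
        ← WithZero.exp_zsmul, ← WithZero.exp_add]
      simp
    have h2 := (heq1 _ (mul_ne_zero hg (zpow_ne_zero _ hπ0))).2 h1
    rw [map_mul, map_zpow₀, hvπ, ← WithZero.exp_zsmul] at h2
    have h3 : v g = (WithZero.exp ((-P.ord g) • e))⁻¹ := eq_inv_of_mul_eq_one_left h2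
    rw [h3, ← WithZero.exp_neg]; simp
  obtain ⟨g, hg⟩ := hs (WithZero.exp (-1))
  have hg0 : g ≠ 0 := by
    rintro rfl; rw [map_zero] at hg; exact WithZero.exp_ne_zero hg.symm
  rw [key g hg0, WithZero.exp_inj] at hg
  have hneg : e ≤ 0 := by
    have : v π ≤ 1 := (hle π).2 ((P.val_le_one_iff_ord hπ0).2 (by rw [P.uniformizer_ord]; norm_num))
    rw [hvπ, ← WithZero.exp_zero, WithZero.exp_le_exp] at this
    exact this
  -- Surjectivity of `v` makes `e` a divisor of `-1`; the sign is fixed because the uniformizer is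
  -- regular.
  have he1 : e = -1 := by
    have : e ∣ -1 := ⟨P.ord g, by rw [← hg]; ring⟩
    have := Int.isUnit_iff.1 (isUnit_of_dvd_unit this (by decide))
    omega
  ext g
  rcases eq_or_ne g 0 with rfl | hg
  · simp
  · rw [key g hg, he1, P.val_eq_exp hg]; simp

/-! Values of functions at a point. -/

namespace HasValue

variable {P} {g h : K} {a b : ℂ}

theorem mem (hg : P.HasValue g a) : g ∈ P.ring := by
  rw [← P.val_le_one_iff]
  have : g = (g - algebraMap ℂ K a) + algebraMap ℂ K a := by ring
  rw [this]
  exact (P.val.map_add _ _).trans (max_le (le_of_lt hg) (P.val_const_le a))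

theorem const (P : Place K) (a : ℂ) : P.HasValue (algebraMap ℂ K a) a := by
  simp [HasValue]

theorem add (hg : P.HasValue g a) (hh : P.HasValue h b) : P.HasValue (g + h) (a + b) := by
  have : g + h - algebraMap ℂ K (a + b) = (g - algebraMap ℂ K a) + (h - algebraMap ℂ K b) := by
    rw [map_add]; ring
  rw [HasValue, this]
  exact P.val.map_add_lt hg hh

theorem mul (hg : P.HasValue g a) (hh : P.HasValue h b) : P.HasValue (g * h) (a * b) := by
  have : g * h - algebraMap ℂ K (a * b) =
      g * (h - algebraMap ℂ K b) + algebraMap ℂ K b * (g - algebraMap ℂ K a) := by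
    rw [map_mul]; ring
  rw [HasValue, this]
  apply P.val.map_add_lt
  · rw [map_mul]
    exact mul_lt_one_of_nonneg_of_lt_one_right (P.val_le_one_iff.2 hg.mem) zero_le hh
  · rw [map_mul]
    exact mul_lt_one_of_nonneg_of_lt_one_right (P.val_const_le b) zero_le hg

theorem neg (hg : P.HasValue g a) : P.HasValue (-g) (-a) := by
  have := (HasValue.const P (-1)).mul hg
  simpa using this

theorem sub (hg : P.HasValue g a) (hh : P.HasValue h b) : P.HasValue (g - h) (a - b) := by
  rw [sub_eq_add_neg, sub_eq_add_neg]; exact hg.add hh.neg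

theorem pow (hg : P.HasValue g a) (n : ℕ) : P.HasValue (g ^ n) (a ^ n) := by
  induction n with
  | zero => simpa using HasValue.const P 1
  | succ n ih => rw [pow_succ, pow_succ]; exact ih.mul hg

theorem val_eq_one (hg : P.HasValue g a) (ha : a ≠ 0) : P.val g = 1 := by
  have h1 := P.val_const ha
  have : g = (g - algebraMap ℂ K a) + algebraMap ℂ K a := by ring
  rw [this, Valuation.map_add_eq_of_lt_right _ (by rw [h1]; exact hg), h1]

theorem ne_zero (hg : P.HasValue g a) (ha : a ≠ 0) : g ≠ 0 := by
  rintro rfl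
  have := hg.val_eq_one ha
  simp at this

theorem ord_eq_zero (hg : P.HasValue g a) (ha : a ≠ 0) : P.ord g = 0 := by
  rw [ord, hg.val_eq_one ha]; simp

theorem inv (hg : P.HasValue g a) (ha : a ≠ 0) : P.HasValue g⁻¹ a⁻¹ := by
  have h0 := hg.ne_zero ha
  have h1 : algebraMap ℂ K a ≠ 0 := by simpa using ha
  have : g⁻¹ - algebraMap ℂ K a⁻¹ = -(g - algebraMap ℂ K a) * (g⁻¹ * (algebraMap ℂ K a)⁻¹) := by
    rw [map_inv₀]; field_simp; ring
  rw [HasValue, this, map_mul, map_mul, Valuation.map_neg, map_inv₀, map_inv₀, hg.val_eq_one ha,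
    P.val_const ha, inv_one, one_mul, mul_one]
  exact hg

theorem div (hg : P.HasValue g a) (hh : P.HasValue h b) (hb : b ≠ 0) :
    P.HasValue (g / h) (a / b) := by
  rw [div_eq_mul_inv, div_eq_mul_inv]; exact hg.mul (hh.inv hb)

theorem unique (hg : P.HasValue g a) (hg' : P.HasValue g b) : a = b := by
  have h := hg.sub hg'
  by_contra hab
  have := h.val_eq_one (sub_ne_zero.2 hab)
  simp at this

theorem not_isPole (hg : P.HasValue g a) : ¬ P.IsPole g := by
  rw [P.isPole_iff, not_not]; exact hg.mem

end HasValue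

theorem hasValue_zero_iff {g : K} : P.HasValue g 0 ↔ P.val g < 1 := by
  simp [HasValue]

theorem IsPole.inv {P : Place K} {g : K} (h : P.IsPole g) : P.HasValue g⁻¹ 0 := by
  rw [hasValue_zero_iff, map_inv₀]
  exact inv_lt_one_of_one_lt₀ h

theorem HasValue.inv_isPole {P : Place K} {g : K} (h : P.HasValue g 0) (hg : g ≠ 0) :
    P.IsPole g⁻¹ := by
  rw [hasValue_zero_iff] at h
  rw [IsPole, map_inv₀]
  exact (one_lt_inv₀ (zero_lt_iff.2 ((Valuation.ne_zero_iff _).2 hg))).2 h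

theorem HasValue.of_pow_zero {P : Place K} {g : K} {n : ℕ} (h : P.HasValue (g ^ n) 0) :
    P.HasValue g 0 := by
  rw [hasValue_zero_iff, map_pow] at h
  rw [hasValue_zero_iff]
  by_contra hc
  exact absurd h (not_lt.2 (one_le_pow₀ (not_lt.1 hc)))

theorem mem_of_pow_mem {g : K} {n : ℕ} (hn : n ≠ 0) (h : g ^ n ∈ P.ring) : g ∈ P.ring := by
  rw [← val_le_one_iff, map_pow] at h
  rw [← val_le_one_iff]
  by_contra hc
  exact absurd h (not_le.2 (one_lt_pow₀ (not_le.1 hc) hn))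

variable [IsCurveField K] [IsCurveField K']

theorem mem_map_ring (φ : K' →ₐ[ℂ] K) {g : K'} : g ∈ (P.map φ).ring ↔ φ g ∈ P.ring := Iff.rfl

theorem map_isPole_iff (φ : K' →ₐ[ℂ] K) {g : K'} : (P.map φ).IsPole g ↔ P.IsPole (φ g) := by
  rw [isPole_iff, isPole_iff, mem_map_ring]

/-- The image point is defined by its valuation ring alone, so the strict inequality `val < 1` is
first rewritten as a condition on membership of the inverse in the ring. -/
theorem map_hasValue_iff (φ : K' →ₐ[ℂ] K) {g : K'} {a : ℂ} :
    (P.map φ).HasValue g a ↔ P.HasValue (φ g) a := by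
  have key : ∀ {F : Type} [Field F] [Algebra ℂ F] (Q : Place F) (h : F), Q.val h < 1 ↔
      h = 0 ∨ h⁻¹ ∉ Q.ring := by
    intro F _ _ Q h
    rcases eq_or_ne h 0 with rfl | h0
    · simp
    · rw [← Q.val_le_one_iff, map_inv₀,
        inv_le_one₀ (zero_lt_iff.2 ((Valuation.ne_zero_iff _).2 h0))]
      simp [h0]
  rw [HasValue, HasValue, key, key, mem_map_ring]
  have : φ (g - algebraMap ℂ K' a) = φ g - algebraMap ℂ K a := by
    rw [map_sub, AlgHom.commutes]
  rw [map_inv₀, this, ← this, map_eq_zero]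

theorem map_map {K'' : Type} [Field K''] [Algebra ℂ K''] [IsCurveField K''] (φ : K' →ₐ[ℂ] K)
    (ψ : K'' →ₐ[ℂ] K') : (P.map φ).map ψ = P.map (φ.comp ψ) := by
  apply Place.ext
  ext g
  rfl

/-- Orders pull back by multiplication with the ramification index. -/
theorem ord_map (φ : K' →ₐ[ℂ] K) {g : K'} (hg : g ≠ 0) :
    P.ord (φ g) = P.ramificationIndex φ * (P.map φ).ord g := by
  set Q := P.map φ
  set π := Q.uniformizer
  have hπ0 : π ≠ 0 := Q.uniformizer_ne_zero
  set n := Q.ord g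
  have h1 : Q.val (g * π ^ (-n)) = 1 := by
    rw [map_mul, map_zpow₀, Q.val_eq_exp hg, Q.val_eq_exp hπ0, Q.uniformizer_ord,
      ← WithZero.exp_zsmul, ← WithZero.exp_add]
    simp [n]
  set u := g * π ^ (-n) with hu
  have hu0 : u ≠ 0 := mul_ne_zero hg (zpow_ne_zero _ hπ0)
  -- A unit at the image point pulls back to a unit at `P`; only the power of the uniformizer
  -- contributes to the order.
  have h2 : P.val (φ u) = 1 := by
    have hP0 : 0 < P.val (φ u) :=
      zero_lt_iff.2 ((Valuation.ne_zero_iff _).2 ((map_ne_zero φ).2 hu0))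
    apply le_antisymm
    · rw [P.val_le_one_iff, ← P.mem_map_ring φ, ← val_le_one_iff]; exact h1.le
    · rw [← inv_le_one₀ hP0, ← map_inv₀, ← map_inv₀, P.val_le_one_iff, ← P.mem_map_ring φ,
        ← val_le_one_iff, map_inv₀, inv_le_one₀]
      · exact h1.ge
      · exact zero_lt_iff.2 ((Valuation.ne_zero_iff _).2 hu0)
  have h3 : g = u * π ^ n := by
    rw [hu, zpow_neg]; field_simp
  have h4 : WithZero.log (P.val (φ g)) = n * WithZero.log (P.val (φ π)) := by
    rw [h3, map_mul, map_mul, h2, one_mul, map_zpow₀, map_zpow₀, WithZero.log_zpow]; simp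
  rw [ramificationIndex, ord, h4, ord]; ring

theorem ramificationIndex_pos (φ : K' →ₐ[ℂ] K) : 0 < P.ramificationIndex φ := by
  have h : (P.map φ).HasValue (P.map φ).uniformizer 0 := by
    rw [hasValue_zero_iff, val_lt_one_iff_ord _ (uniformizer_ne_zero _), uniformizer_ord]
    norm_num
  rw [map_hasValue_iff, hasValue_zero_iff, val_lt_one_iff_ord] at h
  · exact h
  · exact (map_ne_zero φ).2 (uniformizer_ne_zero _)

end Place

end Valuation

noncomputable instance : IsCurveField (RatFunc ℂ) where
  trdeg_eq_one := by
    have h2 := trdeg_add_eq ℂ ℂ[X] (A := RatFunc ℂ)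
    have h3 : Algebra.trdeg ℂ[X] (RatFunc ℂ) = 0 := by
      have : Algebra.IsAlgebraic ℂ[X] (RatFunc ℂ) :=
        IsLocalization.isAlgebraic _ (nonZeroDivisors ℂ[X])
      exact trdeg_eq_zero
    rw [← h2, h3]
    simp
  fg := ⟨{RatFunc.X}, by simpa using RatFunc.adjoin_X (K := ℂ)⟩

/-! ### Regular functions have complex values. -/

section Transcendental

variable {K : Type} [Field K] [Algebra ℂ K]

/-- The homomorphism `ℂ(X) → K` that sends `X` to a transcendental element. -/
noncomputable def ratLift (a : K) (ha : Transcendental ℂ a) : RatFunc ℂ →ₐ[ℂ] K :=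
  RatFunc.liftAlgHom (aeval a)
    (nonZeroDivisors_le_comap_nonZeroDivisors_of_injective _ (transcendental_iff_injective.1 ha))

theorem ratLift_algebraMap {a : K} (ha : Transcendental ℂ a) (q : ℂ[X]) :
    ratLift a ha (algebraMap ℂ[X] (RatFunc ℂ) q) = aeval a q := by
  have h := RatFunc.liftAlgHom_apply_div (aeval a)
    (nonZeroDivisors_le_comap_nonZeroDivisors_of_injective (aeval a : ℂ[X] →ₐ[ℂ] K)
    (transcendental_iff_injective.1 ha)) q 1
  simpa [ratLift] using h

theorem ratLift_X {a : K} (ha : Transcendental ℂ a) : ratLift a ha RatFunc.X = a := by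
  rw [← RatFunc.algebraMap_X, ratLift_algebraMap, aeval_X]

/-- An algebraic element has a linear minimal polynomial, because `ℂ` is algebraically closed. -/
theorem transcendental_of_not_const {g : K} (hg : ∀ c : ℂ, g ≠ algebraMap ℂ K c) :
    Transcendental ℂ g := by
  intro h
  have h1 : (minpoly ℂ g).degree = 1 :=
    IsAlgClosed.degree_eq_one_of_irreducible ℂ (minpoly.irreducible h.isIntegral)
  obtain ⟨c, hc⟩ := minpoly.mem_range_of_degree_eq_one ℂ g h1
  exact hg c hc.symm

namespace Place

variable (P : Place K)

theorem transcendental_of_ord_ne_zero {g : K} (hg : P.ord g ≠ 0) : Transcendental ℂ g :=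
  transcendental_of_not_const (by rintro c rfl; exact hg (P.ord_const c))

variable [IsCurveField K]

/-- A function that is regular at a point has a value there. -/
theorem exists_value {g : K} (hg : g ∈ P.ring) : ∃ c, P.HasValue g c := by
  set π := P.uniformizer
  have hπt : Transcendental ℂ π := P.transcendental_of_ord_ne_zero (by rw [P.uniformizer_ord]; simp)
  have hπmem : π ∈ P.ring := by
    rw [← val_le_one_iff, P.val_le_one_iff_ord P.uniformizer_ne_zero, P.uniformizer_ord]; norm_num
  -- an algebraic relation between `g` and `π`
  obtain ⟨Q, hQ0, hQ⟩ : ∃ Q : ℂ[X][X], Q ≠ 0 ∧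
      eval₂ (aeval π : ℂ[X] →ₐ[ℂ] K).toRingHom g Q = 0 := by
    let _ := (ratLift π hπt).toRingHom.toAlgebra
    let _ := (aeval π : ℂ[X] →ₐ[ℂ] K).toRingHom.toAlgebra
    have hint := isAlgebraic_of_hom (ratLift π hπt) g
    have : IsScalarTower ℂ[X] (RatFunc ℂ) K :=
      IsScalarTower.of_algebraMap_eq fun q => (ratLift_algebraMap hπt q).symm
    have halg : IsAlgebraic (RatFunc ℂ) g := IsIntegral.isAlgebraic hint
    rw [← IsFractionRing.isAlgebraic_iff ℂ[X] (RatFunc ℂ) K] at halg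
    exact halg
  -- The content is removed so that the relation stays nonzero after setting `π = 0`.
  set Q' := Q.primPart
  have hQ' : eval₂ (aeval π : ℂ[X] →ₐ[ℂ] K).toRingHom g Q' = 0 :=
    eval₂_primPart_eq_zero (fun a b h => transcendental_iff_injective.1 hπt h) hQ0 hQ
  -- reduction modulo the maximal ideal
  let ι : ℂ →+* P.ring := (algebraMap ℂ K).codRestrict P.ring.toSubring P.const_mem
  let res := IsLocalRing.residue P.ring
  let π' : P.ring := ⟨π, hπmem⟩
  let g' : P.ring := ⟨g, hg⟩
  have hres : ∀ a : P.ring, res a = 0 ↔ P.val a < 1 := by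
    intro a
    rw [IsLocalRing.residue_eq_zero_iff, ← not_iff_not]
    rw [IsLocalRing.notMem_maximalIdeal, not_lt]
    constructor
    · intro hu
      obtain ⟨b, hb⟩ := hu.exists_right_inv
      have h1 := congrArg (fun z : P.ring => P.val (z : K)) hb
      simp only [MulMemClass.coe_mul, OneMemClass.coe_one, map_mul, map_one] at h1
      rw [← h1]
      exact mul_le_of_le_one_right' (P.val_le_one_iff.2 b.2)
    · intro hle
      have ha0 : (a : K) ≠ 0 := by intro h; rw [h] at hle; simp at hle
      have hb : (a : K)⁻¹ ∈ P.ring := by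
        rw [← val_le_one_iff, map_inv₀]; exact inv_le_one_of_one_le₀ hle
      exact IsUnit.of_mul_eq_one ⟨_, hb⟩ (Subtype.ext (mul_inv_cancel₀ ha0))
  let α : ℂ[X] →+* P.ring := eval₂RingHom ι π'
  have hα : P.ring.subtype.comp α = (aeval π : ℂ[X] →ₐ[ℂ] K).toRingHom := by
    apply Polynomial.ringHom_ext
    · intro c
      simp only [α, RingHom.comp_apply, coe_eval₂RingHom, eval₂_C, AlgHom.toRingHom_eq_coe,
        RingHom.coe_coe, aeval_C]
      rfl
    · simp only [α, RingHom.comp_apply, coe_eval₂RingHom, eval₂_X, AlgHom.toRingHom_eq_coe,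
        RingHom.coe_coe, aeval_X]
      rfl
  have h1 : eval₂ α g' Q' = 0 := by
    apply P.ring.subtype_injective
    rw [hom_eval₂, hα, map_zero]
    exact hQ'
  have h2 : eval₂ (res.comp α) (res g') Q' = 0 := by
    rw [← hom_eval₂, h1, map_zero]
  -- The uniformizer reduces to zero, so each coefficient, a polynomial in `π`, reduces to its
  -- constant term.
  have h3 : res.comp α = (res.comp ι).comp (evalRingHom 0) := by
    apply Polynomial.ringHom_ext
    · intro c; simp [α]
    · have : res π' = 0 := (hres π').2 (by
        rw [P.val_lt_one_iff_ord P.uniformizer_ne_zero, P.uniformizer_ord]; norm_num)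
      simp [α, this]
  set q : ℂ[X] := Q'.map (evalRingHom 0)
  have h4 : eval₂ (res.comp ι) (res g') q = 0 := by
    rw [eval₂_map, ← h3, h2]
  -- If all constant terms vanished, the variable would divide every coefficient of a primitive
  -- polynomial.
  have hq : q ≠ 0 := by
    intro h
    have hX : C (X : ℂ[X]) ∣ Q' := by
      rw [C_dvd_iff_dvd_coeff]
      intro i
      have := congrArg (fun p => coeff p i) h
      simp only [q, coeff_map, coeff_zero, coe_evalRingHom] at this
      rw [X_dvd_iff, coeff_zero_eq_eval_zero, this]
    have := Q.isPrimitive_primPart X hX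
    exact not_isUnit_X this
  -- The residue of `g` is a root of a nonzero polynomial that already splits over `ℂ`, hence it is
  -- the residue of a constant.
  have hsplit := IsAlgClosed.splits q
  have h5 : ((q.map (res.comp ι)).roots).map id = (q.roots.map (res.comp ι)) := by
    rw [Multiset.map_id]; exact (hsplit.roots_map (res.comp ι))
  have h6 : res g' ∈ (q.map (res.comp ι)).roots := by
    rw [mem_roots (map_ne_zero hq), IsRoot, eval_map, h4]
  rw [Multiset.map_id] at h5
  rw [h5, Multiset.mem_map] at h6
  obtain ⟨c, -, hc⟩ := h6
  refine ⟨c, ?_⟩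
  have h7 : res (g' - ι c) = 0 := by
    rw [map_sub, ← hc]; simp
  exact (hres _).1 h7

theorem exists_value_of_not_isPole {g : K} (hg : ¬ P.IsPole g) : ∃ c, P.HasValue g c :=
  P.exists_value (by rwa [isPole_iff, not_not] at hg)

end Place

end Transcendental

/-! ### Norms and valuations in finite extensions of a discrete valuation ring. -/

theorem liesOver_maximalIdeal {A B : Type} [CommRing A] [IsDomain A] [IsDiscreteValuationRing A]
    [CommRing B] [IsDedekindDomain B] [Algebra A B] [Algebra.IsIntegral A B]
    (v : HeightOneSpectrum B) :
    v.asIdeal.LiesOver (IsDiscreteValuationRing.maximalIdeal A).asIdeal := by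
  refine ⟨?_⟩
  have := v.isMaximal
  have h : (v.asIdeal.under A).IsMaximal :=
    Ideal.isMaximal_comap_of_isIntegral_of_isMaximal v.asIdeal
  exact (IsLocalRing.eq_maximalIdeal h).symm

theorem finite_heightOneSpectrum (A B : Type) [CommRing A] [IsDomain A] [IsDiscreteValuationRing A]
    [CommRing B] [IsDedekindDomain B] [Algebra A B] [Algebra.IsIntegral A B]
    [Module.IsTorsionFree A B] : Finite (HeightOneSpectrum B) := by
  have hl := fun v : HeightOneSpectrum B => liesOver_maximalIdeal (A := A) v
  have hfin := IsDedekindDomain.primesOver_finite (IsDiscreteValuationRing.maximalIdeal A).asIdeal B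
  have := hfin.to_subtype
  refine Finite.of_injective (β := (IsDiscreteValuationRing.maximalIdeal A).asIdeal.primesOver B)
    (fun v => ⟨v.asIdeal, v.isPrime, hl v⟩) ?_
  intro v w h
  exact HeightOneSpectrum.ext (congrArg Subtype.val h)

section Norm

variable {A F B K : Type} [CommRing A] [IsDomain A] [IsDiscreteValuationRing A] [Field F]
  [Algebra A F] [IsFractionRing A F] [CommRing B] [IsDedekindDomain B] [Algebra A B]
  [Module.Finite A B] [Module.IsTorsionFree A B] [Field K] [Algebra B K] [IsFractionRing B K]
  [Algebra F K] [Algebra A K] [IsScalarTower A F K] [IsScalarTower A B K] [IsIntegralClosure B A K]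
  [FiniteDimensional F K]

/-- Factor the ideal `(b)` into primes of `B`. With inertia degree one, the relative norm of each
prime is the maximal ideal of `A`, so the exponents simply add up. -/
theorem log_intValuation_intNorm [CharZero F] [Fintype (HeightOneSpectrum B)]
    (hf : ∀ v : HeightOneSpectrum B, v.asIdeal.inertiaDeg A = 1) {b : B} (hb : b ≠ 0) :
    WithZero.log ((IsDiscreteValuationRing.maximalIdeal A).intValuation (Algebra.intNorm A B b)) =
      ∑ v : HeightOneSpectrum B, WithZero.log (v.intValuation b) := by
  classical
  set m := IsDiscreteValuationRing.maximalIdeal A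
  have : CharZero A := (algebraMap A F).charZero
  have : CharZero (FractionRing A) :=
    charZero_of_injective_algebraMap (FaithfulSMul.algebraMap_injective A (FractionRing A))
  have hI : Ideal.span {b} ≠ (0 : Ideal B) := by simpa using hb
  have h1 := Ideal.finprod_heightOneSpectrum_factorization hI
  rw [finprod_eq_prod_of_fintype] at h1
  have h2 := congrArg (Ideal.relNorm A) h1
  rw [Ideal.relNorm_singleton, map_prod] at h2
  set k : HeightOneSpectrum B → ℕ := fun v =>
    (Associates.mk v.asIdeal).count (Associates.mk (Ideal.span {b})).factors with hk
  have h3 : ∀ v : HeightOneSpectrum B,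
      Ideal.relNorm A (v.maxPowDividing (Ideal.span {b})) = m.asIdeal ^ k v := by
    intro v
    have := v.isMaximal
    have := liesOver_maximalIdeal (A := A) v
    have : m.asIdeal.IsMaximal := m.isMaximal
    rw [HeightOneSpectrum.maxPowDividing, map_pow,
      Ideal.relNorm_eq_pow_of_isMaximal v.asIdeal m.asIdeal, hf v, pow_one]
  simp_rw [h3] at h2
  rw [Finset.prod_pow_eq_pow_sum] at h2
  have h4 : ∀ v : HeightOneSpectrum B, WithZero.log (v.intValuation b) = -(k v : ℤ) := by
    intro v
    rw [HeightOneSpectrum.intValuation_if_neg _ hb, WithZero.log_exp]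
  simp_rw [h4]
  rw [Finset.sum_neg_distrib, ← Nat.cast_sum]
  set n := ∑ v, k v
  -- The norm generates the `n`-th power of the maximal ideal: it lies in that power but not in the
  -- next one.
  have h5 : m.intValuation (Algebra.intNorm A B b) ≤ WithZero.exp (-(n : ℤ)) := by
    rw [HeightOneSpectrum.intValuation_le_pow_iff_mem, h2]
    exact Ideal.mem_span_singleton_self _
  have h6 : ¬ m.intValuation (Algebra.intNorm A B b) ≤ WithZero.exp (-((n + 1 : ℕ) : ℤ)) := by
    rw [HeightOneSpectrum.intValuation_le_pow_iff_mem, ← Ideal.span_singleton_le_iff_mem, ← h2]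
    intro hle
    exact (Ideal.pow_right_strictAnti m.asIdeal m.ne_bot m.isPrime.ne_top
      (Nat.lt_succ_self n)).not_ge hle
  have h0 : m.intValuation (Algebra.intNorm A B b) ≠ 0 := by
    intro h; rw [h] at h6; exact h6 zero_le
  rw [← WithZero.log_le_iff_le_exp h0] at h5 h6
  push_cast at h6
  omega

/-- Both sides are multiplicative in `g`, so fractions reduce to elements of `B`. -/
theorem log_valuation_norm [CharZero F] [Fintype (HeightOneSpectrum B)]
    (hf : ∀ v : HeightOneSpectrum B, v.asIdeal.inertiaDeg A = 1) {g : K} (hg : g ≠ 0) :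
    WithZero.log ((IsDiscreteValuationRing.maximalIdeal A).valuation F (Algebra.norm F g)) =
      ∑ v : HeightOneSpectrum B, WithZero.log (v.valuation K g) := by
  have key : ∀ b : B, b ≠ 0 →
      WithZero.log ((IsDiscreteValuationRing.maximalIdeal A).valuation F
        (Algebra.norm F (algebraMap B K b))) =
      ∑ v : HeightOneSpectrum B, WithZero.log (v.valuation K (algebraMap B K b)) := by
    intro b hb
    rw [← Algebra.algebraMap_intNorm (A := A), HeightOneSpectrum.valuation_of_algebraMap,
      log_intValuation_intNorm (F := F) hf hb]
    simp_rw [HeightOneSpectrum.valuation_of_algebraMap]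
  obtain ⟨a, b, hb, rfl⟩ := IsFractionRing.div_surjective (A := B) g
  have hb0 : b ≠ 0 := nonZeroDivisors.ne_zero hb
  have ha0 : a ≠ 0 := by rintro rfl; simp at hg
  have ha1 : algebraMap B K a ≠ 0 := by simpa using ha0
  have hb1 : algebraMap B K b ≠ 0 := by simpa using hb0
  have hn : Algebra.norm F (algebraMap B K a / algebraMap B K b) =
      Algebra.norm F (algebraMap B K a) / Algebra.norm F (algebraMap B K b) := by
    rw [eq_div_iff (Algebra.norm_ne_zero_iff.2 hb1), ← map_mul, div_mul_cancel₀ _ hb1]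
  rw [hn, map_div₀, WithZero.log_div, key a ha0, key b hb0, ← Finset.sum_sub_distrib]
  · refine Finset.sum_congr rfl fun v _ => ?_
    rw [map_div₀, WithZero.log_div]
    · exact (Valuation.ne_zero_iff _).2 ha1
    · exact (Valuation.ne_zero_iff _).2 hb1
  · exact (Valuation.ne_zero_iff _).2 (Algebra.norm_ne_zero_iff.2 ha1)
  · exact (Valuation.ne_zero_iff _).2 (Algebra.norm_ne_zero_iff.2 hb1)

end Norm

/-! ### Points of a curve as primes of a Dedekind domain. -/

section Place

variable {F K B : Type} [Field K] [Algebra ℂ K] [CommRing B] [IsDedekindDomain B] [Algebra B K]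
  [IsFractionRing B K]

/-- The point given by a prime ideal of a Dedekind domain of functions. -/
noncomputable def placeOfPrime (v : HeightOneSpectrum B)
    (hc : ∀ c : ℂ, v.valuation K (algebraMap ℂ K c) ≤ 1) : Place K where
  ring := (v.valuation K).valuationSubring
  const_mem := hc
  dvr := by
    rw [← HeightOneSpectrum.valuationSubringAtPrime_eq_valuationSubring]
    exact IsLocalization.AtPrime.isDiscreteValuationRing_of_dedekind_domain B v.ne_bot _

theorem placeOfPrime_val (v : HeightOneSpectrum B)
    (hc : ∀ c : ℂ, v.valuation K (algebraMap ℂ K c) ≤ 1) :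
    (placeOfPrime v hc).val = v.valuation K :=
  ((placeOfPrime v hc).val_unique _ (v.valuation_surjective K) fun _ => Iff.rfl).symm

theorem place_ring_ne_top (P : Place K) : P.ring ≠ ⊤ := by
  intro h
  have : P.uniformizer⁻¹ ∈ P.ring := by rw [h]; trivial
  rw [← P.val_le_one_iff, P.val_le_one_iff_ord (inv_ne_zero P.uniformizer_ne_zero), P.ord_inv,
    P.uniformizer_ord] at this
  norm_num at this

/-- A discrete valuation ring is a maximal proper subring of its fraction field. -/
theorem Place.eq_of_ring_le {P Q : Place K} (h : P.ring ≤ Q.ring) : P = Q :=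
  Place.ext (ValuationSubring.eq_of_le_of_ne_top _ h (place_ring_ne_top Q))

/-- The center of a point on a Dedekind domain of functions that are regular there. -/
theorem exists_prime_of_place (P : Place K) (hB : ∀ b : B, algebraMap B K b ∈ P.ring) :
    ∃ v : HeightOneSpectrum B, v.valuation K = P.val := by
  let α : B →+* P.ring := (algebraMap B K).codRestrict P.ring.toSubring hB
  let I : Ideal B := (IsLocalRing.maximalIdeal P.ring).comap α
  have hmem : ∀ b : B, b ∈ I ↔ P.val (algebraMap B K b) < 1 := by
    intro b
    have := (IsDiscreteValuationRing.maximalIdeal P.ring).valuation_lt_one_iff_mem (K := K) (α b)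
    exact this.symm
  have hI : I.IsPrime := Ideal.comap_isPrime _ _
  -- With center zero, all nonzero elements of `B` would be units at `P`, and then every function
  -- would be regular at `P`.
  have hI0 : I ≠ ⊥ := by
    intro h
    apply place_ring_ne_top P
    rw [eq_top_iff]
    intro g _
    obtain ⟨a, b, hb, rfl⟩ := IsFractionRing.div_surjective (A := B) g
    have hb0 : b ≠ 0 := nonZeroDivisors.ne_zero hb
    have hbI : b ∉ I := by rw [h]; simpa using hb0
    rw [hmem, not_lt] at hbI
    rw [← P.val_le_one_iff, map_div₀]
    exact div_le_one_of_le₀ ((P.val_le_one_iff.2 (hB a)).trans hbI) zero_le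
  let v : HeightOneSpectrum B := ⟨I, hI, hI0⟩
  have hle : ∀ g, v.valuation K g ≤ 1 → g ∈ P.ring := by
    intro g hg
    obtain ⟨n, d, hd⟩ := v.exists_primeCompl_mul_eq_of_integer g hg
    have hdI : (d : B) ∉ I := d.2
    rw [hmem, not_lt] at hdI
    have hd1 : P.val (algebraMap B K d) = 1 := le_antisymm (P.val_le_one_iff.2 (hB d)) hdI
    rw [← P.val_le_one_iff]
    have := congrArg P.val hd
    rw [map_mul, hd1, mul_one] at this
    rw [this]
    exact P.val_le_one_iff.2 (hB n)
  -- The local ring of `B` at the center is contained in `P.ring`, and such an inclusion is an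
  -- equality.
  have hPv : (v.valuation K).valuationSubring = P.ring := by
    rw [← HeightOneSpectrum.valuationSubringAtPrime_eq_valuationSubring]
    apply ValuationSubring.eq_of_le_of_ne_top _ _ (place_ring_ne_top P)
    rw [HeightOneSpectrum.valuationSubringAtPrime_eq_valuationSubring]
    exact hle
  refine ⟨v, P.val_unique _ (v.valuation_surjective K) fun g => ?_⟩
  rw [← hPv]; rfl

end Place

/-! ### Fibres, norms and the degree of a morphism. -/

section Extension

variable {F K : Type} [Field F] [Algebra ℂ F] [Field K] [Algebra ℂ K] [IsCurveField F]
  [IsCurveField K]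

section Algebra

variable [Algebra F K] [IsScalarTower ℂ F K]

/-- `K` is finitely generated over `ℂ`, hence over `F`, and it is algebraic over `F` because both
fields have transcendence degree one. -/
theorem finiteDimensional_of_isCurveField : FiniteDimensional F K := by
  obtain ⟨S, hS⟩ := IsCurveField.fg (K := K)
  have halg := isAlgebraic_of_hom (IsScalarTower.toAlgHom ℂ F K)
  have : Algebra.IsIntegral F K := ⟨halg⟩
  have h1 : IntermediateField.adjoin F (S : Set K) = ⊤ := by
    rw [eq_top_iff]
    have : (IntermediateField.adjoin ℂ (S : Set K)) ≤
        (IntermediateField.adjoin F (S : Set K)).restrictScalars ℂ := by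
      rw [IntermediateField.adjoin_le_iff]
      exact IntermediateField.subset_adjoin F _
    rw [hS] at this
    intro z _
    exact this (IntermediateField.mem_top)
  have h2 := IntermediateField.finiteDimensional_adjoin (K := F) (S := (S : Set K))
    fun x _ => halg x
  rw [h1] at h2
  exact Module.Finite.equiv (IntermediateField.topEquiv (F := F) (E := K)).toLinearEquiv

/-- The order of a norm is the sum of the orders over the points of the fibre. -/
theorem ord_algebraNorm (p : Place F) {g : K} (hg : g ≠ 0) :
    ∃ S : Finset (Place K), (∀ Q, Q ∈ S ↔ Q.map (IsScalarTower.toAlgHom ℂ F K) = p) ∧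
      p.ord (Algebra.norm F g) = ∑ Q ∈ S, Q.ord g := by
  classical
  have : CharZero F := charZero_of_injective_algebraMap (algebraMap ℂ F).injective
  have := finiteDimensional_of_isCurveField (F := F) (K := K)
  let A := p.ring
  let B := integralClosure A K
  have : IsFractionRing B K := integralClosure.isFractionRing_of_finite_extension F K
  have : IsDedekindDomain B := integralClosure.isDedekindDomain A F K
  have : Module.Finite A B := IsIntegralClosure.finite A F K B
  have : Module.IsTorsionFree A B := by
    refine Module.isTorsionFree_iff_algebraMap_injective.2 fun a b h => ?_
    exact Subtype.ext ((algebraMap F K).injective (congrArg (algebraMap B K) h))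
  have : Finite (HeightOneSpectrum B) := finite_heightOneSpectrum A B
  have := Fintype.ofFinite (HeightOneSpectrum B)
  have hAK : ∀ a : A, algebraMap B K (algebraMap A B a) = algebraMap F K (a : F) := fun a => rfl
  -- points of the fibre give prime ideals
  have hfib : ∀ Q : Place K, Q.map (IsScalarTower.toAlgHom ℂ F K) = p →
      ∃ v : HeightOneSpectrum B, v.valuation K = Q.val := by
    intro Q hQ
    apply exists_prime_of_place
    intro b
    have hA : ∀ a : A, algebraMap F K (a : F) ∈ Q.ring := by
      intro a
      have : (a : F) ∈ (Q.map (IsScalarTower.toAlgHom ℂ F K)).ring := by rw [hQ]; exact a.2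
      exact this
    let χ : A →+* Q.ring :=
      ((algebraMap F K).comp p.ring.subtype).codRestrict Q.ring.toSubring hA
    have hint : IsIntegral Q.ring (b : K) := by
      obtain ⟨P, hP, hPb⟩ := b.2
      refine ⟨P.map χ, hP.map χ, ?_⟩
      rw [eval₂_map]
      exact hPb
    obtain ⟨w, hw⟩ := IsIntegrallyClosed.isIntegral_iff.1 hint
    have : (b : K) ∈ Q.ring := by rw [← hw]; exact w.2
    exact this
  -- prime ideals give points of the fibre
  have hA1 : ∀ (v : HeightOneSpectrum B) (a : F), a ∈ p.ring →
      v.valuation K (algebraMap F K a) ≤ 1 := by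
    intro v a ha
    rw [← hAK ⟨a, ha⟩]
    exact v.valuation_le_one _
  have hc : ∀ (v : HeightOneSpectrum B) (c : ℂ), v.valuation K (algebraMap ℂ K c) ≤ 1 := by
    intro v c
    rw [IsScalarTower.algebraMap_apply ℂ F K]
    exact hA1 v _ (p.const_mem c)
  let pl : HeightOneSpectrum B → Place K := fun v => placeOfPrime v (hc v)
  have hpl : ∀ v, (pl v).map (IsScalarTower.toAlgHom ℂ F K) = p := by
    intro v
    symm
    apply Place.eq_of_ring_le
    intro a ha
    exact hA1 v a ha
  have hval : ∀ v, (pl v).val = v.valuation K := fun v => placeOfPrime_val v (hc v)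
  have hinj : Function.Injective pl := by
    intro v w h
    have h1 : v.valuation K = w.valuation K := by rw [← hval, ← hval, h]
    apply HeightOneSpectrum.ext
    ext b
    rw [← v.valuation_lt_one_iff_mem (K := K), h1, w.valuation_lt_one_iff_mem (K := K)]
  -- residue fields are trivial
  have hf : ∀ v : HeightOneSpectrum B, v.asIdeal.inertiaDeg A = 1 := by
    intro v
    have := v.isMaximal
    have := liesOver_maximalIdeal (A := A) v
    have hm : (IsDiscreteValuationRing.maximalIdeal A).asIdeal.IsMaximal :=
      (IsDiscreteValuationRing.maximalIdeal A).isMaximal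
    rw [Ideal.inertiaDeg_eq_of_isMaximal (IsDiscreteValuationRing.maximalIdeal A).asIdeal v.asIdeal]
    let _ := Ideal.Quotient.field (IsDiscreteValuationRing.maximalIdeal A).asIdeal
    let _ := Ideal.Quotient.field v.asIdeal
    apply finrank_eq_one (1 : B ⧸ v.asIdeal) one_ne_zero
    intro z
    obtain ⟨b, rfl⟩ := Ideal.Quotient.mk_surjective z
    have hb : algebraMap B K b ∈ (pl v).ring := v.valuation_le_one b
    -- Every element of the residue field at `v` is the class of a complex number, which already
    -- lies in `A`.
    obtain ⟨c, hcv⟩ := (pl v).exists_value hb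
    refine ⟨Ideal.Quotient.mk _ ⟨algebraMap ℂ F c, p.const_mem c⟩, ?_⟩
    rw [Algebra.smul_def, mul_one, Ideal.Quotient.algebraMap_mk_of_liesOver]
    symm
    rw [Ideal.Quotient.eq, ← v.valuation_lt_one_iff_mem (K := K), ← hval]
    have := hcv
    rw [Place.HasValue, IsScalarTower.algebraMap_apply ℂ F K] at this
    exact this
  refine ⟨Finset.univ.image pl, fun Q => ?_, ?_⟩
  · rw [Finset.mem_image]
    constructor
    · rintro ⟨v, -, rfl⟩; exact hpl v
    · intro hQ
      obtain ⟨v, hv⟩ := hfib Q hQ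
      refine ⟨v, Finset.mem_univ _, Place.ext ?_⟩
      ext g
      rw [← Place.val_le_one_iff, ← Place.val_le_one_iff, hval, hv]
  · rw [Finset.sum_image hinj.injOn]
    have h := log_valuation_norm (A := A) (F := F) hf hg
    simp only [Place.ord, hval]
    rw [Finset.sum_neg_distrib, ← h]
    rfl

end Algebra

/-- The degree of the morphism of curves given by a homomorphism of function fields. -/
noncomputable def degree (φ : F →ₐ[ℂ] K) : ℕ :=
  let _ := φ.toRingHom.toAlgebra
  Module.finrank F K

/-- The norm along a homomorphism of function fields. -/
noncomputable def norm (φ : F →ₐ[ℂ] K) : K →* F :=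
  let _ := φ.toRingHom.toAlgebra
  Algebra.norm F

theorem degree_pos (φ : F →ₐ[ℂ] K) : 0 < degree φ := by
  let _ := φ.toRingHom.toAlgebra
  have : IsScalarTower ℂ F K := IsScalarTower.of_algebraMap_eq fun c => (φ.commutes c).symm
  have := finiteDimensional_of_isCurveField (F := F) (K := K)
  exact Module.finrank_pos (R := F) (M := K)

theorem norm_map (φ : F →ₐ[ℂ] K) (a : F) : norm φ (φ a) = a ^ degree φ := by
  let _ := φ.toRingHom.toAlgebra
  exact Algebra.norm_algebraMap (S := K) a

theorem norm_ne_zero (φ : F →ₐ[ℂ] K) {g : K} (hg : g ≠ 0) : norm φ g ≠ 0 := by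
  let _ := φ.toRingHom.toAlgebra
  have : IsScalarTower ℂ F K := IsScalarTower.of_algebraMap_eq fun c => (φ.commutes c).symm
  have := finiteDimensional_of_isCurveField (F := F) (K := K)
  exact Algebra.norm_ne_zero_iff.2 hg

theorem exists_fibre (φ : F →ₐ[ℂ] K) (p : Place F) {g : K} (hg : g ≠ 0) :
    ∃ S : Finset (Place K), (∀ Q, Q ∈ S ↔ Q.map φ = p) ∧
      p.ord (norm φ g) = ∑ Q ∈ S, Q.ord g := by
  let _ := φ.toRingHom.toAlgebra
  have : IsScalarTower ℂ F K := IsScalarTower.of_algebraMap_eq fun c => (φ.commutes c).symm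
  exact ord_algebraNorm p hg

theorem finite_fibre (φ : F →ₐ[ℂ] K) (p : Place F) : {Q : Place K | Q.map φ = p}.Finite := by
  obtain ⟨S, hS, -⟩ := exists_fibre φ p (one_ne_zero (α := K))
  exact S.finite_toSet.subset fun Q hQ => (hS Q).2 hQ

/-- The points of a fibre. -/
noncomputable def fibre (φ : F →ₐ[ℂ] K) (p : Place F) : Finset (Place K) :=
  (finite_fibre φ p).toFinset

theorem mem_fibre (φ : F →ₐ[ℂ] K) {p : Place F} {Q : Place K} : Q ∈ fibre φ p ↔ Q.map φ = p := by
  simp [fibre]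

theorem ord_norm (φ : F →ₐ[ℂ] K) (p : Place F) {g : K} (hg : g ≠ 0) :
    p.ord (norm φ g) = ∑ Q ∈ fibre φ p, Q.ord g := by
  obtain ⟨S, hS, h⟩ := exists_fibre φ p hg
  rw [h]
  congr 1
  ext Q
  rw [hS, mem_fibre]

/-- Compute in two ways the order at `p` of the norm of a pulled-back uniformizer: this norm is the
uniformizer to the power `degree φ`. -/
theorem sum_ramificationIndex (φ : F →ₐ[ℂ] K) (p : Place F) :
    ∑ Q ∈ fibre φ p, Q.ramificationIndex φ = degree φ := by
  have h := ord_norm φ p ((_root_.map_ne_zero φ).2 p.uniformizer_ne_zero)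
  rw [norm_map, p.ord_pow, p.uniformizer_ord, mul_one] at h
  rw [h]
  refine Finset.sum_congr rfl fun Q hQ => ?_
  rw [Q.ord_map φ p.uniformizer_ne_zero, (mem_fibre φ).1 hQ, p.uniformizer_ord, mul_one]

/-- An empty fibre would make the sum of ramification indices zero, but that sum is the degree. -/
theorem exists_map_eq (φ : F →ₐ[ℂ] K) (p : Place F) : ∃ Q : Place K, Q.map φ = p := by
  by_contra! hcon
  have h := sum_ramificationIndex φ p
  rw [Finset.sum_eq_zero fun Q hQ => absurd ((mem_fibre φ).1 hQ) (hcon Q)] at h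
  have := degree_pos φ
  omega

end Extension

/-! ### Push-forward and pull-back of divisor classes. -/

section Descends

variable {F K : Type} [Field F] [Algebra ℂ F] [Field K] [Algebra ℂ K] [IsCurveField F]
  [IsCurveField K] (φ : F →ₐ[ℂ] K)

theorem pushforward_single (P : Place K) (n : ℤ) :
    pushforward φ (Finsupp.single P n) = Finsupp.single (P.map φ) n :=
  Finsupp.mapDomain_single

/-- Finiteness of the fibre guarantees that the `finsum` in `pullback` is a genuine sum and not its
default value `0`. -/
theorem pullback_single (p : Place F) (n : ℤ) :
    pullback φ (Finsupp.single p n) =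
      n • ∑ Q ∈ fibre φ p, Finsupp.single Q (Q.ramificationIndex φ) := by
  rw [pullback, Finsupp.liftAddHom_apply_single, zmultiplesHom_apply,
    finsum_mem_eq_finite_toFinset_sum _ (finite_fibre φ p)]
  rfl

theorem pullback_apply (D : Divisor F) (Q : Place K) :
    pullback φ D Q = Q.ramificationIndex φ * D (Q.map φ) := by
  classical
  induction D using Finsupp.induction_linear with
  | zero => simp
  | add D E hD hE => rw [map_add, Finsupp.add_apply, hD, hE, Finsupp.add_apply, mul_add]
  | single p n =>
    rw [pullback_single, Finsupp.smul_apply, Finsupp.finsetSum_apply]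
    simp only [Finsupp.single_apply, smul_eq_mul]
    rw [Finset.sum_ite_eq' (fibre φ p) Q]
    simp only [mem_fibre]
    split_ifs with h1 h2 h2
    · ring
    · exact absurd h1.symm h2
    · exact absurd h2.symm h1
    · ring

/-- The push-forward of the divisor of `g` is the divisor of the norm of `g`. -/
theorem pushforward_descends : Descends (pushforward φ) where
  degree D hD := by
    have : (Finsupp.degree : Divisor F →+ ℤ).comp (pushforward φ) = Finsupp.degree := by
      ext P
      simp [pushforward_single]
    have h1 : Finsupp.degree (pushforward φ D) = Finsupp.degree D := DFunLike.congr_fun this D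
    rw [AddSubgroup.mem_comap, divisorZero, AddMonoidHom.mem_ker, h1]
    exact hD
  principal := by
    classical
    rintro D ⟨g, hg, h⟩
    refine ⟨norm φ g, norm_ne_zero φ hg, fun p => ?_⟩
    rw [ord_norm φ p hg]
    have h1 : pushforward φ D = D.sum fun P n => Finsupp.single (P.map φ) n := rfl
    rw [h1, Finsupp.sum_apply, Finsupp.sum]
    simp only [Finsupp.single_apply]
    rw [← Finset.sum_filter]
    simp_rw [← h]
    apply Finset.sum_subset_zero_on_sdiff
    · intro Q hQ
      rw [mem_fibre]
      exact (Finset.mem_filter.1 hQ).2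
    · intro Q hQ
      rw [Finset.mem_sdiff, mem_fibre, Finset.mem_filter] at hQ
      by_contra h0
      exact hQ.2 ⟨Finsupp.mem_support_iff.2 h0, hQ.1⟩
    · intro Q _; rfl

/-- Pull-back multiplies degrees by `degree φ`, and it sends the divisor of `g` to the divisor of `φ
g`. -/
theorem pullback_descends : Descends (pullback φ) where
  degree D hD := by
    have : (Finsupp.degree : Divisor K →+ ℤ).comp (pullback φ) =
        (AddMonoidHom.mulLeft (degree φ : ℤ)).comp Finsupp.degree := by
      ext P
      simp [pullback_single, sum_ramificationIndex]
    have h1 : Finsupp.degree (pullback φ D) = degree φ * Finsupp.degree D :=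
      DFunLike.congr_fun this D
    have h2 : Finsupp.degree D = 0 := hD
    rw [AddSubgroup.mem_comap, divisorZero, AddMonoidHom.mem_ker, h1, h2, mul_zero]
  principal := by
    rintro D ⟨g, hg, h⟩
    refine ⟨φ g, (_root_.map_ne_zero φ).2 hg, fun Q => ?_⟩
    rw [pullback_apply, h, Q.ord_map φ hg]

end Descends

/-! ### The points of the projective line. -/

section RatFunc

/-- The prime ideal of `ℂ[X]` generated by `X - a`. -/
noncomputable def primeAt (a : ℂ) : HeightOneSpectrum ℂ[X] where
  asIdeal := Ideal.span {X - C a}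
  isPrime := (Ideal.span_singleton_prime (X_sub_C_ne_zero a)).2 (prime_X_sub_C a)
  ne_bot := by simpa using X_sub_C_ne_zero a

/-- The point `a` of the affine line. -/
noncomputable def ratPlace (a : ℂ) : Place (RatFunc ℂ) :=
  placeOfPrime (primeAt a) fun c => by
    rw [IsScalarTower.algebraMap_apply ℂ ℂ[X] (RatFunc ℂ)]
    exact (primeAt a).valuation_le_one _

theorem ratX_sub (a : ℂ) : (RatFunc.X : RatFunc ℂ) - algebraMap ℂ (RatFunc ℂ) a =
    algebraMap ℂ[X] (RatFunc ℂ) (X - C a) := by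
  rw [map_sub, RatFunc.algebraMap_X, RatFunc.algebraMap_C, RatFunc.algebraMap_eq_C]

theorem ratX_sub_ne_zero (a : ℂ) : (RatFunc.X : RatFunc ℂ) - algebraMap ℂ (RatFunc ℂ) a ≠ 0 := by
  rw [ratX_sub]
  exact (map_ne_zero_iff _ (IsFractionRing.injective ℂ[X] (RatFunc ℂ))).2 (X_sub_C_ne_zero a)

theorem ratPlace_ord (a : ℂ) : (ratPlace a).ord (RatFunc.X - algebraMap ℂ (RatFunc ℂ) a) = 1 := by
  rw [Place.ord, ratPlace, placeOfPrime_val, ratX_sub, HeightOneSpectrum.valuation_of_algebraMap,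
    HeightOneSpectrum.intValuation_singleton _ (X_sub_C_ne_zero a) rfl]
  simp

theorem ratPlace_hasValue (a : ℂ) : (ratPlace a).HasValue RatFunc.X a := by
  rw [Place.HasValue, Place.val_lt_one_iff_ord _ (ratX_sub_ne_zero a), ratPlace_ord]
  norm_num

/-- The center of `Q` on `ℂ[X]` contains `X - a`, which already generates a maximal ideal. -/
theorem eq_ratPlace {Q : Place (RatFunc ℂ)} {a : ℂ} (hQ : Q.HasValue RatFunc.X a) :
    Q = ratPlace a := by
  obtain ⟨v, hv⟩ := exists_prime_of_place (B := ℂ[X]) Q (by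
    intro q
    rw [← aeval_X_left_apply q, ← aeval_algebraMap_apply, RatFunc.algebraMap_X]
    induction q using Polynomial.induction_on' with
    | add p q hp hq => rw [map_add]; exact add_mem hp hq
    | monomial n c =>
      rw [aeval_monomial]
      exact mul_mem (Q.const_mem c) (pow_mem hQ.mem n))
  have h1 : X - C a ∈ v.asIdeal := by
    rw [← v.valuation_lt_one_iff_mem (K := RatFunc ℂ), hv]
    exact (congrArg Q.val (ratX_sub a)).symm.trans_lt hQ
  have h2 : v = primeAt a := by
    apply HeightOneSpectrum.ext
    symm
    apply (primeAt a).isMaximal.eq_of_le v.isPrime.ne_top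
    rw [primeAt, Ideal.span_singleton_le_iff_mem]
    exact h1
  apply Place.ext
  ext g
  rw [← Place.val_le_one_iff, ← Place.val_le_one_iff, ← hv, h2, ratPlace, placeOfPrime_val]

theorem ratX_inv_transcendental : Transcendental ℂ (RatFunc.X : RatFunc ℂ)⁻¹ := by
  intro h
  have h1 := h.inv
  rw [inv_inv] at h1
  exact RatFunc.transcendental_X h1

/-- The automorphism `X ↦ 1/X`. -/
noncomputable def ratInv : RatFunc ℂ →ₐ[ℂ] RatFunc ℂ := ratLift _ ratX_inv_transcendental

theorem ratInv_X : ratInv RatFunc.X = RatFunc.X⁻¹ := ratLift_X _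

theorem ratFunc_algHom_ext {K : Type} [Field K] [Algebra ℂ K] {φ ψ : RatFunc ℂ →ₐ[ℂ] K}
    (h : φ RatFunc.X = ψ RatFunc.X) : φ = ψ := by
  have h1 : ∀ q : ℂ[X], φ (algebraMap ℂ[X] (RatFunc ℂ) q) = ψ (algebraMap ℂ[X] (RatFunc ℂ) q) := by
    intro q
    rw [← aeval_X_left_apply q, ← aeval_algebraMap_apply, RatFunc.algebraMap_X,
      ← aeval_algHom_apply, ← aeval_algHom_apply, h]
  ext g
  obtain ⟨p, q, _, rfl⟩ := IsFractionRing.div_surjective (A := ℂ[X]) g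
  rw [map_div₀, map_div₀, h1, h1]

theorem ratInv_comp : ratInv.comp ratInv = AlgHom.id ℂ _ := by
  apply ratFunc_algHom_ext
  rw [AlgHom.comp_apply, ratInv_X, map_inv₀, ratInv_X, inv_inv, AlgHom.id_apply]

/-- The point at infinity of the projective line. -/
noncomputable def ratInfty : Place (RatFunc ℂ) := (ratPlace 0).map ratInv

/-- The inversion takes `X` to a function of order `-1` at `0`, so its ramification index there is a
positive divisor of `1`. -/
theorem ratInfty_ord : ratInfty.ord RatFunc.X = -1 := by
  have h := (ratPlace 0).ord_map ratInv (g := RatFunc.X) RatFunc.X_ne_zero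
  have h1 := ratPlace_ord 0
  rw [map_zero, sub_zero] at h1
  rw [ratInv_X, Place.ord_inv, h1] at h
  have h2 := (ratPlace 0).ramificationIndex_pos ratInv
  have h3 : (ratPlace 0).ramificationIndex ratInv ∣ 1 := by
    rw [← dvd_neg]; exact ⟨_, h⟩
  have h4 := Int.eq_one_of_dvd_one h2.le h3
  rw [h4, one_mul] at h
  exact h.symm

theorem ratInfty_isPole : ratInfty.IsPole RatFunc.X := by
  rw [Place.IsPole, Place.one_lt_val_iff_ord _ RatFunc.X_ne_zero, ratInfty_ord]; norm_num

theorem eq_ratInfty {Q : Place (RatFunc ℂ)} (hQ : Q.IsPole RatFunc.X) : Q = ratInfty := by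
  have h : Q.map ratInv = ratPlace 0 := by
    apply eq_ratPlace
    rw [Place.map_hasValue_iff, ratInv_X]
    exact hQ.inv
  rw [ratInfty, ← h, Place.map_map, ratInv_comp]
  rfl

end RatFunc

/-! ### A nonconstant function as a map to the projective line. -/

section Functions

variable {K : Type} [Field K] [Algebra ℂ K] [IsCurveField K] {g : K} (hg : Transcendental ℂ g)

theorem mem_fibre_ratPlace {Q : Place K} {a : ℂ} :
    Q ∈ fibre (ratLift g hg) (ratPlace a) ↔ Q.HasValue g a := by
  rw [mem_fibre]
  constructor
  · intro h
    have := ratPlace_hasValue a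
    rwa [← h, Place.map_hasValue_iff, ratLift_X] at this
  · intro h
    apply eq_ratPlace
    rwa [Place.map_hasValue_iff, ratLift_X]

theorem mem_fibre_ratInfty {Q : Place K} : Q ∈ fibre (ratLift g hg) ratInfty ↔ Q.IsPole g := by
  rw [mem_fibre]
  constructor
  · intro h
    have := ratInfty_isPole
    rwa [← h, Place.map_isPole_iff, ratLift_X] at this
  · intro h
    apply eq_ratInfty
    rwa [Place.map_isPole_iff, ratLift_X]

theorem ramificationIndex_of_hasValue {Q : Place K} {a : ℂ} (hQ : Q.HasValue g a) :
    Q.ramificationIndex (ratLift g hg) = Q.ord (g - algebraMap ℂ K a) := by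
  have h := Q.ord_map (ratLift g hg) (ratX_sub_ne_zero a)
  rw [(mem_fibre _).1 ((mem_fibre_ratPlace hg).2 hQ), ratPlace_ord, mul_one, map_sub, ratLift_X,
    AlgHom.commutes] at h
  exact h.symm

theorem ramificationIndex_of_isPole {Q : Place K} (hQ : Q.IsPole g) :
    Q.ramificationIndex (ratLift g hg) = -Q.ord g := by
  have h := Q.ord_map (ratLift g hg) (g := RatFunc.X) RatFunc.X_ne_zero
  rw [(mem_fibre _).1 ((mem_fibre_ratInfty hg).2 hQ), ratInfty_ord, ratLift_X] at h
  rw [h]; ring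

theorem exists_hasValue (hg : Transcendental ℂ g) (a : ℂ) : ∃ Q : Place K, Q.HasValue g a := by
  obtain ⟨Q, hQ⟩ := exists_map_eq (ratLift g hg) (ratPlace a)
  exact ⟨Q, (mem_fibre_ratPlace hg).1 ((mem_fibre _).2 hQ)⟩

theorem exists_isPole (hg : Transcendental ℂ g) : ∃ Q : Place K, Q.IsPole g := by
  obtain ⟨Q, hQ⟩ := exists_map_eq (ratLift g hg) ratInfty
  exact ⟨Q, (mem_fibre_ratInfty hg).1 ((mem_fibre _).2 hQ)⟩

/-- A function without poles is constant. -/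
theorem const_of_no_pole {g : K} (h : ∀ Q : Place K, ¬ Q.IsPole g) : ∃ c, g = algebraMap ℂ K c := by
  by_contra! hcon
  obtain ⟨Q, hQ⟩ := exists_isPole (transcendental_of_not_const hcon)
  exact h Q hQ

end Functions

/-! ### Morphisms of degree at most two. -/

section Quadratic

variable {F K : Type} [Field F] [Algebra ℂ F] [Field K] [Algebra ℂ K]

/-- `K` arises from `F` by adjoining a square root. The upper bound suffices: two distinct points in
one fibre, or one ramified point, already use it up. -/
theorem degree_le_two (φ : F →ₐ[ℂ] K) {w : K} {a : F} (hw : w ^ 2 = φ a)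
    (htop : ∀ E : IntermediateField ℂ K, (∀ b, φ b ∈ E) → w ∈ E → E = ⊤) : degree φ ≤ 2 := by
  let _ := φ.toRingHom.toAlgebra
  have : IsScalarTower ℂ F K := IsScalarTower.of_algebraMap_eq fun c => (φ.commutes c).symm
  have hroot : aeval w (X ^ 2 - C a) = 0 := by
    rw [map_sub, map_pow, aeval_X, aeval_C, hw]
    exact sub_self _
  have hint : IsIntegral F w := ⟨X ^ 2 - C a, monic_X_pow_sub_C a two_ne_zero, hroot⟩
  have h1 : IntermediateField.adjoin F {w} = ⊤ := by
    have := htop ((IntermediateField.adjoin F {w}).restrictScalars ℂ)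
      (fun b => (IntermediateField.adjoin F {w}).algebraMap_mem b)
      (IntermediateField.mem_adjoin_simple_self F w)
    rw [eq_top_iff]
    intro z _
    have hz : z ∈ (⊤ : IntermediateField ℂ K) := IntermediateField.mem_top
    rw [← this] at hz
    exact hz
  have h2 : degree φ = Module.finrank F (IntermediateField.adjoin F {w}) := by
    rw [h1]
    exact (IntermediateField.topEquiv (F := F) (E := K)).toLinearEquiv.finrank_eq.symm
  rw [h2, IntermediateField.adjoin.finrank hint]
  refine (natDegree_le_of_dvd (minpoly.dvd F w hroot) ?_).trans (by simp)
  exact X_pow_sub_C_ne_zero two_pos a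

/-- Ramification indices are positive and add up to at most two, so there is no room for a third
point or for ramification. -/
theorem fibre_of_degree_le_two [IsCurveField F] [IsCurveField K] {φ : F →ₐ[ℂ] K} {p : Place F}
    (hφ : degree φ ≤ 2) {Q R : Place K} (hQ : Q.map φ = p) (hR : R.map φ = p) (hQR : Q ≠ R) :
    (∀ S : Place K, S.map φ = p → S = Q ∨ S = R) ∧ Q.ramificationIndex φ = 1 ∧
      R.ramificationIndex φ = 1 ∧
      pullback φ (Finsupp.single p 1) = Finsupp.single Q 1 + Finsupp.single R 1 := by
  classical
  have h := sum_ramificationIndex φ p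
  have hsub : {Q, R} ⊆ fibre φ p := by
    intro S hS
    rw [Finset.mem_insert, Finset.mem_singleton] at hS
    rw [mem_fibre]
    rcases hS with rfl | rfl <;> assumption
  rw [← Finset.sum_sdiff hsub, Finset.sum_pair hQR] at h
  have h1 := Q.ramificationIndex_pos φ
  have h2 := R.ramificationIndex_pos φ
  have h3 : ∀ S ∈ fibre φ p \ {Q, R}, 0 ≤ S.ramificationIndex φ :=
    fun S _ => (S.ramificationIndex_pos φ).le
  have h4 := Finset.sum_nonneg h3
  have hempty : fibre φ p \ {Q, R} = ∅ := by
    by_contra hne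
    obtain ⟨S, hS⟩ := Finset.nonempty_iff_ne_empty.2 hne
    have := Finset.single_le_sum h3 hS
    have := S.ramificationIndex_pos φ
    omega
  have heq : fibre φ p = {Q, R} :=
    Finset.Subset.antisymm (Finset.sdiff_eq_empty_iff_subset.1 hempty) hsub
  have hQ1 : Q.ramificationIndex φ = 1 := by omega
  have hR1 : R.ramificationIndex φ = 1 := by omega
  refine ⟨fun S hS => ?_, hQ1, hR1, ?_⟩
  · have : S ∈ fibre φ p := (mem_fibre φ).2 hS
    rw [heq] at this
    simpa using this
  · rw [pullback_single, heq, Finset.sum_pair hQR, hQ1, hR1, one_smul]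

theorem fibre_of_two_le_ramificationIndex [IsCurveField F] [IsCurveField K] {φ : F →ₐ[ℂ] K}
    {p : Place F} (hφ : degree φ ≤ 2) {Q R : Place K} (hQ : Q.map φ = p) (hR : R.map φ = p)
    (hQ2 : 2 ≤ Q.ramificationIndex φ) : R = Q ∧ Q.ramificationIndex φ = 2 := by
  constructor
  · by_contra hne
    have := (fibre_of_degree_le_two hφ hQ hR (Ne.symm hne)).2.1
    omega
  · have h := sum_ramificationIndex φ p
    have := Finset.single_le_sum (fun S _ => (Place.ramificationIndex_pos S φ).le)
      ((mem_fibre φ).2 hQ)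
    omega

end Quadratic

/-! ### Smooth cubics: points, orders of functions and the group law. -/

/-- A smooth Weierstrass equation `Y² = X³ + a₂ X² + a₄ X + a₆` for a curve with function field `K`,
with the involution `τ : Y ↦ -Y`. -/
structure CubicModel (K : Type) [Field K] [Algebra ℂ K] where
  a₂ : ℂ
  a₄ : ℂ
  a₆ : ℂ
  X : K
  Y : K
  τ : K →ₐ[ℂ] K
  eqn : Y ^ 2 = X ^ 3 + algebraMap ℂ K a₂ * X ^ 2 + algebraMap ℂ K a₄ * X + algebraMap ℂ K a₆
  τ_X : τ X = X
  τ_Y : τ Y = -Y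
  transcendental : Transcendental ℂ X
  generate : ∀ E : IntermediateField ℂ K, X ∈ E → Y ∈ E → E = ⊤
  smooth : ∀ e, e ^ 3 + a₂ * e ^ 2 + a₄ * e + a₆ = 0 → 3 * e ^ 2 + 2 * a₂ * e + a₄ ≠ 0

namespace CubicModel

variable {K : Type} [Field K] [Algebra ℂ K] [IsCurveField K] (M : CubicModel K)

/-- The cubic polynomial function. -/
def f (e : ℂ) : ℂ := e ^ 3 + M.a₂ * e ^ 2 + M.a₄ * e + M.a₆

/-- The map to the projective line given by `X`. -/
noncomputable def toLine : RatFunc ℂ →ₐ[ℂ] K := ratLift M.X M.transcendental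

theorem degree_toLine : degree M.toLine ≤ 2 := by
  have hX : M.toLine RatFunc.X = M.X := ratLift_X _
  refine degree_le_two M.toLine (w := M.Y)
    (a := RatFunc.X ^ 3 + algebraMap ℂ _ M.a₂ * RatFunc.X ^ 2 +
      algebraMap ℂ _ M.a₄ * RatFunc.X + algebraMap ℂ _ M.a₆) ?_ ?_
  · simp only [map_add, map_mul, map_pow, AlgHom.commutes, hX]
    exact M.eqn
  · intro E hE hY
    apply M.generate E _ hY
    rw [← hX]; exact hE _

/-- The point `Q` has coordinates `(a, b)`. -/
def IsPoint (Q : Place K) (a b : ℂ) : Prop := Q.HasValue M.X a ∧ Q.HasValue M.Y b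

variable {M} {P Q R : Place K} {a b a' b' : ℂ}

theorem hasValue_cubic (h : Q.HasValue M.X a) : Q.HasValue (M.Y ^ 2) (M.f a) := by
  rw [M.eqn]
  exact (((h.pow 3).add ((Place.HasValue.const Q _).mul (h.pow 2))).add
    ((Place.HasValue.const Q _).mul h)).add (Place.HasValue.const Q _)

theorem IsPoint.eqn (h : M.IsPoint Q a b) : b ^ 2 = M.f a :=
  (h.2.pow 2).unique (hasValue_cubic h.1)

theorem exists_isPoint_of_not_isPole (h : ¬ Q.IsPole M.X) : ∃ a b, M.IsPoint Q a b := by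
  obtain ⟨a, ha⟩ := Q.exists_value_of_not_isPole h
  obtain ⟨b, hb⟩ := Q.exists_value (Q.mem_of_pow_mem two_ne_zero (hasValue_cubic ha).mem)
  exact ⟨a, b, ha, hb⟩

theorem IsPoint.map_τ (h : M.IsPoint Q a b) : M.IsPoint (Q.map M.τ) a (-b) := by
  refine ⟨?_, ?_⟩
  · rw [Place.map_hasValue_iff, M.τ_X]; exact h.1
  · rw [Place.map_hasValue_iff, M.τ_Y]; exact h.2.neg

variable (M) in
-- Some point has `X = a`; there `Y` is `b` or `-b`, and `τ` corrects the sign.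
theorem exists_isPoint (h : b ^ 2 = M.f a) : ∃ Q, M.IsPoint Q a b := by
  obtain ⟨Q, hQ⟩ := exists_hasValue M.transcendental a
  obtain ⟨a', b', hab⟩ := exists_isPoint_of_not_isPole hQ.not_isPole
  obtain rfl := hab.1.unique hQ
  have hb : (b' - b) * (b' + b) = 0 := by linear_combination hab.eqn - h
  rcases mul_eq_zero.1 hb with hb | hb
  · obtain rfl := sub_eq_zero.1 hb
    exact ⟨Q, hab⟩
  · obtain rfl : b = -b' := by linear_combination hb
    exact ⟨_, hab.map_τ⟩

theorem X_sub_ne_zero (a : ℂ) : M.X - algebraMap ℂ K a ≠ 0 := by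
  intro h
  apply M.transcendental
  rw [sub_eq_zero.1 h]
  exact isAlgebraic_algebraMap a

theorem Y_ne_zero : M.Y ≠ 0 := by
  intro h
  have hE := exists_hasValue M.transcendental (0 : ℂ)
  have hall : ∀ a, M.f a = 0 := by
    intro a
    obtain ⟨Q, hQ⟩ := exists_hasValue M.transcendental a
    have h1 := hasValue_cubic hQ
    rw [h, zero_pow two_ne_zero] at h1
    have h2 := Place.HasValue.const Q 0
    rw [map_zero] at h2
    exact h1.unique h2
  have h0 := hall 0
  have h1 := hall 1
  have h2 := hall (-1)
  have h3 := hall 2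
  simp only [f] at h0 h1 h2 h3
  -- The third finite difference of a monic cubic is `3! = 6`.
  have : (6 : ℂ) = 0 := by linear_combination h3 - 3 * h1 + 3 * h0 - h2
  norm_num at this

theorem mem_fibre_toLine_of_hasValue : Q.map M.toLine = ratPlace a ↔ Q.HasValue M.X a := by
  rw [← mem_fibre]; exact mem_fibre_ratPlace M.transcendental

theorem mem_fibre_toLine_of_isPole : Q.map M.toLine = ratInfty ↔ Q.IsPole M.X := by
  rw [← mem_fibre]; exact mem_fibre_ratInfty M.transcendental

/-- Write `Y² = (X - a) u`. At the point, `u` takes the derivative of the cubic at `a` as its value,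
which is nonzero by smoothness, so `X - a` has the same order as `Y²`. -/
theorem IsPoint.two_le_ord (h : M.IsPoint Q a 0) : 2 ≤ Q.ord (M.X - algebraMap ℂ K a) := by
  have hf : M.f a = 0 := by rw [← h.eqn]; ring
  set u : K := M.X ^ 2 + algebraMap ℂ K (a + M.a₂) * M.X + algebraMap ℂ K (a ^ 2 + M.a₂ * a + M.a₄)
    with hu
  have h1 : M.Y ^ 2 = (M.X - algebraMap ℂ K a) * u := by
    have h2 : algebraMap ℂ K (M.f a) = 0 := by rw [hf, map_zero]
    simp only [f, map_add, map_mul, map_pow] at h2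
    rw [M.eqn, hu]
    simp only [map_add, map_mul, map_pow]
    linear_combination h2
  have hval : Q.HasValue u (a ^ 2 + (a + M.a₂) * a + (a ^ 2 + M.a₂ * a + M.a₄)) :=
    ((h.1.pow 2).add ((Place.HasValue.const Q _).mul h.1)).add (Place.HasValue.const Q _)
  have hne : a ^ 2 + (a + M.a₂) * a + (a ^ 2 + M.a₂ * a + M.a₄) ≠ 0 := by
    have := M.smooth a hf
    intro h0
    apply this
    linear_combination h0
  have h3 := congrArg Q.ord h1
  rw [Q.ord_pow, Q.ord_mul (X_sub_ne_zero a) (hval.ne_zero hne), hval.ord_eq_zero hne] at h3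
  have h4 : 0 < Q.ord M.Y := by
    rw [← Q.val_lt_one_iff_ord Y_ne_zero, ← Place.hasValue_zero_iff]; exact h.2
  push_cast at h3
  omega

theorem ramificationIndex_toLine (h : Q.HasValue M.X a) :
    Q.ramificationIndex M.toLine = Q.ord (M.X - algebraMap ℂ K a) :=
  ramificationIndex_of_hasValue M.transcendental h

theorem IsPoint.ne_map_τ (h : M.IsPoint Q a b) (hb : b ≠ 0) : Q ≠ Q.map M.τ := by
  intro hQ
  have h1 := h.map_τ.2
  rw [← hQ] at h1
  have := h.2.unique h1
  exact hb (by linear_combination this / 2)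

/-- The fibre of `X` is `{Q, τQ}` when `b ≠ 0`, and `Y` separates the two points; when `b = 0` the
map `X` is ramified at `Q`, which is then alone in its fibre. -/
theorem IsPoint.unique (hQ : M.IsPoint Q a b) (hR : M.IsPoint R a b) : R = Q := by
  rcases eq_or_ne b 0 with rfl | hb
  · refine (fibre_of_two_le_ramificationIndex M.degree_toLine
      (mem_fibre_toLine_of_hasValue.2 hQ.1) (mem_fibre_toLine_of_hasValue.2 hR.1) ?_).1
    rw [ramificationIndex_toLine hQ.1]; exact hQ.two_le_ord
  · have h := (fibre_of_degree_le_two M.degree_toLine (mem_fibre_toLine_of_hasValue.2 hQ.1)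
      (mem_fibre_toLine_of_hasValue.2 hQ.map_τ.1) (hQ.ne_map_τ hb)).1 R
      (mem_fibre_toLine_of_hasValue.2 hR.1)
    rcases h with h | h
    · exact h
    · have h1 := hQ.map_τ.2
      rw [← h] at h1
      have := hR.2.unique h1
      exact absurd (by linear_combination this / 2) hb

theorem IsPoint.eq_iff (hQ : M.IsPoint Q a b) (hR : M.IsPoint R a' b') :
    Q = R ↔ a = a' ∧ b = b' := by
  constructor
  · rintro rfl
    exact ⟨hQ.1.unique hR.1, hQ.2.unique hR.2⟩
  · rintro ⟨rfl, rfl⟩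
    exact hR.unique hQ

theorem IsPoint.ord_of_ne_zero (h : M.IsPoint Q a b) (hb : b ≠ 0) :
    Q.ord (M.X - algebraMap ℂ K a) = 1 := by
  rw [← ramificationIndex_toLine h.1]
  exact (fibre_of_degree_le_two M.degree_toLine (mem_fibre_toLine_of_hasValue.2 h.1)
      (mem_fibre_toLine_of_hasValue.2 h.map_τ.1) (h.ne_map_τ hb)).2.1

theorem IsPoint.ord_of_zero (h : M.IsPoint Q a 0) : Q.ord (M.X - algebraMap ℂ K a) = 2 := by
  rw [← ramificationIndex_toLine h.1]
  refine (fibre_of_two_le_ramificationIndex M.degree_toLine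
      (mem_fibre_toLine_of_hasValue.2 h.1) (mem_fibre_toLine_of_hasValue.2 h.1) ?_).2
  rw [ramificationIndex_toLine h.1]; exact h.two_le_ord

open Classical in
theorem IsPoint.ord_X_sub (h : M.IsPoint Q a b) (e : ℂ) :
    Q.ord (M.X - algebraMap ℂ K e) = if a = e then (if b = 0 then 2 else 1) else 0 := by
  split_ifs with h1 h2
  · subst h1 h2; exact h.ord_of_zero
  · subst h1; exact h.ord_of_ne_zero h2
  · exact (h.1.sub (Place.HasValue.const Q e)).ord_eq_zero (sub_ne_zero.2 h1)

/-! The point at infinity. -/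

/-- `Y²/X³` has value `1` at a pole of `X`. The relation makes the order of `X` even, so `X` is
ramified there and has only one pole. -/
theorem ord_of_isPole (h : Q.IsPole M.X) : 2 * Q.ord M.Y = 3 * Q.ord M.X := by
  have hX := h.ne_zero
  set u : K := 1 + algebraMap ℂ K M.a₂ * M.X⁻¹ + algebraMap ℂ K M.a₄ * M.X⁻¹ ^ 2 +
    algebraMap ℂ K M.a₆ * M.X⁻¹ ^ 3 with hu
  have h1 : M.Y ^ 2 = M.X ^ 3 * u := by
    rw [M.eqn, hu]; field_simp
  have h0 := h.inv
  have hval : Q.HasValue u 1 := by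
    have := (((Place.HasValue.const Q 1).add ((Place.HasValue.const Q M.a₂).mul h0)).add
      ((Place.HasValue.const Q M.a₄).mul (h0.pow 2))).add
      ((Place.HasValue.const Q M.a₆).mul (h0.pow 3))
    rw [map_one] at this
    simpa only [hu, zero_pow two_ne_zero, zero_pow three_ne_zero, mul_zero, add_zero] using this
  have h3 := congrArg Q.ord h1
  rw [Q.ord_pow, Q.ord_mul (pow_ne_zero 3 hX) (hval.ne_zero one_ne_zero),
    hval.ord_eq_zero one_ne_zero, Q.ord_pow] at h3
  push_cast at h3
  omega

theorem two_le_ramificationIndex_of_isPole (h : Q.IsPole M.X) :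
    2 ≤ Q.ramificationIndex M.toLine := by
  have h1 := ramificationIndex_of_isPole M.transcendental h
  have h2 := ord_of_isPole h
  have h3 := (Q.one_lt_val_iff_ord h.ne_zero).1 h
  rw [toLine]
  omega

variable (M) in
/-- The point at infinity. -/
noncomputable def O : Place K := (exists_isPole M.transcendental).choose

theorem O_isPole : M.O.IsPole M.X := (exists_isPole M.transcendental).choose_spec

theorem isPole_iff : Q.IsPole M.X ↔ Q = M.O := by
  constructor
  · intro h
    exact (fibre_of_two_le_ramificationIndex M.degree_toLine
      (mem_fibre_toLine_of_isPole.2 O_isPole) (mem_fibre_toLine_of_isPole.2 h)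
      (two_le_ramificationIndex_of_isPole O_isPole)).1
  · rintro rfl; exact O_isPole

theorem O_ord_X : M.O.ord M.X = -2 := by
  have h := (fibre_of_two_le_ramificationIndex M.degree_toLine
      (mem_fibre_toLine_of_isPole.2 O_isPole) (mem_fibre_toLine_of_isPole.2 O_isPole)
      (two_le_ramificationIndex_of_isPole O_isPole)).2
  rw [toLine, ramificationIndex_of_isPole M.transcendental O_isPole] at h
  omega

theorem O_ord_Y : M.O.ord M.Y = -3 := by
  have h := ord_of_isPole (M := M) O_isPole
  rw [O_ord_X] at h
  omega

theorem O_val_X : M.O.val M.X = WithZero.exp 2 := by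
  rw [M.O.val_eq_exp O_isPole.ne_zero, O_ord_X]; rfl

theorem O_val_Y : M.O.val M.Y = WithZero.exp 3 := by
  rw [M.O.val_eq_exp Y_ne_zero, O_ord_Y]; rfl

theorem O_ord_X_sub (e : ℂ) : M.O.ord (M.X - algebraMap ℂ K e) = -2 := by
  rw [M.O.ord_eq_iff (X_sub_ne_zero e), Valuation.map_sub_eq_of_lt_left, O_val_X]
  · rfl
  · rw [O_val_X]
    exact (M.O.val_const_le e).trans_lt (by rw [← WithZero.exp_zero, WithZero.exp_lt_exp]; norm_num)

theorem IsPoint.ne_O (h : M.IsPoint Q a b) : Q ≠ M.O := by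
  rintro rfl; exact h.1.not_isPole O_isPole

theorem eq_O_or_isPoint (Q : Place K) : Q = M.O ∨ ∃ a b, M.IsPoint Q a b := by
  by_cases h : Q.IsPole M.X
  · exact Or.inl (isPole_iff.1 h)
  · exact Or.inr (exists_isPoint_of_not_isPole h)

/-! Linear equivalence. -/

theorem abelJacobi_self (O : Place K) : abelJacobi O O = 0 := by
  rw [abelJacobi, QuotientAddGroup.eq_zero_iff]
  have : (⟨Finsupp.single O 1 - Finsupp.single O 1, by simp [divisorZero]⟩ :
    divisorZero K) = 0 := Subtype.ext (sub_self _)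
  rw [this]
  exact zero_mem _

theorem abelJacobi_sum_eq_zero {O : Place K} {g : K} (hg : g ≠ 0)
    (h : ∀ S : Place K, (Finsupp.single P 1 + Finsupp.single Q 1 + Finsupp.single R 1 -
      3 • Finsupp.single O 1 : Divisor K) S = S.ord g) :
    abelJacobi O P + abelJacobi O Q + abelJacobi O R = 0 := by
  rw [abelJacobi, abelJacobi, abelJacobi, ← QuotientAddGroup.mk_add, ← QuotientAddGroup.mk_add,
    QuotientAddGroup.eq_zero_iff, AddSubgroup.mem_addSubgroupOf]
  refine ⟨g, hg, fun S => ?_⟩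
  rw [← h]
  congr 1
  simp only [AddSubgroup.coe_add]
  abel

/-- The function `X - a` has divisor `Q + τQ - 2 O`. The origin serves as third point so that the
criterion for three points applies. -/
theorem IsPoint.add_map_τ (h : M.IsPoint Q a b) :
    abelJacobi M.O Q + abelJacobi M.O (Q.map M.τ) = 0 := by
  classical
  have h1 : abelJacobi M.O Q + abelJacobi M.O (Q.map M.τ) + abelJacobi M.O M.O = 0 := by
    refine abelJacobi_sum_eq_zero (g := M.X - algebraMap ℂ K a) (X_sub_ne_zero a) fun S => ?_
    simp only [Finsupp.sub_apply, Finsupp.add_apply, Finsupp.smul_apply, Finsupp.single_apply]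
    rcases eq_O_or_isPoint (M := M) S with rfl | ⟨c, d, hS⟩
    · rw [O_ord_X_sub, if_neg h.ne_O, if_neg h.map_τ.ne_O, if_pos rfl]; norm_num
    · rw [if_neg hS.ne_O.symm, hS.ord_X_sub]
      simp only [h.eq_iff hS, h.map_τ.eq_iff hS]
      by_cases hac : a = c
      · subst hac
        have h2 : (b - d) * (b + d) = 0 := by linear_combination h.eqn - hS.eqn
        rcases mul_eq_zero.1 h2 with h3 | h3
        · obtain rfl := sub_eq_zero.1 h3
          by_cases hb : b = 0
          · simp [hb]
          · have : -b ≠ b := fun h => hb (by linear_combination -h / 2)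
            simp [hb, this]
        · obtain rfl : d = -b := by linear_combination h3
          by_cases hb : b = 0
          · simp [hb]
          · have : b ≠ -b := fun h => hb (by linear_combination h / 2)
            simp [hb, this]
      · simp [hac, Ne.symm hac]
  rwa [abelJacobi_self, add_zero] at h1

/-- Three points on a line have sum zero. -/
theorem abelJacobi_collinear {x₁ y₁ x₂ y₂ x₃ y₃ l m : ℂ} (h₁ : M.IsPoint P x₁ y₁)
    (h₂ : M.IsPoint Q x₂ y₂) (h₃ : M.IsPoint R x₃ y₃) (l₁ : y₁ = l * x₁ + m)
    (l₂ : y₂ = l * x₂ + m) (l₃ : y₃ = l * x₃ + m) (s₁ : x₁ + x₂ + x₃ = l ^ 2 - M.a₂)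
    (s₂ : x₁ * x₂ + x₁ * x₃ + x₂ * x₃ = M.a₄ - 2 * l * m) (s₃ : x₁ * x₂ * x₃ = m ^ 2 - M.a₆) :
    abelJacobi M.O P + abelJacobi M.O Q + abelJacobi M.O R = 0 := by
  classical
  set lin : K := algebraMap ℂ K l * M.X + algebraMap ℂ K m with hlin
  -- The hypotheses `s₁`, `s₂`, `s₃` compare the coefficients of `f - (lX + m)²` and `(X - x₁)(X -
  -- x₂)(X - x₃)`, so coincidences among the points (tangents and flexes) are covered as well.
  have hprod : (M.Y - lin) * (M.Y + lin) = (M.X - algebraMap ℂ K x₁) * (M.X - algebraMap ℂ K x₂) *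
      (M.X - algebraMap ℂ K x₃) := by
    have e₁ := congrArg (algebraMap ℂ K) s₁
    have e₂ := congrArg (algebraMap ℂ K) s₂
    have e₃ := congrArg (algebraMap ℂ K) s₃
    simp only [map_add, map_mul, map_sub, map_pow, map_ofNat] at e₁ e₂ e₃
    rw [hlin]
    linear_combination M.eqn + M.X ^ 2 * e₁ - M.X * e₂ + e₃
  have hne : (M.Y - lin) * (M.Y + lin) ≠ 0 := by
    rw [hprod]
    exact mul_ne_zero (mul_ne_zero (X_sub_ne_zero _) (X_sub_ne_zero _)) (X_sub_ne_zero _)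
  have hne1 := left_ne_zero_of_mul hne
  have hne2 := right_ne_zero_of_mul hne
  refine abelJacobi_sum_eq_zero (g := M.Y - lin) hne1 fun S => ?_
  simp only [Finsupp.sub_apply, Finsupp.add_apply, Finsupp.smul_apply, Finsupp.single_apply]
  rcases eq_O_or_isPoint (M := M) S with rfl | ⟨c, d, hS⟩
  · rw [if_neg h₁.ne_O, if_neg h₂.ne_O, if_neg h₃.ne_O, if_pos rfl]
    have hle : M.O.val lin ≤ WithZero.exp 2 := by
      refine (M.O.val.map_add _ _).trans (max_le ?_ ?_)
      · rw [map_mul, O_val_X]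
        exact mul_le_of_le_one_left' (M.O.val_const_le l)
      · refine (M.O.val_const_le m).trans ?_
        rw [← WithZero.exp_zero, WithZero.exp_le_exp]; norm_num
    symm
    rw [M.O.ord_eq_iff hne1, Valuation.map_sub_eq_of_lt_left, O_val_Y]
    · rfl
    · rw [O_val_Y]
      exact hle.trans_lt (by rw [WithZero.exp_lt_exp]; norm_num)
  · rw [if_neg hS.ne_O.symm, smul_zero, sub_zero]
    simp only [h₁.eq_iff hS, h₂.eq_iff hS, h₃.eq_iff hS]
    have hvl : S.HasValue lin (l * c + m) :=
      ((Place.HasValue.const S l).mul hS.1).add (Place.HasValue.const S m)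
    by_cases hd : d = l * c + m
    · have hi : ∀ {x y : ℂ}, y = l * x + m → (x = c ∧ y = d ↔ c = x) := by
        intro x y hxy
        constructor
        · rintro ⟨h, -⟩; exact h.symm
        · rintro rfl; exact ⟨rfl, by rw [hxy, hd]⟩
      simp only [hi l₁, hi l₂, hi l₃]
      have hord := congrArg S.ord hprod
      rw [S.ord_mul hne1 hne2, S.ord_mul (mul_ne_zero (X_sub_ne_zero _) (X_sub_ne_zero _))
        (X_sub_ne_zero _), S.ord_mul (X_sub_ne_zero _) (X_sub_ne_zero _), hS.ord_X_sub,
        hS.ord_X_sub, hS.ord_X_sub] at hord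
      -- The product of the two factors has known order. If `d = 0`, then `τ` fixes `S` and
      -- exchanges the factors up to sign, so they share this order equally; otherwise the second
      -- factor has value `2d ≠ 0` and the first carries it all.
      by_cases hd0 : d = 0
      · have hτ : S.map M.τ = S := by
          have := hS.map_τ
          rw [hd0, neg_zero] at this
          rw [hd0] at hS
          exact hS.unique this
        have h4 := S.ord_map M.τ hne1
        rw [hτ] at h4
        have h5 : S.ramificationIndex M.τ = 1 := by
          have h6 := S.ord_map M.τ (X_sub_ne_zero (M := M) c)
          rw [hτ, map_sub, M.τ_X, AlgHom.commutes, hS.ord_X_sub, if_pos rfl, if_pos hd0] at h6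
          omega
        have h7 : M.τ (M.Y - lin) = -(M.Y + lin) := by
          rw [hlin]; simp only [map_sub, map_add, map_mul, M.τ_X, M.τ_Y, AlgHom.commutes]; ring
        rw [h7, S.ord_neg, h5, one_mul] at h4
        rw [h4] at hord
        simp only [hd0, if_true] at hord
        split_ifs at hord ⊢ <;> omega
      · have hp : S.HasValue (M.Y + lin) (d + (l * c + m)) := hS.2.add hvl
        rw [hp.ord_eq_zero (by rw [← hd]; intro h; exact hd0 (by linear_combination h / 2)),
          add_zero] at hord
        simp only [hd0, if_false] at hord
        rw [hord]
    · have hv : S.HasValue (M.Y - lin) (d - (l * c + m)) := hS.2.sub hvl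
      rw [hv.ord_eq_zero (sub_ne_zero.2 hd)]
      have hi : ∀ {x y : ℂ}, y = l * x + m → ¬ (x = c ∧ y = d) := by
        rintro x y hxy ⟨rfl, rfl⟩; exact hd hxy
      simp [hi l₁, hi l₂, hi l₃]

/-- The third point on a chord. -/
theorem abelJacobi_chord {x₁ y₁ x₂ y₂ x₃ y₃ l : ℂ} (h₁ : M.IsPoint P x₁ y₁)
    (h₂ : M.IsPoint Q x₂ y₂) (hx : x₁ ≠ x₂) (hl : l * (x₁ - x₂) = y₁ - y₂)
    (h₃ : x₃ = l ^ 2 - M.a₂ - x₁ - x₂) (h₃' : y₃ = y₁ + l * (x₃ - x₁)) :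
    ∃ R, M.IsPoint R x₃ y₃ ∧ abelJacobi M.O P + abelJacobi M.O Q + abelJacobi M.O R = 0 := by
  have e₁ := h₁.eqn
  have e₂ := h₂.eqn
  simp only [f] at e₁ e₂
  have hx' : x₁ - x₂ ≠ 0 := sub_ne_zero.2 hx
  obtain ⟨m, hm⟩ : ∃ m, m = y₁ - l * x₁ := ⟨_, rfl⟩
  have l₁ : y₁ = l * x₁ + m := by rw [hm]; ring
  have l₂ : y₂ = l * x₂ + m := by rw [hm]; linear_combination hl
  have l₃ : y₃ = l * x₃ + m := by rw [hm, h₃']; ring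
  have s₁ : x₁ + x₂ + x₃ = l ^ 2 - M.a₂ := by rw [h₃]; ring
  rw [l₁] at e₁
  rw [l₂] at e₂
  -- This is the difference of the two curve equations, divided by `x₁ - x₂`.
  have s₂ : x₁ * x₂ + x₁ * x₃ + x₂ * x₃ = M.a₄ - 2 * l * m := by
    apply mul_left_cancel₀ hx'
    rw [h₃]
    linear_combination e₁ - e₂
  have s₃ : x₁ * x₂ * x₃ = m ^ 2 - M.a₆ := by
    linear_combination e₁ * (-1) - x₁ ^ 2 * s₁ + x₁ * s₂
  have e₃ : y₃ ^ 2 = M.f x₃ := by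
    rw [l₃, f]
    linear_combination x₃ ^ 2 * (-s₁) + x₃ * s₂ - s₃
  obtain ⟨R, hR⟩ := M.exists_isPoint e₃
  exact ⟨R, hR, abelJacobi_collinear h₁ h₂ hR l₁ l₂ l₃ s₁ s₂ s₃⟩

/-- The third point lies on the chord, or on the tangent if the points coincide; the excluded case
is that of a vertical line. -/
theorem exists_add_add_eq_zero {x₁ y₁ x₂ y₂ : ℂ} (h₁ : M.IsPoint P x₁ y₁)
    (h₂ : M.IsPoint Q x₂ y₂) (hne : ¬ (x₁ = x₂ ∧ y₁ = -y₂)) :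
    ∃ R x₃ y₃, M.IsPoint R x₃ y₃ ∧
      abelJacobi M.O P + abelJacobi M.O Q + abelJacobi M.O R = 0 := by
  by_cases hx : x₁ = x₂
  · subst hx
    have e₁ := h₁.eqn
    have e₂ := h₂.eqn
    have hy : (y₁ - y₂) * (y₁ + y₂) = 0 := by linear_combination e₁ - e₂
    rcases mul_eq_zero.1 hy with hy | hy
    · obtain rfl := sub_eq_zero.1 hy
      obtain rfl := h₂.unique h₁
      have hy0 : y₁ ≠ 0 := by rintro rfl; exact hne ⟨rfl, by ring⟩
      -- The slope of the tangent, from implicit differentiation of the equation.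
      obtain ⟨l, hl⟩ : ∃ l, 2 * y₁ * l = 3 * x₁ ^ 2 + 2 * M.a₂ * x₁ + M.a₄ :=
        ⟨(3 * x₁ ^ 2 + 2 * M.a₂ * x₁ + M.a₄) / (2 * y₁), by field_simp⟩
      obtain ⟨m, hm⟩ : ∃ m, m = y₁ - l * x₁ := ⟨_, rfl⟩
      obtain ⟨x₃, hx₃⟩ : ∃ x₃, x₃ = l ^ 2 - M.a₂ - x₁ - x₁ := ⟨_, rfl⟩
      have l₁ : y₁ = l * x₁ + m := by rw [hm]; ring
      have s₁ : x₁ + x₁ + x₃ = l ^ 2 - M.a₂ := by rw [hx₃]; ring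
      simp only [f] at e₁
      have s₂ : x₁ * x₁ + x₁ * x₃ + x₁ * x₃ = M.a₄ - 2 * l * m := by
        rw [hx₃, hm]; linear_combination hl
      have s₃ : x₁ * x₁ * x₃ = m ^ 2 - M.a₆ := by
        rw [l₁] at e₁
        linear_combination e₁ * (-1) - x₁ ^ 2 * s₁ + x₁ * s₂
      have e₃ : (l * x₃ + m) ^ 2 = M.f x₃ := by
        rw [f]
        linear_combination x₃ ^ 2 * (-s₁) + x₃ * s₂ - s₃
      obtain ⟨R, hR⟩ := M.exists_isPoint e₃
      exact ⟨R, _, _, hR, abelJacobi_collinear h₁ h₁ hR l₁ l₁ rfl s₁ s₂ s₃⟩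
    · exact absurd ⟨rfl, by linear_combination hy⟩ hne
  · obtain ⟨R, hR⟩ := abelJacobi_chord h₁ h₂ hx (l := (y₁ - y₂) / (x₁ - x₂))
      (div_mul_cancel₀ _ (sub_ne_zero.2 hx)) rfl rfl
    exact ⟨R, _, _, hR⟩

theorem exists_abelJacobi_neg (P : Place K) : ∃ R, abelJacobi M.O R = -abelJacobi M.O P := by
  rcases eq_O_or_isPoint (M := M) P with rfl | ⟨a, b, h⟩
  · exact ⟨M.O, by rw [abelJacobi_self, neg_zero]⟩
  · exact ⟨_, (neg_eq_of_add_eq_zero_right h.add_map_τ).symm⟩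

theorem exists_abelJacobi_add (P Q : Place K) :
    ∃ R, abelJacobi M.O R = abelJacobi M.O P + abelJacobi M.O Q := by
  rcases eq_O_or_isPoint (M := M) P with rfl | ⟨a, b, hP⟩
  · exact ⟨Q, by rw [abelJacobi_self, zero_add]⟩
  rcases eq_O_or_isPoint (M := M) Q with rfl | ⟨c, d, hQ⟩
  · exact ⟨P, by rw [abelJacobi_self, add_zero]⟩
  by_cases h : a = c ∧ b = -d
  · obtain ⟨rfl, rfl⟩ := h
    refine ⟨M.O, ?_⟩
    have := hQ.map_τ.unique hP
    rw [this, abelJacobi_self, add_comm, hQ.add_map_τ]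
  · obtain ⟨R, x, y, hR, h0⟩ := exists_add_add_eq_zero hP hQ h
    refine ⟨R.map M.τ, ?_⟩
    rw [eq_neg_of_add_eq_zero_left h0]
    exact (neg_eq_of_add_eq_zero_right hR.add_map_τ).symm

variable (M) in
-- By the chord and tangent construction the image is a subgroup. It contains the class of `D -
-- deg(D) O` for `D` a point, hence for every divisor `D`.
theorem abelJacobi_surjective : Function.Surjective (abelJacobi M.O) := by
  classical
  let G : AddSubgroup (Jac K) :=
    { carrier := Set.range (abelJacobi M.O)
      zero_mem' := ⟨M.O, abelJacobi_self _⟩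
      add_mem' := by
        rintro _ _ ⟨P, rfl⟩ ⟨Q, rfl⟩
        obtain ⟨R, hR⟩ := exists_abelJacobi_add (M := M) P Q
        exact ⟨R, hR⟩
      neg_mem' := by
        rintro _ ⟨P, rfl⟩
        obtain ⟨R, hR⟩ := exists_abelJacobi_neg (M := M) P
        exact ⟨R, hR⟩ }
  have hmem : ∀ D : Divisor K, D - Finsupp.degree D • Finsupp.single M.O 1 ∈ divisorZero K := by
    intro D
    simp [divisorZero, AddMonoidHom.mem_ker]
  have key : ∀ D : Divisor K, (QuotientAddGroup.mk ⟨_, hmem D⟩ : Jac K) ∈ G := by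
    intro D
    induction D using Finsupp.induction_linear with
    | zero =>
      have : (⟨_, hmem 0⟩ : divisorZero K) = 0 := Subtype.ext (by simp)
      rw [this]; exact G.zero_mem
    | add D E hD hE =>
      have : (⟨_, hmem (D + E)⟩ : divisorZero K) = ⟨_, hmem D⟩ + ⟨_, hmem E⟩ :=
        Subtype.ext (by simp [add_smul]; abel)
      rw [this, QuotientAddGroup.mk_add]; exact G.add_mem hD hE
    | single P n =>
      have : (QuotientAddGroup.mk ⟨_, hmem (Finsupp.single P n)⟩ : Jac K) =
          n • abelJacobi M.O P := by
        rw [abelJacobi, ← QuotientAddGroup.mk_zsmul]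
        congr 1
        apply Subtype.ext
        simp [smul_sub]
      rw [this]; exact G.zsmul_mem ⟨P, rfl⟩ n
  intro j
  obtain ⟨D, rfl⟩ := QuotientAddGroup.mk_surjective j
  have h := key D
  have h0 : Finsupp.degree (D : Divisor K) = 0 := D.2
  have : (⟨_, hmem D⟩ : divisorZero K) = D := Subtype.ext (by simp [h0])
  rw [this] at h
  exact h

end CubicModel

/-! ### A smooth cubic is not rational, and the Abel–Jacobi map is injective. -/

theorem Place.HasValue.aeval {K : Type} [Field K] [Algebra ℂ K] {Q : Place K} {g : K} {a : ℂ}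
    (h : Q.HasValue g a) (q : ℂ[X]) : Q.HasValue (Polynomial.aeval g q) (q.eval a) := by
  induction q using Polynomial.induction_on' with
  | add p q hp hq => rw [map_add, eval_add]; exact hp.add hq
  | monomial n c =>
    rw [aeval_monomial, eval_monomial]
    exact (Place.HasValue.const Q c).mul (h.pow n)

/-- If `g` has a single simple pole `O`, then functions regular outside `O` are polynomials
in `g`. -/
theorem exists_eq_aeval {K : Type} [Field K] [Algebra ℂ K] [IsCurveField K] {O : Place K} {g : K}
    (hO : O.val g = WithZero.exp 1) (hg : ∀ Q, Q ≠ O → ¬ Q.IsPole g) (n : ℕ) {h : K}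
    (hh : ∀ Q, Q ≠ O → ¬ Q.IsPole h) (hn : O.val h ≤ WithZero.exp (n : ℤ)) :
    ∃ q : ℂ[X], q.natDegree ≤ n ∧ h = aeval g q := by
  have hg0 : g ≠ 0 := by
    rintro rfl; rw [map_zero] at hO; exact WithZero.exp_ne_zero hO.symm
  induction n generalizing h with
  | zero =>
    obtain ⟨c, hc⟩ := const_of_no_pole (g := h) fun Q => by
      by_cases hQ : Q = O
      · rw [hQ, Place.IsPole, not_lt]; simpa using hn
      · exact hh Q hQ
    exact ⟨C c, by simp, by simpa using hc⟩
  | succ n ih =>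
    have hpow : O.val (g ^ (n + 1)) = WithZero.exp ((n + 1 : ℕ) : ℤ) := by
      rw [map_pow, hO, ← WithZero.exp_nsmul]; simp
    have h1 : O.val (h / g ^ (n + 1)) ≤ 1 := by
      rw [map_div₀, hpow]
      exact div_le_one_of_le₀ hn zero_le
    -- `c` is the leading coefficient: subtracting `c g ^ (n + 1)` lowers the pole order at `O`.
    obtain ⟨c, hc⟩ := O.exists_value (O.val_le_one_iff.1 h1)
    have h2 : h - algebraMap ℂ K c * g ^ (n + 1) =
        (h / g ^ (n + 1) - algebraMap ℂ K c) * g ^ (n + 1) := by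
      field_simp
    have h3 : O.val (h - algebraMap ℂ K c * g ^ (n + 1)) ≤ WithZero.exp (n : ℤ) := by
      rw [h2, map_mul, hpow]
      rcases eq_or_ne (h / g ^ (n + 1) - algebraMap ℂ K c) 0 with h0 | h0
      · rw [h0, map_zero, zero_mul]; exact zero_le
      · have h4 := (O.val_lt_one_iff_ord h0).1 hc
        rw [O.val_eq_exp h0, ← WithZero.exp_add, WithZero.exp_le_exp]
        push_cast
        omega
    obtain ⟨q, hq, hqg⟩ := ih (h := h - algebraMap ℂ K c * g ^ (n + 1)) (by
      intro Q hQ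
      have := hh Q hQ
      have := hg Q hQ
      rw [Place.isPole_iff, not_not] at *
      exact sub_mem ‹h ∈ _› (mul_mem (Q.const_mem c) (pow_mem ‹_› _))) h3
    refine ⟨q + C c * X ^ (n + 1), ?_, ?_⟩
    · refine (natDegree_add_le _ _).trans (max_le (by omega) ?_)
      exact natDegree_C_mul_X_pow_le c (n + 1)
    · rw [map_add, ← hqg]; simp

namespace CubicModel

variable {K : Type} [Field K] [Algebra ℂ K] [IsCurveField K] {M : CubicModel K}
variable {P Q R : Place K} {a b : ℂ}

theorem Y_regular (hQ : Q ≠ M.O) : ¬ Q.IsPole M.Y := by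
  rcases eq_O_or_isPoint (M := M) Q with h | ⟨a, b, h⟩
  · exact absurd h hQ
  · exact h.2.not_isPole

variable (M) in
-- Divide the cubic by `X - e` for a root `e`; by smoothness `e` is not a root of the quadratic
-- quotient.
theorem exists_roots : ∃ e₁ e₂ : ℂ, e₁ ≠ e₂ ∧ M.f e₁ = 0 ∧ M.f e₂ = 0 := by
  obtain ⟨e, he⟩ := IsAlgClosed.exists_root
    (Polynomial.X ^ 3 + C M.a₂ * Polynomial.X ^ 2 + C M.a₄ * Polynomial.X + C M.a₆) (by
      have : (Polynomial.X ^ 3 + C M.a₂ * Polynomial.X ^ 2 + C M.a₄ * Polynomial.X + C M.a₆).degree = 3 := by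
        compute_degree!
      rw [this]; norm_num)
  have he0 : M.f e = 0 := by simpa [f, IsRoot] using he
  have hs := M.smooth e he0
  obtain ⟨d, hd⟩ := IsAlgClosed.exists_root
    (Polynomial.X ^ 2 + C (e + M.a₂) * Polynomial.X + C (e ^ 2 + M.a₂ * e + M.a₄)) (by
      have : (Polynomial.X ^ 2 + C (e + M.a₂) * Polynomial.X + C (e ^ 2 + M.a₂ * e + M.a₄)).degree =
          2 := by
        compute_degree!
      rw [this]; norm_num)
  have hd0 : d ^ 2 + (e + M.a₂) * d + (e ^ 2 + M.a₂ * e + M.a₄) = 0 := by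
    simpa [IsRoot] using hd
  refine ⟨e, d, ?_, he0, ?_⟩
  · rintro rfl
    apply hs
    linear_combination hd0
  · rw [f] at he0 ⊢
    linear_combination (d - e) * hd0 + he0

/-- If `R - O` were the divisor of `g`, then `g` would have a single simple pole, so `X = p(g)` and
`Y = q(g)` with polynomials `p` of degree at most two and `q`, and `q² = f(p)`. Over each root of
`f` there would be a zero of `p'`. Two distinct roots give two zeros of a polynomial of degree at
most one, so `p` would be constant, yet it takes both roots as values. -/
theorem abelJacobi_ne_zero (h : M.IsPoint R a b) : abelJacobi M.O R ≠ 0 := by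
  classical
  intro h0
  rw [abelJacobi, QuotientAddGroup.eq_zero_iff, AddSubgroup.mem_addSubgroupOf] at h0
  obtain ⟨g, hg, hdiv⟩ := h0
  have hRO := h.ne_O
  have hord : ∀ S, S.ord g = (if R = S then 1 else 0) - (if M.O = S then 1 else 0) := by
    intro S
    rw [← hdiv]
    simp [Finsupp.single_apply]
  have hO : M.O.val g = WithZero.exp 1 := by
    rw [M.O.val_eq_exp hg, hord, if_neg hRO, if_pos rfl]; rfl
  have hreg : ∀ Q, Q ≠ M.O → ¬ Q.IsPole g := by
    intro Q hQ
    rw [Place.IsPole, not_lt, Q.val_le_one_iff_ord hg, hord, if_neg hQ.symm]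
    split_ifs <;> norm_num
  obtain ⟨p, hp, hpX⟩ := exists_eq_aeval hO hreg 2 (h := M.X)
    (fun Q hQ => fun hpole => hQ (isPole_iff.1 hpole)) (by rw [O_val_X]; rfl)
  obtain ⟨q, -, hqY⟩ := exists_eq_aeval hO hreg 3 (h := M.Y)
    (fun Q hQ => Y_regular hQ) (by rw [O_val_Y]; rfl)
  have hgt : Transcendental ℂ g := M.O.transcendental_of_ord_ne_zero (by
    rw [hord, if_neg hRO, if_pos rfl]; norm_num)
  have hpoly : q ^ 2 = p ^ 3 + C M.a₂ * p ^ 2 + C M.a₄ * p + C M.a₆ := by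
    apply transcendental_iff_injective.1 hgt
    simp only [map_add, map_mul, map_pow, aeval_C, ← hpX, ← hqY]
    exact M.eqn
  have hder := congrArg derivative hpoly
  have hp2 : p = C (p.coeff 2) * Polynomial.X ^ 2 + C (p.coeff 1) * Polynomial.X + C (p.coeff 0) :=
    eq_quadratic_of_degree_le_two (natDegree_le_iff_degree_le.1 hp)
  set c₂ := p.coeff 2
  set c₁ := p.coeff 1
  set c₀ := p.coeff 0
  -- Here `α` is the value of `g` at the point `(e, 0)`. Differentiating `q² = f(p)` at `α`, where
  -- `q` vanishes, leaves `f'(e) p'(α) = 0`.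
  have key : ∀ e, M.f e = 0 → ∃ α, c₂ * α ^ 2 + c₁ * α + c₀ = e ∧ 2 * c₂ * α + c₁ = 0 := by
    intro e he
    obtain ⟨Q, hQ⟩ := M.exists_isPoint (b := 0) (by rw [he]; ring : (0 : ℂ) ^ 2 = M.f e)
    obtain ⟨α, hα⟩ := Q.exists_value_of_not_isPole (hreg Q hQ.ne_O)
    have h1 : p.eval α = e := by
      have := hα.aeval p
      rw [← hpX] at this
      exact this.unique hQ.1
    have h2 : q.eval α = 0 := by
      have := hα.aeval q
      rw [← hqY] at this
      exact this.unique hQ.2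
    have h3 := congrArg (eval α) hder
    simp only [derivative_pow, derivative_add, derivative_mul, derivative_C, eval_add, eval_mul,
      eval_pow, eval_C, h1, h2, map_natCast, eval_natCast] at h3
    have h4 : p.derivative.eval α = 2 * c₂ * α + c₁ := by
      rw [hp2]
      simp
      ring
    rw [h4] at h3
    refine ⟨α, ?_, ?_⟩
    · rw [← h1, hp2]; simp
    · have h5 : (3 * e ^ 2 + 2 * M.a₂ * e + M.a₄) * (2 * c₂ * α + c₁) = 0 := by
        norm_num at h3
        linear_combination -h3
      exact (mul_eq_zero.1 h5).resolve_left (M.smooth e he)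
  obtain ⟨e₁, e₂, hne, he₁, he₂⟩ := M.exists_roots
  obtain ⟨α, hα, hα'⟩ := key e₁ he₁
  obtain ⟨β, hβ, hβ'⟩ := key e₂ he₂
  have hαβ : α - β ≠ 0 := by
    intro h0
    obtain rfl := sub_eq_zero.1 h0
    exact hne (hα.symm.trans hβ)
  have h2 : c₂ = 0 := by
    apply mul_left_cancel₀ hαβ
    linear_combination (hα' - hβ') / 2
  have h1 : c₁ = 0 := by
    rw [h2] at hα'; linear_combination hα'
  apply hne
  rw [← hα, ← hβ, h2, h1]; ring

variable (M) in
-- If `P ≠ Q` had the same class, the third point on the line through `P` and `-Q` would be an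
-- affine point of class zero.
theorem abelJacobi_injective : Function.Injective (abelJacobi M.O) := by
  intro P Q hPQ
  by_contra hne
  rcases eq_O_or_isPoint (M := M) P with rfl | ⟨a, b, hP⟩
  · rcases eq_O_or_isPoint (M := M) Q with rfl | ⟨c, d, hQ⟩
    · exact hne rfl
    · rw [abelJacobi_self] at hPQ
      exact abelJacobi_ne_zero hQ hPQ.symm
  · rcases eq_O_or_isPoint (M := M) Q with rfl | ⟨c, d, hQ⟩
    · rw [abelJacobi_self] at hPQ
      exact abelJacobi_ne_zero hP hPQ
    · have h1 : ¬ (a = c ∧ b = -(-d)) := by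
        rw [neg_neg, ← hP.eq_iff hQ]; exact hne
      obtain ⟨R, x, y, hR, h0⟩ := exists_add_add_eq_zero hP hQ.map_τ h1
      rw [hPQ, hQ.add_map_τ, zero_add] at h0
      exact abelJacobi_ne_zero hR h0

variable (M) in
theorem abelJacobi_bijective : Function.Bijective (abelJacobi M.O) :=
  ⟨M.abelJacobi_injective, M.abelJacobi_surjective⟩

theorem abelJacobi_eq_zero_iff : abelJacobi M.O P = 0 ↔ P = M.O := by
  rw [← abelJacobi_self M.O, M.abelJacobi_injective.eq_iff]

/-- A flex of the cubic is a point of order three. -/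
theorem addOrderOf_flex {l m : ℂ} (h : M.IsPoint P a b) (hb : b = l * a + m)
    (s₁ : a + a + a = l ^ 2 - M.a₂) (s₂ : a * a + a * a + a * a = M.a₄ - 2 * l * m)
    (s₃ : a * a * a = m ^ 2 - M.a₆) : addOrderOf (abelJacobi M.O P) = 3 := by
  have : Fact (Nat.Prime 3) := ⟨Nat.prime_three⟩
  apply addOrderOf_eq_prime
  · rw [← abelJacobi_collinear h h h hb hb hb s₁ s₂ s₃]; abel
  · exact abelJacobi_ne_zero h

/-- Homomorphisms that agree on all points with finitely many exceptional `X`-coordinates agree. -/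
theorem hom_ext {G : Type*} [AddCommGroup G] {h₁ h₂ : Jac K →+ G} (S : Finset ℂ)
    (h : ∀ P a b, M.IsPoint P a b → a ∉ S →
      h₁ (abelJacobi M.O P) = h₂ (abelJacobi M.O P)) : h₁ = h₂ := by
  classical
  -- the exceptional points
  let B : Set (Place K) := {P | P = M.O ∨ ∃ a ∈ S, P.HasValue M.X a}
  have hBfin : B.Finite := by
    have hsub : B ⊆ {M.O} ∪ ⋃ a ∈ S, {P | P.HasValue M.X a} := by
      rintro P (rfl | ⟨a, ha, hP⟩)
      · exact Or.inl rfl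
      · exact Or.inr (Set.mem_biUnion ha hP)
    refine Set.Finite.subset (Set.Finite.union (Set.finite_singleton _)
      (S.finite_toSet.biUnion fun a _ => ?_)) hsub
    exact (fibre M.toLine (ratPlace a)).finite_toSet.subset fun P hP =>
      (mem_fibre_ratPlace M.transcendental).2 hP
  have hB : ∀ P, P ∉ B → h₁ (abelJacobi M.O P) = h₂ (abelJacobi M.O P) := by
    intro P hP
    rcases eq_O_or_isPoint (M := M) P with hO | ⟨a, b, hab⟩
    · exact absurd (Or.inl hO) hP
    · exact h P a b hab fun ha => hP (Or.inr ⟨a, ha, hab.1⟩)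
  have hinf : Infinite (Place K) := by
    choose F hF using exists_hasValue M.transcendental
    exact Infinite.of_injective F fun a b hab => (hF a).unique (hab ▸ hF b)
  refine AddMonoidHom.ext fun j => ?_
  obtain ⟨R, rfl⟩ := M.abelJacobi_surjective j
  have hfin2 : {P : Place K | ∃ Q ∈ B,
      abelJacobi M.O P = abelJacobi M.O R - abelJacobi M.O Q}.Finite := by
    have : {P : Place K | ∃ Q ∈ B, abelJacobi M.O P = abelJacobi M.O R - abelJacobi M.O Q} =
        abelJacobi M.O ⁻¹' ((fun Q => abelJacobi M.O R - abelJacobi M.O Q) '' B) := by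
      ext P
      simp [eq_comm]
    rw [this]
    exact (hBfin.image _).preimage M.abelJacobi_injective.injOn
  -- There are infinitely many points, so the class of `R` can be written as `P + Q` with both
  -- summands outside the exceptional set.
  obtain ⟨P, hP⟩ := (hBfin.union hfin2).exists_notMem
  rw [Set.mem_union, not_or] at hP
  obtain ⟨Q, hQ⟩ := M.abelJacobi_surjective (abelJacobi M.O R - abelJacobi M.O P)
  have hQB : Q ∉ B := fun hQB => hP.2 ⟨Q, hQB, by rw [hQ]; abel⟩
  have hsum : abelJacobi M.O R = abelJacobi M.O P + abelJacobi M.O Q := by rw [hQ]; abel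
  rw [hsum, map_add, map_add, hB P hP.1, hB Q hQB]

end CubicModel

/-! Homomorphisms of Jacobians given by correspondences. -/

section Correspondence

variable {K F F' : Type} [Field K] [Algebra ℂ K] [IsCurveField K] [Field F] [Algebra ℂ F]
  [IsCurveField F] [Field F'] [Algebra ℂ F'] [IsCurveField F']

theorem Descends.map_mk {G : Divisor F →+ Divisor F'} (h : Descends G) (D : divisorZero F) :
    h.map (QuotientAddGroup.mk D) = QuotientAddGroup.mk ⟨G D, h.degree D.2⟩ := rfl

theorem Descends.map_pushforward {φ : F' →ₐ[ℂ] F} (h : Descends (pushforward φ)) (O P : Place F) :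
    h.map (abelJacobi O P) = abelJacobi (O.map φ) (P.map φ) := by
  rw [abelJacobi, abelJacobi]
  refine congrArg QuotientAddGroup.mk (Subtype.ext ?_)
  change pushforward φ (Finsupp.single P 1 - Finsupp.single O 1) = _
  rw [map_sub, pushforward_single, pushforward_single]

/-- The pull-back of `P - O` is `Q + R - Q₀ - R₀`. It has degree zero, so the base point `O'`
cancels and may be chosen freely. -/
theorem Descends.map_correspondence {φ : F →ₐ[ℂ] K} {φ' : F' →ₐ[ℂ] K} {σ : K →ₐ[ℂ] K}
    (hφ' : Descends (pushforward φ')) (hσ : Descends (pushforward σ)) (hφ : Descends (pullback φ))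
    (hdeg : PoonenCurve.degree φ ≤ 2) {O P : Place F} (O' : Place F') {Q R Q₀ R₀ : Place K}
    (hQ : Q.map φ = P) (hR : R.map φ = P) (hQR : Q ≠ R)
    (hQ₀ : Q₀.map φ = O) (hR₀ : R₀.map φ = O) (hQR₀ : Q₀ ≠ R₀) :
    (hφ'.map.comp (hσ.map.comp hφ.map)) (abelJacobi O P) =
      abelJacobi O' ((Q.map σ).map φ') + abelJacobi O' ((R.map σ).map φ') -
        (abelJacobi O' ((Q₀.map σ).map φ') + abelJacobi O' ((R₀.map σ).map φ')) := by
  have h1 := (fibre_of_degree_le_two hdeg hQ hR hQR).2.2.2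
  have h2 := (fibre_of_degree_le_two hdeg hQ₀ hR₀ hQR₀).2.2.2
  rw [AddMonoidHom.comp_apply, AddMonoidHom.comp_apply]
  simp only [abelJacobi, Descends.map_mk]
  rw [← QuotientAddGroup.mk_add, ← QuotientAddGroup.mk_add, ← QuotientAddGroup.mk_sub]
  congr 1
  apply Subtype.ext
  simp only [AddSubgroup.coe_sub, AddSubgroup.coe_add, map_sub, h1, h2, map_add, pushforward_single]
  abel

end Correspondence

namespace CubicModel

/-! ### The kernel of an isogeny, read off from poles. -/

section Kernel

variable {K K' : Type} [Field K] [Algebra ℂ K] [IsCurveField K] [Field K'] [Algebra ℂ K']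
  [IsCurveField K'] {M : CubicModel K} {M' : CubicModel K'}

/-- A point lies in the kernel iff it maps to the origin, that is, iff the pull-back of `X` has a
pole there. The points with `X = a` are `T` and `-T`. -/
theorem ker_eq_zmultiples {h : Jac K →+ Jac K'} {ψ : K' →ₐ[ℂ] K} {T : Place K} {a b : ℂ}
    (hψ : ∀ P, h (abelJacobi M.O P) = abelJacobi M'.O (P.map ψ)) (hT : M.IsPoint T a b)
    (hker : ∀ P, P.IsPole (ψ M'.X) ↔ P = M.O ∨ P.HasValue M.X a) :
    h.ker = AddSubgroup.zmultiples (abelJacobi M.O T) := by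
  have hker' : ∀ P, h (abelJacobi M.O P) = 0 ↔ P = M.O ∨ P.HasValue M.X a := by
    intro P
    rw [hψ, abelJacobi_eq_zero_iff, ← isPole_iff, Place.map_isPole_iff, hker]
  apply le_antisymm
  · intro j hj
    obtain ⟨P, rfl⟩ := M.abelJacobi_surjective j
    rcases (hker' P).1 hj with rfl | hP
    · rw [abelJacobi_self]; exact zero_mem _
    · rcases eq_O_or_isPoint (M := M) P with rfl | ⟨c, d, hcd⟩
      · rw [abelJacobi_self]; exact zero_mem _
      · obtain rfl := hcd.1.unique hP
        have h1 : (d - b) * (d + b) = 0 := by linear_combination hcd.eqn - hT.eqn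
        rcases mul_eq_zero.1 h1 with h2 | h2
        · obtain rfl := sub_eq_zero.1 h2
          rw [hT.unique hcd]
          exact AddSubgroup.mem_zmultiples _
        · obtain rfl : d = -b := by linear_combination h2
          rw [hT.map_τ.unique hcd, ← neg_eq_of_add_eq_zero_right hT.add_map_τ]
          exact neg_mem (AddSubgroup.mem_zmultiples _)
  · rw [AddSubgroup.zmultiples_le, AddMonoidHom.mem_ker, hker']
    exact Or.inr hT.1

end Kernel

/-! The 3-isogeny from `Y² = (X - m)³ + r² (3X + m)²` to `Y² = (X - m')³ + r² (3X + m')²`, where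
`m + m' = r²`. -/

section ThreeIsogeny

variable {K : Type} [Field K] [Algebra ℂ K] (M : CubicModel K)

/-- The equation is `Y² = (X - m)³ + r² (3X + m)²`. -/
structure HasFlexForm (r m : ℂ) : Prop where
  a₂_eq : M.a₂ = 9 * r ^ 2 - 3 * m
  a₄_eq : M.a₄ = 3 * m ^ 2 + 6 * r ^ 2 * m
  a₆_eq : M.a₆ = r ^ 2 * m ^ 2 - m ^ 3

theorem smooth_flexForm {r m e : ℂ} (hr : r ≠ 0) (hm : m ≠ 0) (hm' : m ≠ r ^ 2)
    (h : (e - m) ^ 3 + r ^ 2 * (3 * e + m) ^ 2 = 0) :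
    3 * (e - m) ^ 2 + 6 * r ^ 2 * (3 * e + m) ≠ 0 := by
  intro h'
  -- Subtracting `(e - m)/3` times the derivative removes the cube and leaves a product of linear
  -- factors.
  have h1 : r ^ 2 * ((3 * e + m) * (e + 3 * m)) = 0 := by
    linear_combination h - (e - m) / 3 * h'
  rcases mul_eq_zero.1 ((mul_eq_zero.1 h1).resolve_left (pow_ne_zero 2 hr)) with h2 | h2
  · rw [h2] at h
    have h3 : e - m = 0 := by
      apply pow_eq_zero_iff (three_ne_zero) |>.1
      linear_combination h
    exact hm (by linear_combination h2 / 4 - 3 / 4 * h3)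
  · obtain rfl : e = -(3 * m) := by linear_combination h2
    have h3 : m * (m - r ^ 2) = 0 := by linear_combination h' / 48
    exact hm' (sub_eq_zero.1 ((mul_eq_zero.1 h3).resolve_left hm))

/-- The `X`-coordinate of the isogeny. -/
noncomputable def isogX (r m : ℂ) : K :=
  algebraMap ℂ K (r ^ 2 - m) - ((M.X - algebraMap ℂ K m) ^ 3 +
    algebraMap ℂ K (12 * r ^ 2) * (M.X - algebraMap ℂ K m) ^ 2 +
    algebraMap ℂ K (48 * r ^ 2 * m) * (M.X - algebraMap ℂ K m) +
    algebraMap ℂ K (64 * r ^ 2 * m ^ 2)) / (algebraMap ℂ K 3 * (M.X - algebraMap ℂ K m) ^ 2)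

/-- The `Y`-coordinate of the isogeny. -/
noncomputable def isogY (r m s : ℂ) : K :=
  M.Y * ((M.X - algebraMap ℂ K m) ^ 3 -
    algebraMap ℂ K (48 * r ^ 2 * m) * (M.X - algebraMap ℂ K m) -
    algebraMap ℂ K (128 * r ^ 2 * m ^ 2)) / (algebraMap ℂ K (s ^ 3) * (M.X - algebraMap ℂ K m) ^ 3)

/-- The value of the `X`-coordinate of the isogeny. -/
noncomputable def isogXVal (r m a : ℂ) : ℂ :=
  r ^ 2 - m - ((a - m) ^ 3 + 12 * r ^ 2 * (a - m) ^ 2 + 48 * r ^ 2 * m * (a - m) +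
    64 * r ^ 2 * m ^ 2) / (3 * (a - m) ^ 2)

/-- The value of the `Y`-coordinate of the isogeny. -/
noncomputable def isogYVal (r m s a b : ℂ) : ℂ :=
  b * ((a - m) ^ 3 - 48 * r ^ 2 * m * (a - m) - 128 * r ^ 2 * m ^ 2) / (s ^ 3 * (a - m) ^ 3)

variable {M} {r m s a b : ℂ} {P : Place K}

theorem hasValue_isogX (h : P.HasValue M.X a) (ha : a ≠ m) :
    P.HasValue (M.isogX r m) (isogXVal r m a) := by
  have c := Place.HasValue.const P
  have hw := h.sub (c m)
  exact (c _).sub (((((hw.pow 3).add ((c _).mul (hw.pow 2))).add ((c _).mul hw)).add (c _)).div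
    ((c 3).mul (hw.pow 2)) (mul_ne_zero three_ne_zero (pow_ne_zero 2 (sub_ne_zero.2 ha))))

theorem hasValue_isogY (h : P.HasValue M.X a) (h' : P.HasValue M.Y b) (ha : a ≠ m) (hs : s ≠ 0) :
    P.HasValue (M.isogY r m s) (isogYVal r m s a b) := by
  have c := Place.HasValue.const P
  have hw := h.sub (c m)
  exact (h'.mul (((hw.pow 3).sub ((c _).mul hw)).sub (c _))).div ((c _).mul (hw.pow 3))
    (mul_ne_zero (pow_ne_zero 3 hs) (pow_ne_zero 3 (sub_ne_zero.2 ha)))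

variable [IsCurveField K]

theorem isogX_inv (r m : ℂ) : (M.isogX r m)⁻¹ =
    algebraMap ℂ K 3 * (M.X - algebraMap ℂ K m) ^ 2 / (algebraMap ℂ K (r ^ 2 - m) *
      (algebraMap ℂ K 3 * (M.X - algebraMap ℂ K m) ^ 2) - ((M.X - algebraMap ℂ K m) ^ 3 +
    algebraMap ℂ K (12 * r ^ 2) * (M.X - algebraMap ℂ K m) ^ 2 +
    algebraMap ℂ K (48 * r ^ 2 * m) * (M.X - algebraMap ℂ K m) +
    algebraMap ℂ K (64 * r ^ 2 * m ^ 2))) := by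
  have h : algebraMap ℂ K 3 * (M.X - algebraMap ℂ K m) ^ 2 ≠ 0 :=
    mul_ne_zero ((_root_.map_ne_zero _).2 three_ne_zero) (pow_ne_zero 2 (X_sub_ne_zero m))
  rw [isogX, sub_div' h, inv_div]

theorem isPole_isogX_of_hasValue (hr : r ≠ 0) (hm : m ≠ 0) (h : P.HasValue M.X m) :
    P.IsPole (M.isogX r m) := by
  have c := Place.HasValue.const P
  have hw := h.sub (c m)
  have h1 := (((c (r ^ 2 - m)).mul ((c 3).mul (hw.pow 2))).sub ((((hw.pow 3).add
    ((c (12 * r ^ 2)).mul (hw.pow 2))).add ((c (48 * r ^ 2 * m)).mul hw)).add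
    (c (64 * r ^ 2 * m ^ 2))))
  have hne : (r ^ 2 - m) * (3 * (m - m) ^ 2) - ((m - m) ^ 3 + 12 * r ^ 2 * (m - m) ^ 2 +
      48 * r ^ 2 * m * (m - m) + 64 * r ^ 2 * m ^ 2) ≠ 0 := by
    have : r ^ 2 * m ^ 2 ≠ 0 := mul_ne_zero (pow_ne_zero 2 hr) (pow_ne_zero 2 hm)
    intro h0
    apply this
    linear_combination -h0 / 64
  have h2 := ((c 3).mul (hw.pow 2)).div h1 hne
  rw [← isogX_inv, sub_self, zero_pow two_ne_zero, mul_zero, zero_div] at h2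
  have h3 : (M.isogX r m)⁻¹ ≠ 0 := by
    rw [isogX_inv]
    exact div_ne_zero (mul_ne_zero ((_root_.map_ne_zero _).2 three_ne_zero)
      (pow_ne_zero 2 (X_sub_ne_zero m))) (h1.ne_zero hne)
  have := h2.inv_isPole h3
  rwa [inv_inv] at this

/-- The `X`-coordinate of the isogeny grows like `-(X - m)/3` at infinity. -/
theorem isPole_isogX_O : M.O.IsPole (M.isogX r m) := by
  rw [Place.isPole_iff]
  intro h
  have hpole : M.O.IsPole (M.X - algebraMap ℂ K m) := by
    rw [Place.IsPole, Place.one_lt_val_iff_ord _ (X_sub_ne_zero m), O_ord_X_sub]; norm_num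
  have hinv := hpole.inv.mem
  rw [Place.isPole_iff] at hpole
  apply hpole
  have c := M.O.const_mem
  have hw : M.X - algebraMap ℂ K m ≠ 0 := X_sub_ne_zero m
  have h3 : (algebraMap ℂ K 3) ≠ 0 := (_root_.map_ne_zero _).2 three_ne_zero
  -- The definition solved for its leading term: were `isogX` regular at `O`, so would be `X - m`,
  -- as its inverse is.
  have key : M.X - algebraMap ℂ K m =
      algebraMap ℂ K 3 * (algebraMap ℂ K (r ^ 2 - m) - M.isogX r m) -
      algebraMap ℂ K (12 * r ^ 2) - algebraMap ℂ K (48 * r ^ 2 * m) * (M.X - algebraMap ℂ K m)⁻¹ -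
      algebraMap ℂ K (64 * r ^ 2 * m ^ 2) * (M.X - algebraMap ℂ K m)⁻¹ ^ 2 := by
    rw [isogX]
    field_simp
    ring
  rw [key]
  exact sub_mem (sub_mem (sub_mem (mul_mem (c _) (sub_mem (c _) h)) (c _)) (mul_mem (c _) hinv))
    (mul_mem (c _) (pow_mem hinv 2))

theorem isPole_isogX_iff (hr : r ≠ 0) (hm : m ≠ 0) :
    P.IsPole (M.isogX r m) ↔ P = M.O ∨ P.HasValue M.X m := by
  constructor
  · intro h
    rcases eq_O_or_isPoint (M := M) P with hO | ⟨a, b, hab⟩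
    · exact Or.inl hO
    · right
      by_cases ha : a = m
      · rw [← ha]; exact hab.1
      · exact absurd h (hasValue_isogX hab.1 ha).not_isPole
  · rintro (rfl | h)
    · exact isPole_isogX_O
    · exact isPole_isogX_of_hasValue hr hm h

theorem isogX_transcendental : Transcendental ℂ (M.isogX r m) := by
  apply transcendental_of_not_const
  intro c hc
  have h := isPole_isogX_O (M := M) (r := r) (m := m)
  rw [hc] at h
  exact (Place.HasValue.const _ c).not_isPole h

theorem isog_eqn (h : M.HasFlexForm r m) (hs : s ^ 2 = -3) :
    M.isogY r m s ^ 2 = M.isogX r m ^ 3 +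
      algebraMap ℂ K (9 * r ^ 2 - 3 * (r ^ 2 - m)) * M.isogX r m ^ 2 +
      algebraMap ℂ K (3 * (r ^ 2 - m) ^ 2 + 6 * r ^ 2 * (r ^ 2 - m)) * M.isogX r m +
      algebraMap ℂ K (r ^ 2 * (r ^ 2 - m) ^ 2 - (r ^ 2 - m) ^ 3) := by
  have hw : M.X - algebraMap ℂ K m ≠ 0 := X_sub_ne_zero m
  have hY : M.Y ^ 2 = (M.X - algebraMap ℂ K m) ^ 3 + algebraMap ℂ K r ^ 2 *
      (3 * (M.X - algebraMap ℂ K m) + 4 * algebraMap ℂ K m) ^ 2 := by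
    rw [M.eqn, h.a₂_eq, h.a₄_eq, h.a₆_eq]
    simp only [map_add, map_sub, map_mul, map_pow, map_ofNat]
    ring
  -- The cube of `isogX` has leading term `-(X - m)³/27`, which is why `isogY` needs a square root
  -- of `-3`.
  have hs6 : (algebraMap ℂ K (s ^ 3)) ^ 2 = -27 := by
    rw [← map_pow, ← pow_mul, mul_comm 3 2, pow_mul, hs, map_pow, map_neg, map_ofNat]; norm_num
  have h3 : (3 : K) ≠ 0 := by
    rw [← map_ofNat (algebraMap ℂ K)]; exact (_root_.map_ne_zero _).2 three_ne_zero
  rw [isogY, div_pow, mul_pow, mul_pow, hs6, hY, isogX]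
  simp only [map_add, map_sub, map_mul, map_pow, map_ofNat] at hw ⊢
  generalize M.X - algebraMap ℂ K m = w at hw
  have h27 : (-27 : K) = -3 ^ 3 := by norm_num
  rw [h27]
  field_simp
  ring

/-- The points at which the flex tangents touch. -/
theorem addOrderOf_flexForm (h : M.HasFlexForm r m) (hP : M.IsPoint P m b)
    (hb : b ^ 2 = (4 * r * m) ^ 2) : addOrderOf (abelJacobi M.O P) = 3 := by
  -- The flex tangent is `Y = ρ(3X + m)`: on it the equation becomes `(X - m)³ = 0`.
  have key : ∀ ρ : ℂ, ρ ^ 2 = r ^ 2 → b = 4 * ρ * m → addOrderOf (abelJacobi M.O P) = 3 := by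
    intro ρ hρ hb
    refine addOrderOf_flex (l := 3 * ρ) (m := ρ * m) hP (by rw [hb]; ring) ?_ ?_ ?_
    · rw [h.a₂_eq]; linear_combination -9 * hρ
    · rw [h.a₄_eq]; linear_combination 6 * m * hρ
    · rw [h.a₆_eq]; linear_combination -m ^ 2 * hρ
  rcases sq_eq_sq_iff_eq_or_eq_neg.1 hb with h | h
  · exact key r rfl h
  · exact key (-r) (neg_sq r) (by rw [h]; ring)

end ThreeIsogeny

end CubicModel

/-! ### Generators and the involution of a double cover of the line. -/

theorem DoubleCover.eq_top_of_mem {f : ℂ[X]} [Fact (Irreducible (quad f))]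
    (L : IntermediateField ℂ (DoubleCover f)) (hx : DoubleCover.x f ∈ L)
    (hy : DoubleCover.y f ∈ L) : L = ⊤ := by
  rw [eq_top_iff]
  intro z _
  have hp : ∀ q : ℂ[X], AdjoinRoot.of (quad f) (algebraMap ℂ[X] (RatFunc ℂ) q) ∈ L := by
    intro q
    rw [← DoubleCover.aeval_x]
    exact Algebra.adjoin_le (S := L.toSubalgebra) (Set.singleton_subset_iff.2 hx)
      (aeval_mem_adjoin_singleton ℂ (DoubleCover.x f))
  have hr : ∀ r : RatFunc ℂ, AdjoinRoot.of (quad f) r ∈ L := by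
    intro r
    obtain ⟨q, q', _, rfl⟩ := IsFractionRing.div_surjective (A := ℂ[X]) r
    rw [map_div₀]
    exact L.div_mem (hp q) (hp q')
  induction z using AdjoinRoot.induction_on with
  | ih q =>
    induction q using Polynomial.induction_on' with
    | add q q' hq hq' => rw [map_add]; exact L.add_mem (hq trivial) (hq' trivial)
    | monomial n a =>
      rw [← C_mul_X_pow_eq_monomial, map_mul, map_pow, AdjoinRoot.mk_X, AdjoinRoot.mk_C]
      exact L.mul_mem (hr a) (pow_mem hy n)

/-- The involution `y ↦ -y`. -/
noncomputable def DoubleCover.involution (f : ℂ[X]) [Fact (Irreducible (quad f))] :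
    DoubleCover f →ₐ[ℂ] DoubleCover f :=
  DoubleCover.lift (DoubleCover.x f) (-DoubleCover.y f) DoubleCover.x_transcendental
    (by rw [neg_sq, DoubleCover.y_sq])

theorem DoubleCover.involution_x (f : ℂ[X]) [Fact (Irreducible (quad f))] :
    DoubleCover.involution f (DoubleCover.x f) = DoubleCover.x f := DoubleCover.lift_x ..

theorem DoubleCover.involution_y (f : ℂ[X]) [Fact (Irreducible (quad f))] :
    DoubleCover.involution f (DoubleCover.y f) = -DoubleCover.y f := DoubleCover.lift_y ..

/-! ### The Weierstrass models of `E₁` and `E₂`. -/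

namespace Param

open DoubleCover

variable (p : Param)

/-- The parameter of the equations of `E₁` and `E₂`. -/
noncomputable def r : ℂ := 2 * p.t ^ 3 / (1 + p.t ^ 6)

/-- The product `u v w` up to sign. -/
noncomputable def n : ℂ := p.r ^ 2 - 1

/-- The parameter of the action of `σ` on `(x - t²) / (x + t²)`. -/
noncomputable def s : ℂ := (p.ζ - 1) / (p.ζ + 1)

theorem one_add_t_pow_ne_zero : 1 + p.t ^ 6 ≠ 0 := fun h =>
  p.t_pow_ne_one (by linear_combination (p.t ^ 6 - 1) * h)

theorem r_ne_zero : p.r ≠ 0 :=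
  div_ne_zero (mul_ne_zero two_ne_zero (pow_ne_zero 3 p.t_ne_zero)) p.one_add_t_pow_ne_zero

theorem n_ne_zero : p.n ≠ 0 := by
  have h1 := p.one_add_t_pow_ne_zero
  have h2 : 1 - p.t ^ 6 ≠ 0 := fun h =>
    p.t_pow_ne_one (by linear_combination -(p.t ^ 6 + 1) * h)
  have h3 : p.n = -((1 - p.t ^ 6) / (1 + p.t ^ 6)) ^ 2 := by
    rw [n, r]; field_simp; ring
  rw [h3]
  exact neg_ne_zero.2 (pow_ne_zero 2 (div_ne_zero h2 h1))

theorem zeta_add_one_ne_zero : p.ζ + 1 ≠ 0 := by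
  have h : p.ζ + 1 = -p.ζ ^ 2 := by linear_combination p.zeta_rel
  rw [h]
  exact neg_ne_zero.2 (pow_ne_zero 2 (p.isPrimitiveRoot.ne_zero (by norm_num)))

theorem s_sq : p.s ^ 2 = -3 := by
  have h := p.zeta_add_one_ne_zero
  rw [s]
  field_simp
  linear_combination 4 * p.zeta_rel

theorem s_ne_zero : p.s ≠ 0 := by
  intro h
  have := p.s_sq
  rw [h] at this
  norm_num at this

/-- For `z = (a - t²)/(a + t²)` one has `z² - 1 = -4at²/(a + t²)²`, and `a³ = 1` gives `3z² + 1 =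
4(1 + t⁶)/(a + t²)³`. Thus `u`, `v`, `w` are roots of the cubic in flex form. -/
theorem cubic_eq_zero {a : ℂ} (ha : a ^ 3 = 1) :
    (((a - p.t ^ 2) / (a + p.t ^ 2)) ^ 2 - 1) ^ 3 +
      p.r ^ 2 * (3 * ((a - p.t ^ 2) / (a + p.t ^ 2)) ^ 2 + 1) ^ 2 = 0 := by
  have h1 := p.add_ne_zero_of_cube ha
  have h2 := p.one_add_t_pow_ne_zero
  have h3 : ((a - p.t ^ 2) / (a + p.t ^ 2)) ^ 2 - 1 = -(4 * a * p.t ^ 2) / (a + p.t ^ 2) ^ 2 := by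
    field_simp; ring
  have h4 : 3 * ((a - p.t ^ 2) / (a + p.t ^ 2)) ^ 2 + 1 =
      4 * (1 + p.t ^ 6) / (a + p.t ^ 2) ^ 3 := by
    field_simp
    linear_combination 4 * ha
  rw [h3, h4, r]
  field_simp
  linear_combination -64 * p.t ^ 6 * ha

/-- Three distinct roots determine a monic cubic; the relations come from divided differences of the
cubic at the roots. -/
theorem vieta : p.u + p.v + p.w = -(9 * p.r ^ 2 - 3) ∧
    p.u * p.v + p.u * p.w + p.v * p.w = 3 + 6 * p.r ^ 2 ∧ p.u * p.v * p.w = -(p.r ^ 2 - 1) := by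
  have hu := p.cubic_eq_zero (one_pow 3)
  have hv := p.cubic_eq_zero p.zeta_cube
  have hw := p.cubic_eq_zero p.zeta_sq_cube
  have huv := p.u_sub_v
  have huw := p.u_sub_w
  have hvw : p.v - p.w ≠ 0 := by
    refine p.sq_sub_sq_ne_zero p.zeta_cube p.zeta_sq_cube fun h => ?_
    apply p.isPrimitiveRoot.ne_one (by norm_num)
    apply mul_left_cancel₀ (p.isPrimitiveRoot.ne_zero (by norm_num))
    linear_combination -h
  rw [← u] at hu
  rw [← v] at hv
  rw [← w] at hw
  have h1 : p.u ^ 2 + p.u * p.v + p.v ^ 2 + (9 * p.r ^ 2 - 3) * (p.u + p.v) +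
      (3 + 6 * p.r ^ 2) = 0 := by
    apply mul_left_cancel₀ huv
    linear_combination hu - hv
  have h2 : p.u ^ 2 + p.u * p.w + p.w ^ 2 + (9 * p.r ^ 2 - 3) * (p.u + p.w) +
      (3 + 6 * p.r ^ 2) = 0 := by
    apply mul_left_cancel₀ huw
    linear_combination hu - hw
  have h3 : p.u + p.v + p.w = -(9 * p.r ^ 2 - 3) := by
    apply mul_left_cancel₀ hvw
    linear_combination h1 - h2
  have h4 : p.u * p.v + p.u * p.w + p.v * p.w = 3 + 6 * p.r ^ 2 := by
    linear_combination (p.u + p.v) * h3 - h1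
  refine ⟨h3, h4, ?_⟩
  linear_combination hu + p.u * h4 - p.u ^ 2 * h3

theorem polyE₁_eq : p.polyE₁ = X ^ 3 + C (9 * p.r ^ 2 - 3) * X ^ 2 + C (3 + 6 * p.r ^ 2) * X +
    C (p.r ^ 2 - 1) := by
  obtain ⟨h1, h2, h3⟩ := p.vieta
  have e1 := congrArg C h1
  have e2 := congrArg C h2
  have e3 := congrArg C h3
  rw [C_neg] at e1 e3
  rw [← neg_eq_iff_eq_neg] at e1 e3
  rw [← e1, ← e2, ← e3, polyE₁]
  simp only [C_add, C_mul]
  ring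

theorem aeval_polyE₁ {L : Type} [Field L] [Algebra ℂ L] (a : L) : aeval a p.polyE₁ =
    a ^ 3 + algebraMap ℂ L (9 * p.r ^ 2 - 3) * a ^ 2 + algebraMap ℂ L (3 + 6 * p.r ^ 2) * a +
      algebraMap ℂ L (p.r ^ 2 - 1) := by
  rw [polyE₁_eq]
  simp only [map_add, map_mul, map_pow, aeval_X, aeval_C]

theorem aeval_polyE₂ {L : Type} [Field L] [Algebra ℂ L] (a : L) : aeval a p.polyE₂ =
    a * (a ^ 3 + algebraMap ℂ L (9 * p.r ^ 2 - 3) * a ^ 2 + algebraMap ℂ L (3 + 6 * p.r ^ 2) * a +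
      algebraMap ℂ L (p.r ^ 2 - 1)) := by
  have h : p.polyE₂ = X * p.polyE₁ := by rw [polyE₁, polyE₂]; ring
  rw [h, map_mul, aeval_X, aeval_polyE₁]

/-- The equation of `E₁`. -/
noncomputable def model₁ : CubicModel p.FE₁ where
  a₂ := 9 * p.r ^ 2 - 3
  a₄ := 3 + 6 * p.r ^ 2
  a₆ := p.r ^ 2 - 1
  X := x p.polyE₁
  Y := y p.polyE₁
  τ := involution p.polyE₁
  eqn := by rw [y_sq, aeval_polyE₁]
  τ_X := involution_x _
  τ_Y := involution_y _
  transcendental := x_transcendental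
  generate := eq_top_of_mem
  smooth e he := by
    have h := CubicModel.smooth_flexForm (e := e) p.r_ne_zero one_ne_zero
      (fun h => p.n_ne_zero (by rw [n, ← h, sub_self])) (by linear_combination he)
    intro h0
    exact h (by linear_combination h0)

theorem model₁_hasFlexForm : p.model₁.HasFlexForm p.r 1 where
  a₂_eq := by rw [model₁]; ring
  a₄_eq := by rw [model₁]; ring
  a₆_eq := by rw [model₁]; ring

theorem xE₂_ne_zero : x p.polyE₂ ≠ 0 := fun h =>
  x_transcendental (f := p.polyE₂) (by rw [h]; exact isAlgebraic_zero)

theorem transcendental_const_div {L : Type} [Field L] [Algebra ℂ L] {a : L} {b : ℂ} (hb : b ≠ 0)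
    (ha : Transcendental ℂ a) : Transcendental ℂ (algebraMap ℂ L b / a) := by
  intro h
  apply ha
  have hb' : algebraMap ℂ L b ≠ 0 := (_root_.map_ne_zero _).2 hb
  have : a = (algebraMap ℂ L b / a)⁻¹ * algebraMap ℂ L b := by
    rw [inv_div, div_mul_cancel₀ _ hb']
  rw [this]
  exact h.inv.mul (isAlgebraic_algebraMap b)

/-- A Weierstrass equation of `E₂`, with `(0, 0)` moved to infinity. -/
noncomputable def model₂ : CubicModel p.FE₂ where
  a₂ := 9 * p.r ^ 2 - 3 * p.n
  a₄ := 3 * p.n ^ 2 + 6 * p.r ^ 2 * p.n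
  a₆ := p.r ^ 2 * p.n ^ 2 - p.n ^ 3
  X := algebraMap ℂ p.FE₂ p.n / x p.polyE₂
  Y := algebraMap ℂ p.FE₂ p.n * y p.polyE₂ / x p.polyE₂ ^ 2
  τ := involution p.polyE₂
  eqn := by
    have h := p.xE₂_ne_zero
    rw [div_pow, mul_pow, y_sq, aeval_polyE₂]
    have hn : p.r ^ 2 = p.n + 1 := by rw [n]; ring
    rw [hn]
    simp only [map_add, map_sub, map_mul, map_pow, map_ofNat, map_one]
    field_simp
    ring
  τ_X := by rw [map_div₀, AlgHom.commutes, involution_x]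
  τ_Y := by
    rw [map_div₀, map_mul, AlgHom.commutes, map_pow, involution_x, involution_y]; ring
  transcendental := transcendental_const_div p.n_ne_zero x_transcendental
  generate E hX hY := by
    have hn : algebraMap ℂ p.FE₂ p.n ≠ 0 := (_root_.map_ne_zero _).2 p.n_ne_zero
    have hx : x p.polyE₂ ∈ E := by
      have h := E.div_mem (E.algebraMap_mem p.n) hX
      rwa [div_div_cancel₀ hn] at h
    apply eq_top_of_mem _ hx
    have h := E.div_mem (E.mul_mem hY (pow_mem hx 2)) (E.algebraMap_mem p.n)
    rwa [div_mul_cancel₀ _ (pow_ne_zero 2 p.xE₂_ne_zero), mul_div_cancel_left₀ _ hn] at h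
  smooth e he := by
    have h := CubicModel.smooth_flexForm (e := e) p.r_ne_zero p.n_ne_zero
      (fun h => one_ne_zero (α := ℂ) (by rw [n] at h; linear_combination -h))
      (by linear_combination he)
    intro h0
    exact h (by linear_combination h0)

theorem model₂_hasFlexForm : p.model₂.HasFlexForm p.r p.n := ⟨rfl, rfl, rfl⟩

/-! Coordinates on `C` adapted to `φ₁` and `φ₂`. -/

/-- The function `(x - t²) / (x + t²)` on `C`. -/
noncomputable def zC : p.FC := (p.xC - p.c (p.t ^ 2)) / (p.xC + p.c (p.t ^ 2))

theorem φ₁_X : p.φ₁ p.model₁.X = p.zC ^ 2 := by rw [zC, div_pow]; exact p.φ₁_x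

theorem φ₁_Y : p.φ₁ p.model₁.Y = p.φy₁ := p.φ₁_y

theorem φ₂_x' : p.φ₂ (x p.polyE₂) = p.zC ^ 2 := by rw [zC, div_pow]; exact p.φ₂_x

theorem φ₂_y' : p.φ₂ (y p.polyE₂) = p.zC * p.φy₁ := by
  rw [φ₂_y, zC, φy₁, div_mul_div_comm]
  congr 1 <;> ring

theorem zC_transcendental : Transcendental ℂ p.zC := by
  intro h
  apply p.φx_transcendental
  rw [φx, ← div_pow]
  exact h.pow 2

theorem zC_ne_const (a : ℂ) : p.zC ≠ p.c a := fun h =>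
  p.zC_transcendental (by rw [h]; exact isAlgebraic_algebraMap a)

theorem zC_ne_zero : p.zC ≠ 0 := by
  rw [← map_zero (algebraMap ℂ p.FC)]; exact p.zC_ne_const 0

theorem φ₂_X : p.φ₂ p.model₂.X = p.c p.n / p.zC ^ 2 := by
  rw [model₂, map_div₀, φ₂_x', AlgHom.commutes]

theorem φ₂_Y : p.φ₂ p.model₂.Y = p.c p.n * p.φy₁ / p.zC ^ 3 := by
  have h := p.zC_ne_zero
  rw [model₂, map_div₀, map_mul, map_pow, φ₂_x', φ₂_y', AlgHom.commutes]
  field_simp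

theorem φy₁_sq : p.φy₁ ^ 2 = (p.zC ^ 2 - 1) ^ 3 + p.c (p.r ^ 2) * (3 * p.zC ^ 2 + 1) ^ 2 := by
  have h := p.φ₁_equation
  rw [aeval_polyE₁, φx, ← div_pow, ← zC] at h
  rw [h]
  simp only [c, map_add, map_sub, map_mul, map_pow, map_ofNat, map_one]
  ring

theorem eq_top_of_zC_mem (E : IntermediateField ℂ p.FC) (hz : p.zC ∈ E) (hY : p.φy₁ ∈ E) :
    E = ⊤ := by
  have h1 := p.xC_add_ne_zero
  have h2 : 1 - p.zC ≠ 0 := by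
    rw [← map_one (algebraMap ℂ p.FC)]; exact sub_ne_zero.2 (p.zC_ne_const 1).symm
  have hx : p.xC = p.c (p.t ^ 2) * (1 + p.zC) / (1 - p.zC) := by
    rw [eq_div_iff h2, zC]
    field_simp
    ring
  have hxE : p.xC ∈ E := by
    rw [hx]
    exact E.div_mem (E.mul_mem (E.algebraMap_mem _) (E.add_mem E.one_mem hz))
      (E.sub_mem E.one_mem hz)
  apply eq_top_of_mem _ hxE
  have h3 : p.c (8 * p.t ^ 3) ≠ 0 :=
    (_root_.map_ne_zero _).2 (mul_ne_zero (by norm_num) (pow_ne_zero 3 p.t_ne_zero))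
  have h4 : p.c (p.t ^ 6 + 1) ≠ 0 :=
    (_root_.map_ne_zero _).2 (by rw [add_comm]; exact p.one_add_t_pow_ne_zero)
  have hy : p.yC =
      p.φy₁ * (p.c (p.t ^ 6 + 1) * (p.xC + p.c (p.t ^ 2)) ^ 3) / p.c (8 * p.t ^ 3) := by
    rw [φy₁]
    field_simp
  change p.yC ∈ E
  rw [hy]
  exact E.div_mem (E.mul_mem hY (E.mul_mem (E.algebraMap_mem _)
    (pow_mem (E.add_mem hxE (E.algebraMap_mem _)) 3))) (E.algebraMap_mem _)

/-- The function field of `C` is generated by `z` and `Y`, and both `z²` and `Y` come from `E₁`. -/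
theorem degree_φ₁ : degree p.φ₁ ≤ 2 := by
  refine degree_le_two p.φ₁ (w := p.zC) (a := p.model₁.X) p.φ₁_X.symm fun E hE hz => ?_
  apply p.eq_top_of_zC_mem E hz
  rw [← φ₁_Y]
  exact hE _

theorem degree_φ₂ : degree p.φ₂ ≤ 2 := by
  refine degree_le_two p.φ₂ (w := p.zC) (a := x p.polyE₂) p.φ₂_x'.symm fun E hE hz => ?_
  apply p.eq_top_of_zC_mem E hz
  have h := E.div_mem (hE (y p.polyE₂)) hz
  rwa [φ₂_y', mul_div_cancel_left₀ _ p.zC_ne_zero] at h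

/-! Automorphisms of `C`. -/

/-- The hyperelliptic involution of `C`. -/
noncomputable abbrev τ : p.FC →ₐ[ℂ] p.FC := involution p.polyC

theorem τ_zC : p.τ p.zC = p.zC := by
  simp only [zC, map_div₀, map_add, map_sub, AlgHom.commutes, involution_x]

theorem τ_φy₁ : p.τ p.φy₁ = -p.φy₁ := by
  simp only [φy₁, map_div₀, map_mul, map_add, map_pow, AlgHom.commutes, involution_x, involution_y]
  ring

theorem xC_ne_zero : p.xC ≠ 0 := by
  rw [← map_zero (algebraMap ℂ p.FC)]; exact p.not_const 0

/-- The involution `(x, y) ↦ (t⁴ / x, t⁶ y / x³)` of `C`. -/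
noncomputable def ι : p.FC →ₐ[ℂ] p.FC :=
  lift (p.c (p.t ^ 4) / p.xC) (p.c (p.t ^ 6) * p.yC / p.xC ^ 3)
    (transcendental_const_div (pow_ne_zero 4 p.t_ne_zero) x_transcendental) (by
      have h := p.xC_ne_zero
      rw [div_pow, mul_pow, yC_sq]
      simp only [polyC, map_mul, map_sub, map_pow, aeval_X, aeval_C, map_one]
      field_simp
      ring)

/-- In the coordinates `(z, Y)` the involution is `(-z, Y)`. Hence `φ₁`, given by `z²` and `Y`, is
invariant under `ι`, and `φ₂`, given by `z²` and `zY`, under `τι`. -/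
theorem ι_zC : p.ι p.zC = -p.zC := by
  have h := p.xC_ne_zero
  have h1 := p.xC_add_ne_zero
  have h2 : p.c p.t ≠ 0 := (_root_.map_ne_zero _).2 p.t_ne_zero
  have hx : p.ι p.xC = p.c p.t ^ 4 / p.xC := by rw [← map_pow]; exact lift_x ..
  simp only [c, map_pow] at h1
  have h3 : algebraMap ℂ p.FC p.t ^ 2 + p.xC ≠ 0 := by rwa [add_comm]
  simp only [zC, map_div₀, map_add, map_sub, AlgHom.commutes, hx]
  simp only [c, map_pow]
  have h4 : algebraMap ℂ p.FC p.t ^ 4 / p.xC + algebraMap ℂ p.FC p.t ^ 2 =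
      algebraMap ℂ p.FC p.t ^ 2 * (p.xC + algebraMap ℂ p.FC p.t ^ 2) / p.xC := by
    field_simp; ring
  rw [h4]
  field_simp
  ring

theorem ι_φy₁ : p.ι p.φy₁ = p.φy₁ := by
  have h := p.xC_ne_zero
  have h1 := p.xC_add_ne_zero
  have h2 : p.c p.t ≠ 0 := (_root_.map_ne_zero _).2 p.t_ne_zero
  have hx : p.ι p.xC = p.c p.t ^ 4 / p.xC := by rw [← map_pow]; exact lift_x ..
  have hy : p.ι p.yC = p.c p.t ^ 6 * p.yC / p.xC ^ 3 := by rw [← map_pow]; exact lift_y ..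
  have h4 : p.c (p.t ^ 6 + 1) ≠ 0 :=
    (_root_.map_ne_zero _).2 (by rw [add_comm]; exact p.one_add_t_pow_ne_zero)
  have h5 : p.c p.t ^ 4 / p.xC + p.c (p.t ^ 2) =
      p.c p.t ^ 2 * (p.xC + p.c (p.t ^ 2)) / p.xC := by
    simp only [c, map_pow]; field_simp; ring
  simp only [φy₁, map_div₀, map_mul, map_add, map_pow, AlgHom.commutes, hx, hy] at *
  rw [h5]
  field_simp

theorem zetaC_add_ne_zero : p.c p.ζ * p.xC + p.c (p.t ^ 2) ≠ 0 := fun h =>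
  p.σ_transcendental (by
    rw [eq_neg_of_add_eq_zero_left h, ← map_neg]; exact isAlgebraic_algebraMap _)

theorem one_add_s_mul_zC : 1 + p.c p.s * p.zC =
    2 * (p.c p.ζ * p.xC + p.c (p.t ^ 2)) / (p.c (p.ζ + 1) * (p.xC + p.c (p.t ^ 2))) := by
  have h1 := p.xC_add_ne_zero
  have h2 : p.c (p.ζ + 1) ≠ 0 := (_root_.map_ne_zero _).2 p.zeta_add_one_ne_zero
  rw [s, zC, c, map_div₀]
  field_simp
  simp only [map_add, map_sub, map_one]
  ring

/-- Multiplication of `x` by `ζ` fixes `0` and `∞`; in terms of `z` it is a Möbius map fixing `-1`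
and `1`. -/
theorem σ_zC : p.σ p.zC = (p.zC + p.c p.s) / (1 + p.c p.s * p.zC) := by
  have h1 := p.xC_add_ne_zero
  have h2 : p.c (p.ζ + 1) ≠ 0 := (_root_.map_ne_zero _).2 p.zeta_add_one_ne_zero
  have h3 := p.zetaC_add_ne_zero
  have : CharZero p.FC := charZero_of_injective_algebraMap (algebraMap ℂ p.FC).injective
  have h4 : p.zC + p.c p.s = 2 * (p.c p.ζ * p.xC - p.c (p.t ^ 2)) /
      (p.c (p.ζ + 1) * (p.xC + p.c (p.t ^ 2))) := by
    have h5 : p.c p.s = p.c (p.ζ - 1) / p.c (p.ζ + 1) := by rw [s]; exact map_div₀ _ _ _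
    rw [h5, zC]
    field_simp
    simp only [c, map_add, map_sub, map_one]
    ring
  rw [one_add_s_mul_zC, h4, zC, map_div₀, map_add, map_sub, σ_x, AlgHom.commutes]
  field_simp

theorem σ_φy₁ : p.σ p.φy₁ = p.c (-8) * p.φy₁ / (1 + p.c p.s * p.zC) ^ 3 := by
  have h1 := p.xC_add_ne_zero
  have h2 : p.c (p.ζ + 1) ≠ 0 := (_root_.map_ne_zero _).2 p.zeta_add_one_ne_zero
  have h3 := p.zetaC_add_ne_zero
  have h4 : p.c (p.t ^ 6 + 1) ≠ 0 :=
    (_root_.map_ne_zero _).2 (by rw [add_comm]; exact p.one_add_t_pow_ne_zero)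
  have : CharZero p.FC := charZero_of_injective_algebraMap (algebraMap ℂ p.FC).injective
  -- Since `ζ + 1 = -ζ²`. With the factor `2³` from `one_add_s_mul_zC`, this produces the constant
  -- `-8`.
  have h5 : p.c (p.ζ + 1) ^ 3 = -1 := by
    rw [c, ← map_pow, ← map_one (algebraMap ℂ p.FC), ← map_neg]
    congr 1
    linear_combination (p.ζ + 2) * p.zeta_rel
  rw [one_add_s_mul_zC, div_pow, mul_pow, mul_pow, h5]
  simp only [φy₁, map_div₀, map_mul, map_add, map_pow, AlgHom.commutes, σ_x, σ_y, map_neg,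
    map_ofNat, map_one] at *
  field_simp
  ring

end Param

/-! The chord computations. -/

section Chord

open CubicModel

variable {r s z Y : ℂ}

/-- Rationalize the denominator: `(z + s)(z - s) = z² + 3`. -/
theorem sigma_inv (hs : s ^ 2 = -3) (h : z + s ≠ 0) (h3 : z ^ 2 + 3 ≠ 0) :
    (1 + s * z) / (z + s) = (4 * z + s * (z ^ 2 - 1)) / (z ^ 2 + 3) := by
  rw [div_eq_div_iff h h3]
  linear_combination (1 - z ^ 2) * hs

theorem sigma_eq (hs : s ^ 2 = -3) (h : 1 + s * z ≠ 0) (h4 : 3 * z ^ 2 + 1 ≠ 0) :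
    (z + s) / (1 + s * z) = (4 * z - s * (z ^ 2 - 1)) / (3 * z ^ 2 + 1) := by
  rw [div_eq_div_iff h h4]
  linear_combination (z ^ 3 - z) * hs

theorem isogYVal_eq {m a b : ℂ} (hs : s ^ 2 = -3) (hs0 : s ≠ 0) : isogYVal r m s a b =
    s * (b * ((a - m) ^ 3 - 48 * r ^ 2 * m * (a - m) - 128 * r ^ 2 * m ^ 2) /
      (9 * (a - m) ^ 3)) := by
  have h : s ^ 3 = 9 / s := by
    rw [eq_div_iff hs0]; linear_combination (s ^ 2 - 3) * hs
  rw [isogYVal, h]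
  field_simp

/-- The points `(x₁, y₁)` and `(x₂, y₂)` are `φ₂σQ` and `φ₂σιQ`, interchanged by `z ↦ -z`, and `l`
is the slope of their chord. Its third point is the negative of the image of `φ₁Q` under the
3-isogeny. -/
theorem chord₁₂ (hs : s ^ 2 = -3) (hs0 : s ≠ 0)
    (hY : Y ^ 2 = (z ^ 2 - 1) ^ 3 + r ^ 2 * (3 * z ^ 2 + 1) ^ 2) (h0 : z ≠ 0)
    (h1 : z ^ 2 - 1 ≠ 0) (h3 : z ^ 2 + 3 ≠ 0) (hn : r ^ 2 - 1 ≠ 0) {x₁ x₂ y₁ y₂ l : ℂ}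
    (hx₁ : x₁ = (r ^ 2 - 1) * ((16 * z ^ 2 - 3 * (z ^ 2 - 1) ^ 2 + 8 * s * z * (z ^ 2 - 1)) /
      (z ^ 2 + 3) ^ 2))
    (hx₂ : x₂ = (r ^ 2 - 1) * ((16 * z ^ 2 - 3 * (z ^ 2 - 1) ^ 2 - 8 * s * z * (z ^ 2 - 1)) /
      (z ^ 2 + 3) ^ 2))
    (hy₁ : y₁ = -8 * (r ^ 2 - 1) * Y * ((z ^ 3 - 9 * z - 3 * s * (z ^ 2 - 1)) / (z ^ 2 + 3) ^ 3))
    (hy₂ : y₂ = 8 * (r ^ 2 - 1) * Y * ((z ^ 3 - 9 * z + 3 * s * (z ^ 2 - 1)) / (z ^ 2 + 3) ^ 3))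
    (hl : l = s * Y * (z ^ 2 - 9) / (3 * (z ^ 2 - 1) * (z ^ 2 + 3))) :
    x₁ ≠ x₂ ∧ l * (x₁ - x₂) = y₁ - y₂ ∧
      isogXVal r 1 (z ^ 2) = l ^ 2 - (9 * r ^ 2 - 3 * (r ^ 2 - 1)) - x₁ - x₂ ∧
      -isogYVal r 1 s (z ^ 2) Y = y₁ + l * (isogXVal r 1 (z ^ 2) - x₁) := by
  refine ⟨?_, ?_, ?_, ?_⟩
  · have : x₁ - x₂ = 16 * (r ^ 2 - 1) * s * z * (z ^ 2 - 1) / (z ^ 2 + 3) ^ 2 := by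
      rw [hx₁, hx₂]; ring
    rw [← sub_ne_zero, this]
    exact div_ne_zero (mul_ne_zero (mul_ne_zero (mul_ne_zero (mul_ne_zero (by norm_num) hn) hs0) h0)
      h1) (pow_ne_zero 2 h3)
  · rw [← sub_eq_zero]
    -- The identity holds only modulo `s² = -3`, so the multiple of `s² + 3` is made explicit.
    have : l * (x₁ - x₂) - (y₁ - y₂) =
        (s ^ 2 + 3) * (16 * (r ^ 2 - 1) * Y * z * (z ^ 2 - 9) / (3 * (z ^ 2 + 3) ^ 3)) := by
      rw [hx₁, hx₂, hy₁, hy₂, hl]; field_simp; ring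
    rw [this, hs]; ring
  · have hl2 : l ^ 2 = -((z ^ 2 - 1) ^ 3 + r ^ 2 * (3 * z ^ 2 + 1) ^ 2) * (z ^ 2 - 9) ^ 2 /
        (3 * (z ^ 2 - 1) ^ 2 * (z ^ 2 + 3) ^ 2) := by
      rw [hl, div_pow, mul_pow, mul_pow, hs, hY]; field_simp
    rw [hl2, hx₁, hx₂, isogXVal]
    field_simp
    ring
  · rw [isogYVal_eq hs hs0, ← sub_eq_zero]
    have : -(s * (Y * ((z ^ 2 - 1) ^ 3 - 48 * r ^ 2 * 1 * (z ^ 2 - 1) - 128 * r ^ 2 * 1 ^ 2) /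
        (9 * (z ^ 2 - 1) ^ 3))) - (y₁ + l * (isogXVal r 1 (z ^ 2) - x₁)) =
        (s ^ 2 + 3) * (8 * (r ^ 2 - 1) * Y * z * (z ^ 2 - 9) / (3 * (z ^ 2 + 3) ^ 3)) := by
      rw [hx₁, hy₁, hl, isogXVal]; field_simp; ring
    rw [this, hs]; ring

/-- The analogue for `φ₁σQ` and `φ₁στιQ`, which are interchanged by `(z, Y) ↦ (-z, -Y)`. The
denominator `3z² + 1` is carried as a single symbol `d` and expanded only at the end. -/
theorem chord₂₁ (hs : s ^ 2 = -3) (hs0 : s ≠ 0)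
    (hY : Y ^ 2 = (z ^ 2 - 1) ^ 3 + r ^ 2 * (3 * z ^ 2 + 1) ^ 2) (h0 : z ≠ 0)
    (h1 : z ^ 2 - 1 ≠ 0) {d : ℂ} (hd : d = 3 * z ^ 2 + 1) (h4 : d ≠ 0) (hn : r ^ 2 - 1 ≠ 0)
    {x₁ x₂ y₁ y₂ l : ℂ}
    (hx₁ : x₁ = (16 * z ^ 2 - 3 * (z ^ 2 - 1) ^ 2 - 8 * s * z * (z ^ 2 - 1)) / d ^ 2)
    (hx₂ : x₂ = (16 * z ^ 2 - 3 * (z ^ 2 - 1) ^ 2 + 8 * s * z * (z ^ 2 - 1)) / d ^ 2)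
    (hy₁ : y₁ = -8 * Y * ((1 - 9 * z ^ 2 + 3 * s * z * (z ^ 2 - 1)) / d ^ 3))
    (hy₂ : y₂ = 8 * Y * ((1 - 9 * z ^ 2 - 3 * s * z * (z ^ 2 - 1)) / d ^ 3))
    (hl : l = -(s * Y * (1 - 9 * z ^ 2)) / (3 * z * (z ^ 2 - 1) * d)) :
    x₁ ≠ x₂ ∧ l * (x₁ - x₂) = y₁ - y₂ ∧
      isogXVal r (r ^ 2 - 1) ((r ^ 2 - 1) / z ^ 2) = l ^ 2 - (9 * r ^ 2 - 3) - x₁ - x₂ ∧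
      -isogYVal r (r ^ 2 - 1) s ((r ^ 2 - 1) / z ^ 2) ((r ^ 2 - 1) * Y / z ^ 3) =
        y₁ + l * (isogXVal r (r ^ 2 - 1) ((r ^ 2 - 1) / z ^ 2) - x₁) := by
  have hw : (r ^ 2 - 1) / z ^ 2 - (r ^ 2 - 1) = -(r ^ 2 - 1) * (z ^ 2 - 1) / z ^ 2 := by
    field_simp; ring
  refine ⟨?_, ?_, ?_, ?_⟩
  · have : x₁ - x₂ = -16 * s * z * (z ^ 2 - 1) / d ^ 2 := by
      rw [hx₁, hx₂]; ring
    rw [← sub_ne_zero, this]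
    exact div_ne_zero (mul_ne_zero (mul_ne_zero (mul_ne_zero (by norm_num) hs0) h0) h1)
      (pow_ne_zero 2 h4)
  · rw [← sub_eq_zero]
    have : l * (x₁ - x₂) - (y₁ - y₂) =
        (s ^ 2 + 3) * (16 * Y * (1 - 9 * z ^ 2) / (3 * d ^ 3)) := by
      rw [hx₁, hx₂, hy₁, hy₂, hl]; field_simp; ring
    rw [this, hs]; ring
  · have hl2 : l ^ 2 = -((z ^ 2 - 1) ^ 3 + r ^ 2 * (3 * z ^ 2 + 1) ^ 2) * (1 - 9 * z ^ 2) ^ 2 /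
        (3 * z ^ 2 * (z ^ 2 - 1) ^ 2 * d ^ 2) := by
      rw [hl, div_pow, neg_sq, mul_pow, mul_pow, hs, hY]; field_simp
    rw [hl2, hx₁, hx₂, isogXVal, hw]
    field_simp
    rw [hd]
    ring
  · rw [isogYVal_eq hs hs0, hw, ← sub_eq_zero]
    have : -(s * ((r ^ 2 - 1) * Y / z ^ 3 * ((-(r ^ 2 - 1) * (z ^ 2 - 1) / z ^ 2) ^ 3 -
        48 * r ^ 2 * (r ^ 2 - 1) * (-(r ^ 2 - 1) * (z ^ 2 - 1) / z ^ 2) -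
        128 * r ^ 2 * (r ^ 2 - 1) ^ 2) / (9 * (-(r ^ 2 - 1) * (z ^ 2 - 1) / z ^ 2) ^ 3))) -
        (y₁ + l * (isogXVal r (r ^ 2 - 1) ((r ^ 2 - 1) / z ^ 2) - x₁)) =
        (s ^ 2 + 3) * (8 * Y * (1 - 9 * z ^ 2) / (3 * d ^ 3)) := by
      rw [hx₁, hy₁, hl, isogXVal, hw]; field_simp; rw [hd]; ring
    rw [this, hs]; ring


/-- Brings the coordinates of `φ₂σQ` into the rationalized form used for the chord. -/
theorem coord₁₂ (hs : s ^ 2 = -3) (h : 1 + s * z ≠ 0) (h' : z + s ≠ 0) (h3 : z ^ 2 + 3 ≠ 0)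
    (n : ℂ) : n / ((z + s) / (1 + s * z)) ^ 2 = n * ((16 * z ^ 2 - 3 * (z ^ 2 - 1) ^ 2 +
        8 * s * z * (z ^ 2 - 1)) / (z ^ 2 + 3) ^ 2) ∧
      n * (-8 * Y / (1 + s * z) ^ 3) / ((z + s) / (1 + s * z)) ^ 3 =
        -8 * n * Y * ((z ^ 3 - 9 * z - 3 * s * (z ^ 2 - 1)) / (z ^ 2 + 3) ^ 3) := by
  constructor
  · rw [div_eq_mul_inv, ← inv_pow, inv_div, sigma_inv hs h' h3, div_pow]
    congr 2
    linear_combination (z ^ 2 - 1) ^ 2 * hs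
  · have h1 : 1 / (z + s) = (z - s) / (z ^ 2 + 3) := by
      rw [div_eq_div_iff h' h3]; linear_combination hs
    have h2 : (z - s) ^ 3 = z ^ 3 - 9 * z - 3 * s * (z ^ 2 - 1) := by
      linear_combination (3 * z - s) * hs
    rw [← h2, ← div_pow, ← h1]
    field_simp

theorem coord₂₁ (hs : s ^ 2 = -3) (h : 1 + s * z ≠ 0) (h4 : 3 * z ^ 2 + 1 ≠ 0) :
    ((z + s) / (1 + s * z)) ^ 2 = (16 * z ^ 2 - 3 * (z ^ 2 - 1) ^ 2 -
        8 * s * z * (z ^ 2 - 1)) / (3 * z ^ 2 + 1) ^ 2 ∧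
      -8 * Y / (1 + s * z) ^ 3 =
        -8 * Y * ((1 - 9 * z ^ 2 + 3 * s * z * (z ^ 2 - 1)) / (3 * z ^ 2 + 1) ^ 3) := by
  constructor
  · rw [sigma_eq hs h h4, div_pow]
    congr 1
    linear_combination (z ^ 2 - 1) ^ 2 * hs
  · have h1 : 1 / (1 + s * z) = (1 - s * z) / (3 * z ^ 2 + 1) := by
      rw [div_eq_div_iff h h4]; linear_combination z ^ 2 * hs
    have h2 : (1 - s * z) ^ 3 = 1 - 9 * z ^ 2 + 3 * s * z * (z ^ 2 - 1) := by
      linear_combination (3 * z ^ 2 - s * z ^ 3) * hs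
    rw [← h2, ← div_pow, ← h1]
    field_simp

end Chord

/-! ### Points of `C` in the coordinates `(z, Y)`. -/

namespace Param

open DoubleCover CubicModel

variable (p : Param) {Q : Place p.FC} {z Y : ℂ}

/-- The functions `(x - t²) / (x + t²)` and `φ₁^* y` have values `z` and `Y` at `Q`. -/
def IsPointC (Q : Place p.FC) (z Y : ℂ) : Prop := Q.HasValue p.zC z ∧ Q.HasValue p.φy₁ Y

variable {p}

theorem IsPointC.eqn (h : p.IsPointC Q z Y) :
    Y ^ 2 = (z ^ 2 - 1) ^ 3 + p.r ^ 2 * (3 * z ^ 2 + 1) ^ 2 := by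
  have c := Place.HasValue.const Q
  have h1 := (((h.1.pow 2).sub (c 1)).pow 3).add ((c (p.r ^ 2)).mul
    ((((c 3).mul (h.1.pow 2)).add (c 1)).pow 2))
  rw [map_one, map_ofNat, ← φy₁_sq] at h1
  exact (h.2.pow 2).unique h1

theorem exists_isPointC (h : Q.HasValue p.zC z) : ∃ Y, p.IsPointC Q z Y := by
  have c := Place.HasValue.const Q
  have h1 := (((h.pow 2).sub (c 1)).pow 3).add ((c (p.r ^ 2)).mul
    ((((c 3).mul (h.pow 2)).add (c 1)).pow 2))
  rw [map_one, map_ofNat, ← φy₁_sq] at h1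
  obtain ⟨Y, hY⟩ := Q.exists_value (Q.mem_of_pow_mem two_ne_zero h1.mem)
  exact ⟨Y, h, hY⟩

theorem IsPointC.map_φ₁ (h : p.IsPointC Q z Y) : p.model₁.IsPoint (Q.map p.φ₁) (z ^ 2) Y := by
  rw [IsPoint, Place.map_hasValue_iff, Place.map_hasValue_iff, φ₁_X, φ₁_Y]
  exact ⟨h.1.pow 2, h.2⟩

theorem IsPointC.map_φ₂ (h : p.IsPointC Q z Y) (hz : z ≠ 0) :
    p.model₂.IsPoint (Q.map p.φ₂) (p.n / z ^ 2) (p.n * Y / z ^ 3) := by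
  rw [IsPoint, Place.map_hasValue_iff, Place.map_hasValue_iff, φ₂_X, φ₂_Y]
  have c := Place.HasValue.const Q
  exact ⟨(c _).div (h.1.pow 2) (pow_ne_zero 2 hz), ((c _).mul h.2).div (h.1.pow 3)
    (pow_ne_zero 3 hz)⟩

theorem IsPointC.map_τ (h : p.IsPointC Q z Y) : p.IsPointC (Q.map p.τ) z (-Y) := by
  rw [IsPointC, Place.map_hasValue_iff, Place.map_hasValue_iff, τ_zC, τ_φy₁]
  exact ⟨h.1, h.2.neg⟩

theorem IsPointC.map_ι (h : p.IsPointC Q z Y) : p.IsPointC (Q.map p.ι) (-z) Y := by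
  rw [IsPointC, Place.map_hasValue_iff, Place.map_hasValue_iff, ι_zC, ι_φy₁]
  exact ⟨h.1.neg, h.2⟩

theorem IsPointC.map_σ (h : p.IsPointC Q z Y) (hz : 1 + p.s * z ≠ 0) :
    p.IsPointC (Q.map p.σ) ((z + p.s) / (1 + p.s * z)) (-8 * Y / (1 + p.s * z) ^ 3) := by
  rw [IsPointC, Place.map_hasValue_iff, Place.map_hasValue_iff, σ_zC, σ_φy₁]
  have c := Place.HasValue.const Q
  have h1 := (c 1).add ((c p.s).mul h.1)
  rw [map_one] at h1
  exact ⟨(h.1.add (c _)).div h1 hz, ((c _).mul h.2).div (h1.pow 3) (pow_ne_zero 3 hz)⟩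

theorem IsPointC.ne_of_ne {R : Place p.FC} {z' Y' : ℂ} (h : p.IsPointC Q z Y)
    (h' : p.IsPointC R z' Y') (hne : z ≠ z' ∨ Y ≠ Y') : Q ≠ R := by
  rintro rfl
  rcases hne with hne | hne
  · exact hne (h.1.unique h'.1)
  · exact hne (h.2.unique h'.2)

variable (p)

/-- Lift `P` to `C` by surjectivity; `z` is regular at the lift because `z²` is. -/
theorem exists_isPointC_of_φ₁ {P : Place p.FE₁} {a b : ℂ} (hP : p.model₁.IsPoint P a b) :
    ∃ Q z, p.IsPointC Q z b ∧ z ^ 2 = a := by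
  obtain ⟨Q, rfl⟩ := exists_map_eq p.φ₁ P
  rw [IsPoint, Place.map_hasValue_iff, Place.map_hasValue_iff, φ₁_X, φ₁_Y] at hP
  obtain ⟨z, hz⟩ := Q.exists_value (Q.mem_of_pow_mem two_ne_zero hP.1.mem)
  exact ⟨Q, z, ⟨hz, hP.2⟩, (hz.pow 2).unique hP.1⟩

theorem exists_isPointC_of_φ₂ {P : Place p.FE₂} {a b : ℂ} (hP : p.model₂.IsPoint P a b)
    (ha : a ≠ 0) : ∃ Q z Y, p.IsPointC Q z Y ∧ z ≠ 0 ∧ a = p.n / z ^ 2 ∧ b = p.n * Y / z ^ 3 := by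
  obtain ⟨Q, rfl⟩ := exists_map_eq p.φ₂ P
  have h1 := hP.1
  rw [Place.map_hasValue_iff, φ₂_X] at h1
  have h2 := (Place.HasValue.const Q p.n).div h1 ha
  have hn : p.c p.n ≠ 0 := (_root_.map_ne_zero _).2 p.n_ne_zero
  rw [div_div_cancel₀ hn] at h2
  obtain ⟨z, hz⟩ := Q.exists_value (Q.mem_of_pow_mem two_ne_zero h2.mem)
  obtain ⟨Y, hY⟩ := exists_isPointC hz
  have h3 : z ≠ 0 := by
    rintro rfl
    have := (hz.pow 2).unique h2
    rw [zero_pow two_ne_zero] at this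
    exact div_ne_zero p.n_ne_zero ha this.symm
  have h4 := hY.map_φ₂ h3
  exact ⟨Q, z, Y, hY, h3, hP.1.unique h4.1, hP.2.unique h4.2⟩

/-! The special fibres. -/

/-- The two points over the origin are the poles of `z`. They are exchanged by `τ`, so their images
on `E₂` are opposite and contribute no constant to `φ₁₂`. -/
theorem O_fibre_φ₁ : ∃ Q R : Place p.FC, Q.map p.φ₁ = p.model₁.O ∧ R.map p.φ₁ = p.model₁.O ∧
    Q ≠ R ∧ abelJacobi p.model₂.O ((Q.map p.σ).map p.φ₂) +
      abelJacobi p.model₂.O ((R.map p.σ).map p.φ₂) = 0 := by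
  obtain ⟨Q, hQ⟩ := exists_map_eq p.φ₁ p.model₁.O
  have hpole : ∀ {R : Place p.FC}, R.map p.φ₁ = p.model₁.O ↔ R.IsPole p.zC := by
    intro R
    rw [← isPole_iff, Place.map_isPole_iff, φ₁_X, Place.isPole_iff, Place.isPole_iff, not_iff_not]
    exact ⟨R.mem_of_pow_mem two_ne_zero, fun h => pow_mem h 2⟩
  have h1 := (hpole.1 hQ)
  have hR : (Q.map p.τ).IsPole p.zC := by rwa [Place.map_isPole_iff, τ_zC]
  have hz := p.zC_ne_zero
  -- The right-hand side of the equation of `C` is monic of degree six in `z`; hence `Y/z³ = ±1`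
  -- where `z = ∞`, and the sign tells the two points apart.
  have val : ∀ {R : Place p.FC}, R.IsPole p.zC → R.HasValue ((p.φy₁ / p.zC ^ 3) ^ 2) 1 := by
    intro R hR
    have c := Place.HasValue.const R
    have hv := hR.inv
    have h2 := (((c 1).sub (hv.pow 2)).pow 3).add ((c (p.r ^ 2)).mul ((hv.pow 2).mul
      (((c 3).add (hv.pow 2)).pow 2)))
    have h3 : (p.φy₁ / p.zC ^ 3) ^ 2 = (algebraMap ℂ p.FC 1 - p.zC⁻¹ ^ 2) ^ 3 +
        algebraMap ℂ p.FC (p.r ^ 2) * (p.zC⁻¹ ^ 2 * (algebraMap ℂ p.FC 3 + p.zC⁻¹ ^ 2) ^ 2) := by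
      rw [div_pow, φy₁_sq, map_one, map_ofNat]
      field_simp
    rw [h3]
    convert h2 using 1
    norm_num
  obtain ⟨e, he⟩ := Q.exists_value (Q.mem_of_pow_mem two_ne_zero (val h1).mem)
  have he2 : e ^ 2 = 1 := (he.pow 2).unique (val h1)
  have he0 : e ≠ 0 := by rintro rfl; norm_num at he2
  have he' : (Q.map p.τ).HasValue (p.φy₁ / p.zC ^ 3) (-e) := by
    rw [Place.map_hasValue_iff, map_div₀, map_pow, τ_zC, τ_φy₁, neg_div]
    exact he.neg
  have hs := p.s_ne_zero
  -- In the limit `z → ∞`, `σ` gives `z = 1/s` and `Y = -8d/s³`.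
  have key : ∀ {R : Place p.FC} {d : ℂ}, R.IsPole p.zC → R.HasValue (p.φy₁ / p.zC ^ 3) d →
      p.model₂.IsPoint ((R.map p.σ).map p.φ₂) (p.n / (1 / p.s) ^ 2)
        (p.n * (-8 * d / p.s ^ 3) / (1 / p.s) ^ 3) := by
    intro R d hR hd
    have c := Place.HasValue.const R
    have hv := hR.inv
    have h3 := hv.add (c p.s)
    rw [zero_add] at h3
    have h6 : p.zC⁻¹ + algebraMap ℂ p.FC p.s = (1 + p.c p.s * p.zC) / p.zC := by
      field_simp
    have h7 := h3.ne_zero hs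
    rw [h6] at h7
    have h8 : 1 + p.c p.s * p.zC ≠ 0 := fun h => h7 (by rw [h, zero_div])
    refine IsPointC.map_φ₂ ⟨?_, ?_⟩ (one_div_ne_zero hs)
    · rw [Place.map_hasValue_iff, σ_zC]
      have h4 := ((c 1).add ((c p.s).mul hv)).div h3 hs
      rw [mul_zero, add_zero, h6] at h4
      convert h4 using 1
      rw [map_one]
      field_simp
    · rw [Place.map_hasValue_iff, σ_φy₁]
      have h4 := ((c (-8)).mul hd).div (h3.pow 3) (pow_ne_zero 3 hs)
      rw [h6] at h4
      convert h4 using 1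
      field_simp
  refine ⟨Q, Q.map p.τ, hQ, hpole.2 hR, ?_, ?_⟩
  · intro h
    rw [← h] at he'
    have := he.unique he'
    exact he0 (by linear_combination this / 2)
  · have k1 := key h1 he
    have k2 := key hR he'
    have k3 := k1.map_τ
    have : ((Q.map p.τ).map p.σ).map p.φ₂ = ((Q.map p.σ).map p.φ₂).map p.model₂.τ := by
      apply k3.unique
      convert k2 using 1
      ring
    rw [this]
    exact k1.add_map_τ

/-- Here `z = 0` and `Y² = r² - 1 = n ≠ 0`, so again `τ` exchanges two distinct points whose images
are opposite. -/
theorem O_fibre_φ₂ : ∃ Q R : Place p.FC, Q.map p.φ₂ = p.model₂.O ∧ R.map p.φ₂ = p.model₂.O ∧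
    Q ≠ R ∧ abelJacobi p.model₁.O ((Q.map p.σ).map p.φ₁) +
      abelJacobi p.model₁.O ((R.map p.σ).map p.φ₁) = 0 := by
  obtain ⟨Q, hQ⟩ := exists_map_eq p.φ₂ p.model₂.O
  have h0 : Q.IsPole (p.φ₂ p.model₂.X) := by rw [← Place.map_isPole_iff, isPole_iff]; exact hQ
  have hR : (Q.map p.τ).map p.φ₂ = p.model₂.O := by
    rw [← isPole_iff, Place.map_isPole_iff, Place.map_isPole_iff, φ₂_X, map_div₀, map_pow, τ_zC,
      AlgHom.commutes]
    rwa [φ₂_X] at h0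
  have h1 := (Place.HasValue.const Q p.n).mul h0.inv
  have hn : p.c p.n ≠ 0 := (_root_.map_ne_zero _).2 p.n_ne_zero
  rw [φ₂_X, inv_div, mul_zero, mul_div_cancel₀ _ hn] at h1
  have hz : Q.HasValue p.zC 0 := h1.of_pow_zero
  obtain ⟨Y, hY⟩ := exists_isPointC hz
  have hY0 : Y ≠ 0 := by
    rintro rfl
    have := hY.eqn
    apply p.n_ne_zero
    rw [n]
    linear_combination -this
  refine ⟨Q, Q.map p.τ, hQ, hR, ?_, ?_⟩
  · exact hY.ne_of_ne hY.map_τ (Or.inr fun h => hY0 (by linear_combination h / 2))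
  · have k1 := (hY.map_σ (by rw [mul_zero, add_zero]; exact one_ne_zero)).map_φ₁
    have k2 := (hY.map_τ.map_σ (by rw [mul_zero, add_zero]; exact one_ne_zero)).map_φ₁
    have k3 := k1.map_τ
    have : ((Q.map p.τ).map p.σ).map p.φ₁ = ((Q.map p.σ).map p.φ₁).map p.model₁.τ := by
      apply k3.unique
      convert k2 using 1
      ring
    rw [this]
    exact k1.add_map_τ

/-! The isogenies. -/

/-- The isogeny `E₁ → E₂`. -/
noncomputable def ψ₁₂ : p.FE₂ →ₐ[ℂ] p.FE₁ :=
  -- In terms of `model₂`, the original coordinates of `E₂` are `x = n/X` and `y = nY/X²`.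
  lift (algebraMap ℂ p.FE₁ p.n / p.model₁.isogX p.r 1)
    (algebraMap ℂ p.FE₁ p.n * p.model₁.isogY p.r 1 p.s / p.model₁.isogX p.r 1 ^ 2)
    (transcendental_const_div p.n_ne_zero isogX_transcendental) (by
      have h : p.model₁.isogX p.r 1 ≠ 0 := isPole_isogX_O.ne_zero
      have h1 := isog_eqn p.model₁_hasFlexForm p.s_sq
      rw [div_pow, mul_pow, h1, aeval_polyE₂]
      have hn : p.r ^ 2 = p.n + 1 := by rw [n]; ring
      rw [hn]
      simp only [map_add, map_sub, map_mul, map_pow, map_ofNat, map_one]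
      field_simp
      ring)

theorem ψ₁₂_X : p.ψ₁₂ p.model₂.X = p.model₁.isogX p.r 1 := by
  have hn : algebraMap ℂ p.FE₁ p.n ≠ 0 := (_root_.map_ne_zero _).2 p.n_ne_zero
  rw [model₂, map_div₀, AlgHom.commutes, ψ₁₂, lift_x, div_div_cancel₀ hn]

theorem ψ₁₂_Y : p.ψ₁₂ p.model₂.Y = p.model₁.isogY p.r 1 p.s := by
  have hn : algebraMap ℂ p.FE₁ p.n ≠ 0 := (_root_.map_ne_zero _).2 p.n_ne_zero
  have h : p.model₁.isogX p.r 1 ≠ 0 := isPole_isogX_O.ne_zero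
  rw [model₂, map_div₀, map_mul, map_pow, AlgHom.commutes, ψ₁₂, lift_x, lift_y]
  field_simp

/-- The isogeny `E₂ → E₁`. -/
noncomputable def ψ₂₁ : p.FE₁ →ₐ[ℂ] p.FE₂ :=
  lift (p.model₂.isogX p.r p.n) (p.model₂.isogY p.r p.n p.s) isogX_transcendental (by
      have h1 := isog_eqn p.model₂_hasFlexForm p.s_sq
      have hn : p.r ^ 2 - p.n = 1 := by rw [n]; ring
      rw [hn] at h1
      rw [h1, aeval_polyE₁]
      simp only [map_add, map_sub, map_mul, map_pow, map_ofNat, map_one]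
      ring)

theorem ψ₂₁_X : p.ψ₂₁ p.model₁.X = p.model₂.isogX p.r p.n := lift_x ..

theorem ψ₂₁_Y : p.ψ₂₁ p.model₁.Y = p.model₂.isogY p.r p.n p.s := lift_y ..

theorem O_map_ψ₁₂ : p.model₁.O.map p.ψ₁₂ = p.model₂.O := by
  rw [← isPole_iff, Place.map_isPole_iff, ψ₁₂_X]; exact isPole_isogX_O

theorem O_map_ψ₂₁ : p.model₂.O.map p.ψ₂₁ = p.model₁.O := by
  rw [← isPole_iff, Place.map_isPole_iff, ψ₂₁_X]; exact isPole_isogX_O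

/-! The generic fibres. -/

theorem one_add_s_mul_ne_zero {z : ℂ} (hz : 3 * z ^ 2 + 1 ≠ 0) : 1 + p.s * z ≠ 0 := by
  intro h
  apply hz
  linear_combination (1 - p.s * z) * h + z ^ 2 * p.s_sq

theorem add_s_ne_zero {z : ℂ} (hz : z ^ 2 + 3 ≠ 0) : z + p.s ≠ 0 := by
  intro h
  apply hz
  linear_combination (z - p.s) * h + p.s_sq

/-- The sum of two points is the negative of the third point on their chord, which `chord₁₂`
computes. The conditions on `z` keep the points affine and the chord non-vertical. -/
theorem abelJacobi_fibre₁₂ {Q : Place p.FC} {z Y : ℂ} (h : p.IsPointC Q z Y) (h0 : z ≠ 0)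
    (h1 : z ^ 2 - 1 ≠ 0) (h3 : z ^ 2 + 3 ≠ 0) (h4 : 3 * z ^ 2 + 1 ≠ 0) :
    abelJacobi p.model₂.O ((Q.map p.σ).map p.φ₂) +
      abelJacobi p.model₂.O (((Q.map p.ι).map p.σ).map p.φ₂) =
    abelJacobi p.model₂.O ((Q.map p.φ₁).map p.ψ₁₂) := by
  have hs := p.s_sq
  have hs0 := p.s_ne_zero
  have hn := p.n_ne_zero
  have e1 := p.one_add_s_mul_ne_zero h4
  have e2 : 1 + p.s * -z ≠ 0 := p.one_add_s_mul_ne_zero (by rwa [neg_sq])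
  have e3 := p.add_s_ne_zero h3
  have e4 : -z + p.s ≠ 0 := p.add_s_ne_zero (by rwa [neg_sq])
  have k1 := (h.map_σ e1).map_φ₂ (div_ne_zero e3 e1)
  have k2 := (h.map_ι.map_σ e2).map_φ₂ (div_ne_zero e4 e2)
  obtain ⟨f1, g1⟩ := coord₁₂ (Y := Y) hs e1 e3 h3 p.n
  obtain ⟨f2, g2⟩ := coord₁₂ (Y := Y) hs e2 e4 (by rwa [neg_sq]) p.n
  obtain ⟨c1, c2, c3, c4⟩ := chord₁₂ hs hs0 h.eqn h0 h1 h3 hn f1 (f2.trans (by rw [n]; ring)) g1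
    (g2.trans (by rw [n]; ring)) rfl
  obtain ⟨R, hR, hsum⟩ := abelJacobi_chord k1 k2 c1 c2 c3 c4
  have hψ : p.model₂.IsPoint ((Q.map p.φ₁).map p.ψ₁₂) (isogXVal p.r 1 (z ^ 2))
      (isogYVal p.r 1 p.s (z ^ 2) Y) := by
    rw [IsPoint, Place.map_hasValue_iff _ p.ψ₁₂, Place.map_hasValue_iff _ p.ψ₁₂, ψ₁₂_X, ψ₁₂_Y]
    exact ⟨hasValue_isogX h.map_φ₁.1 (sub_ne_zero.1 h1),
      hasValue_isogY h.map_φ₁.1 h.map_φ₁.2 (sub_ne_zero.1 h1) hs0⟩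
  have hR' := hR.map_τ
  rw [neg_neg] at hR'
  rw [hR'.unique hψ, ← neg_eq_of_add_eq_zero_right hR.add_map_τ]
  exact eq_neg_of_add_eq_zero_left hsum

/-- As before with `chord₂₁`. No condition on `z² + 3` is needed, since `φ₁` stays affine where `σz
= 0`. -/
theorem abelJacobi_fibre₂₁ {Q : Place p.FC} {z Y : ℂ} (h : p.IsPointC Q z Y) (h0 : z ≠ 0)
    (h1 : z ^ 2 - 1 ≠ 0) (h4 : 3 * z ^ 2 + 1 ≠ 0) :
    abelJacobi p.model₁.O ((Q.map p.σ).map p.φ₁) +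
      abelJacobi p.model₁.O ((((Q.map p.τ).map p.ι).map p.σ).map p.φ₁) =
    abelJacobi p.model₁.O ((Q.map p.φ₂).map p.ψ₂₁) := by
  have hs := p.s_sq
  have hs0 := p.s_ne_zero
  have hn := p.n_ne_zero
  have e1 := p.one_add_s_mul_ne_zero h4
  have e2 : 1 + p.s * -z ≠ 0 := p.one_add_s_mul_ne_zero (by rwa [neg_sq])
  have k1 := (h.map_σ e1).map_φ₁
  have k2 := (h.map_τ.map_ι.map_σ e2).map_φ₁
  obtain ⟨f1, g1⟩ := coord₂₁ (Y := Y) hs e1 h4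
  obtain ⟨f2, g2⟩ := coord₂₁ (Y := -Y) hs e2 (by rwa [neg_sq])
  obtain ⟨c1, c2, c3, c4⟩ := chord₂₁ hs hs0 h.eqn h0 h1 rfl h4 hn f1 (f2.trans (by ring)) g1
    (g2.trans (by ring)) rfl
  obtain ⟨R, hR, hsum⟩ := abelJacobi_chord k1 k2 c1 c2 c3 c4
  have hne : p.n / z ^ 2 ≠ p.n := by
    intro hne
    rw [div_eq_iff (pow_ne_zero 2 h0)] at hne
    exact h1 (mul_left_cancel₀ hn (by linear_combination -hne))
  have hψ : p.model₁.IsPoint ((Q.map p.φ₂).map p.ψ₂₁) (isogXVal p.r p.n (p.n / z ^ 2))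
      (isogYVal p.r p.n p.s (p.n / z ^ 2) (p.n * Y / z ^ 3)) := by
    rw [IsPoint, Place.map_hasValue_iff _ p.ψ₂₁, Place.map_hasValue_iff _ p.ψ₂₁, ψ₂₁_X, ψ₂₁_Y]
    exact ⟨hasValue_isogX (h.map_φ₂ h0).1 hne,
      hasValue_isogY (h.map_φ₂ h0).1 (h.map_φ₂ h0).2 hne hs0⟩
  have hR' := hR.map_τ
  rw [neg_neg] at hR'
  rw [hR'.unique hψ, ← neg_eq_of_add_eq_zero_right hR.add_map_τ]
  exact eq_neg_of_add_eq_zero_left hsum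


/-- The right-hand side is the homomorphism induced by push-forward along `ψ₁₂`, so agreement at
general points suffices. -/
theorem map₁₂_apply (hθ : Descends (pushforward p.φ₂)) (hσ : Descends (pushforward p.σ))
    (hθ' : Descends (pullback p.φ₁)) (P : Place p.FE₁) :
    (hθ.map.comp (hσ.map.comp hθ'.map)) (abelJacobi p.model₁.O P) =
      abelJacobi p.model₂.O (P.map p.ψ₁₂) := by
  have hψ : ∀ P, (pushforward_descends p.ψ₁₂).map (abelJacobi p.model₁.O P) =
      abelJacobi p.model₂.O (P.map p.ψ₁₂) := fun P => by
    rw [Descends.map_pushforward, O_map_ψ₁₂]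
  rw [← hψ]
  congr 1
  -- The values of `X = z²` excluded in `abelJacobi_fibre₁₂`.
  refine hom_ext (M := p.model₁) {0, 1, -3, -1 / 3} fun P a b hP ha => ?_
  simp only [Finset.mem_insert, Finset.mem_singleton, not_or] at ha
  obtain ⟨h0, h1, h3, h4⟩ := ha
  obtain ⟨Q, z, hQ, rfl⟩ := p.exists_isPointC_of_φ₁ hP
  have hQP : Q.map p.φ₁ = P := hP.unique hQ.map_φ₁
  have hRP : (Q.map p.ι).map p.φ₁ = P := by
    have := hQ.map_ι.map_φ₁
    rw [neg_sq] at this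
    exact hP.unique this
  have hz : z ≠ 0 := by rintro rfl; exact h0 (zero_pow two_ne_zero)
  have hQR : Q ≠ Q.map p.ι :=
    hQ.ne_of_ne hQ.map_ι (Or.inl fun h => hz (by linear_combination h / 2))
  obtain ⟨Q₀, R₀, hQ₀, hR₀, hne, hsum⟩ := p.O_fibre_φ₁
  rw [Descends.map_correspondence hθ hσ hθ' p.degree_φ₁ p.model₂.O hQP hRP hQR hQ₀ hR₀ hne, hsum,
    sub_zero, p.abelJacobi_fibre₁₂ hQ hz (sub_ne_zero.2 h1)
      (fun h => h3 (by linear_combination h)) (fun h => h4 (by linear_combination h / 3)), hψ, hQP]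

theorem map₂₁_apply (hθ : Descends (pushforward p.φ₁)) (hσ : Descends (pushforward p.σ))
    (hθ' : Descends (pullback p.φ₂)) (P : Place p.FE₂) :
    (hθ.map.comp (hσ.map.comp hθ'.map)) (abelJacobi p.model₂.O P) =
      abelJacobi p.model₁.O (P.map p.ψ₂₁) := by
  have hψ : ∀ P, (pushforward_descends p.ψ₂₁).map (abelJacobi p.model₂.O P) =
      abelJacobi p.model₁.O (P.map p.ψ₂₁) := fun P => by
    rw [Descends.map_pushforward, O_map_ψ₂₁]
  rw [← hψ]
  congr 1
  have hn := p.n_ne_zero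
  -- Now `X = n/z²`: the exceptions are `z = ∞`, `z² = 1` and `z² = -1/3`; `z = 0` lies over the
  -- origin.
  refine hom_ext (M := p.model₂) {0, p.n, -3 * p.n} fun P a b hP ha => ?_
  simp only [Finset.mem_insert, Finset.mem_singleton, not_or] at ha
  obtain ⟨h0, h1, h4⟩ := ha
  obtain ⟨Q, z, Y, hQ, hz, rfl, rfl⟩ := p.exists_isPointC_of_φ₂ hP h0
  have hQP : Q.map p.φ₂ = P := hP.unique (hQ.map_φ₂ hz)
  have hRP : ((Q.map p.τ).map p.ι).map p.φ₂ = P := by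
    apply hP.unique
    convert hQ.map_τ.map_ι.map_φ₂ (neg_ne_zero.2 hz) using 1
    · rw [neg_sq]
    · rw [Odd.neg_pow (by decide), mul_neg, neg_div_neg_eq]
  have hQR : Q ≠ (Q.map p.τ).map p.ι :=
    hQ.ne_of_ne hQ.map_τ.map_ι (Or.inl fun h => hz (by linear_combination h / 2))
  obtain ⟨Q₀, R₀, hQ₀, hR₀, hne, hsum⟩ := p.O_fibre_φ₂
  have hz2 := pow_ne_zero 2 hz
  rw [Descends.map_correspondence hθ hσ hθ' p.degree_φ₂ p.model₁.O hQP hRP hQR hQ₀ hR₀ hne, hsum,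
    sub_zero, p.abelJacobi_fibre₂₁ hQ hz
      (fun h => h1 (by rw [div_eq_iff hz2]; linear_combination -p.n * h))
      (fun h => h4 (by rw [div_eq_iff hz2]; linear_combination p.n * h)), hψ, hQP]

/-! ### The point `0⁺` and the origins of the two elliptic curves. -/

/-- The point `0⁺`. -/
theorem exists_zero_plus :
    ∃ Z : Place p.FC, ∀ Q, (Q.HasValue p.xC 0 ∧ Q.HasValue p.yC (p.t ^ 6)) ↔ Q = Z := by
  have hx := x_transcendental (f := p.polyC)
  have hyτ : ∀ {Q : Place p.FC} {b : ℂ}, Q.HasValue p.xC 0 → Q.HasValue p.yC b →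
      (Q.map p.τ).HasValue p.xC 0 ∧ (Q.map p.τ).HasValue p.yC (-b) := by
    intro Q b h h'
    rw [Place.map_hasValue_iff, Place.map_hasValue_iff, involution_x, involution_y]
    exact ⟨h, h'.neg⟩
  have hy : ∀ {Q : Place p.FC}, Q.HasValue p.xC 0 → Q.HasValue (p.yC ^ 2) ((p.t ^ 6) ^ 2) := by
    intro Q h
    have c := Place.HasValue.const Q
    have h1 := ((h.pow 3).sub (c 1)).mul ((h.pow 3).sub (c (p.t ^ 12)))
    rw [map_one, ← yC_sq] at h1
    convert h1 using 1
    ring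
  have ht : p.t ^ 6 ≠ 0 := pow_ne_zero 6 p.t_ne_zero
  obtain ⟨Z, hZ, hZ'⟩ : ∃ Z : Place p.FC, Z.HasValue p.xC 0 ∧ Z.HasValue p.yC (p.t ^ 6) := by
    obtain ⟨Q, hQ⟩ := exists_hasValue hx 0
    obtain ⟨b, hb⟩ := Q.exists_value (Q.mem_of_pow_mem two_ne_zero (hy hQ).mem)
    rcases sq_eq_sq_iff_eq_or_eq_neg.1 ((hb.pow 2).unique (hy hQ)) with rfl | rfl
    · exact ⟨Q, hQ, hb⟩
    · have h := hyτ hQ hb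
      rw [neg_neg] at h
      exact ⟨_, h⟩
  refine ⟨Z, fun Q => ⟨?_, by rintro rfl; exact ⟨hZ, hZ'⟩⟩⟩
  rintro ⟨hQ, hQ'⟩
  -- As `x` has degree at most two, `Z` and `τZ` are the only points with `x = 0`, and `y` separates
  -- them.
  have hdeg : degree (ratLift p.xC hx) ≤ 2 := by
    refine degree_le_two _ (w := p.yC) (a := algebraMap ℂ[X] (RatFunc ℂ) p.polyC) ?_
      fun E hE hw => ?_
    · rw [ratLift_algebraMap]; exact y_sq
    · refine eq_top_of_mem E ?_ hw
      have := hE RatFunc.X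
      rwa [ratLift_X] at this
  have hτ := hyτ hZ hZ'
  have hne : Z ≠ Z.map p.τ := by
    intro h
    have h1 := hτ.2
    rw [← h] at h1
    exact ht (by linear_combination hZ'.unique h1 / 2)
  have hf : ∀ {R : Place p.FC}, R.HasValue p.xC 0 → R.map (ratLift p.xC hx) = ratPlace 0 :=
    fun h => (mem_fibre _).1 ((mem_fibre_ratPlace hx).2 h)
  rcases (fibre_of_degree_le_two hdeg (hf hZ) (hf hτ.1) hne).1 Q (hf hQ) with h | h
  · exact h
  · rw [h] at hQ'
    exact absurd (hQ'.unique hτ.2) fun h1 => ht (by linear_combination h1 / 2)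

/-- With `z² = 1`, the images of `0⁺` have `X = 1` on `model₁` and `X = n` on `model₂`, which are
the flexes generating the kernels. -/
theorem isPointC_zero_plus {Z : Place p.FC} (hx : Z.HasValue p.xC 0)
    (hy : Z.HasValue p.yC (p.t ^ 6)) : p.IsPointC Z (-1) (4 * p.r) := by
  have c := Place.HasValue.const Z
  have h1 := hx.add (c (p.t ^ 2))
  have ht := p.t_ne_zero
  have ht6 := p.one_add_t_pow_ne_zero
  have ht6' : p.t ^ 6 + 1 ≠ 0 := by rwa [add_comm]
  have h2 : 0 + p.t ^ 2 ≠ 0 := by rw [zero_add]; exact pow_ne_zero 2 ht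
  constructor
  · have h3 := (hx.sub (c (p.t ^ 2))).div h1 h2
    rwa [zero_sub, zero_add, neg_div, div_self (pow_ne_zero 2 ht)] at h3
  · have h3 := ((c (8 * p.t ^ 3)).mul hy).div ((c (p.t ^ 6 + 1)).mul (h1.pow 3))
      (mul_ne_zero ht6' (pow_ne_zero 3 h2))
    have h4 : 8 * p.t ^ 3 * p.t ^ 6 / ((p.t ^ 6 + 1) * (0 + p.t ^ 2) ^ 3) = 4 * p.r := by
      rw [r, zero_add]
      field_simp
      ring
    rwa [h4] at h3

theorem O₁_iff (Q : Place p.FE₁) : Q.IsPole (x p.polyE₁) ↔ Q = p.model₁.O :=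
  isPole_iff (M := p.model₁)

theorem O₂_iff (Q : Place p.FE₂) :
    (Q.HasValue (x p.polyE₂) 0 ∧ Q.HasValue (y p.polyE₂) 0) ↔ Q = p.model₂.O := by
  have hn : algebraMap ℂ p.FE₂ p.n ≠ 0 := (_root_.map_ne_zero _).2 p.n_ne_zero
  have hx := p.xE₂_ne_zero
  have hX : p.model₂.X = algebraMap ℂ p.FE₂ p.n / x p.polyE₂ := rfl
  have c := Place.HasValue.const Q
  rw [← isPole_iff]
  constructor
  · rintro ⟨h, -⟩
    have h1 := h.div (c p.n) p.n_ne_zero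
    rw [zero_div] at h1
    have h2 := h1.inv_isPole (div_ne_zero hx hn)
    rwa [inv_div] at h2
  · intro h
    have h1 := (c p.n).mul h.inv
    rw [hX, inv_div, mul_div_cancel₀ _ hn, mul_zero] at h1
    refine ⟨h1, Place.HasValue.of_pow_zero (n := 2) ?_⟩
    have h2 := h1.aeval p.polyE₂
    have h3 : p.polyE₂.eval 0 = 0 := by simp [polyE₂]
    rwa [← y_sq, h3] at h2

end Param
end PoonenCurve
theorem mainTheorem10 (p : PoonenCurve.Param) :
    ∃ (Z : PoonenCurve.Place p.FC) (O₁ : PoonenCurve.Place p.FE₁) (O₂ : PoonenCurve.Place p.FE₂),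
      -- `Z` is the point `0⁺ = (0, t⁶)` of `C`
      (∀ Q, (Q.HasValue p.xC 0 ∧ Q.HasValue p.yC (p.t ^ 6)) ↔ Q = Z) ∧
      -- `O₁` is the point at infinity of `E₁`
      (∀ Q, Q.IsPole (PoonenCurve.DoubleCover.x p.polyE₁) ↔ Q = O₁) ∧
      -- `O₂` is the point `(0, 0)` of `E₂`
      (∀ Q, (Q.HasValue (PoonenCurve.DoubleCover.x p.polyE₂) 0 ∧
        Q.HasValue (PoonenCurve.DoubleCover.y p.polyE₂) 0) ↔ Q = O₂) ∧
      -- `E₁` and `E₂` are elliptic curves: `P ↦ [P - O]` identifies them with their Jacobians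
      Function.Bijective (PoonenCurve.abelJacobi O₁) ∧
      Function.Bijective (PoonenCurve.abelJacobi O₂) ∧
      -- the homomorphisms between the Jacobians are well defined
      ∃ (hθ₁ : PoonenCurve.Descends (PoonenCurve.pushforward p.φ₁))
        (hθ₂ : PoonenCurve.Descends (PoonenCurve.pushforward p.φ₂))
        (hσ : PoonenCurve.Descends (PoonenCurve.pushforward p.σ))
        (hθ₁' : PoonenCurve.Descends (PoonenCurve.pullback p.φ₁))
        (hθ₂' : PoonenCurve.Descends (PoonenCurve.pullback p.φ₂)),
        let T₁ : PoonenCurve.Jac p.FE₁ := PoonenCurve.abelJacobi O₁ (Z.map p.φ₁)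
        let T₂ : PoonenCurve.Jac p.FE₂ := PoonenCurve.abelJacobi O₂ (Z.map p.φ₂)
        let φ₁₂ : PoonenCurve.Jac p.FE₁ →+ PoonenCurve.Jac p.FE₂ :=
          hθ₂.map.comp (hσ.map.comp hθ₁'.map)
        let φ₂₁ : PoonenCurve.Jac p.FE₂ →+ PoonenCurve.Jac p.FE₁ :=
          hθ₁.map.comp (hσ.map.comp hθ₂'.map)
        addOrderOf T₁ = 3 ∧ addOrderOf T₂ = 3 ∧
        PoonenCurve.IsIsogeny O₁ O₂ φ₁₂ ∧ PoonenCurve.IsIsogeny O₂ O₁ φ₂₁ ∧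
        φ₁₂.ker = AddSubgroup.zmultiples T₁ ∧ φ₂₁.ker = AddSubgroup.zmultiples T₂ := by
  obtain ⟨Z, hZ⟩ := p.exists_zero_plus
  have hT := p.isPointC_zero_plus ((hZ Z).2 rfl).1 ((hZ Z).2 rfl).2
  have hT₁ := hT.map_φ₁
  have hT₂ := hT.map_φ₂ (neg_ne_zero.2 one_ne_zero)
  rw [neg_one_sq] at hT₁
  rw [neg_one_sq, div_one] at hT₂
  have hθ₁ := PoonenCurve.pushforward_descends p.φ₁
  have hθ₂ := PoonenCurve.pushforward_descends p.φ₂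
  have hσ := PoonenCurve.pushforward_descends p.σ
  have hθ₁' := PoonenCurve.pullback_descends p.φ₁
  have hθ₂' := PoonenCurve.pullback_descends p.φ₂
  have h₁ := PoonenCurve.CubicModel.addOrderOf_flexForm p.model₁_hasFlexForm hT₁ (by ring)
  -- Because `z = -1`, the `Y`-coordinate of `T₂` is `-4rn`; the flex criterion only asks for its
  -- square.
  have h₂ := PoonenCurve.CubicModel.addOrderOf_flexForm p.model₂_hasFlexForm hT₂ (by ring)
  have h₁₂ := p.map₁₂_apply hθ₂ hσ hθ₁'
  have h₂₁ := p.map₂₁_apply hθ₁ hσ hθ₂'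
  have k₁₂ := PoonenCurve.CubicModel.ker_eq_zmultiples h₁₂ hT₁ fun P => by
    rw [p.ψ₁₂_X]
    exact PoonenCurve.CubicModel.isPole_isogX_iff p.r_ne_zero one_ne_zero
  have k₂₁ := PoonenCurve.CubicModel.ker_eq_zmultiples h₂₁ hT₂ fun P => by
    rw [p.ψ₂₁_X]
    exact PoonenCurve.CubicModel.isPole_isogX_iff p.r_ne_zero p.n_ne_zero
  refine ⟨Z, p.model₁.O, p.model₂.O, hZ, p.O₁_iff, p.O₂_iff,
    p.model₁.abelJacobi_bijective, p.model₂.abelJacobi_bijective, hθ₁, hθ₂, hσ, hθ₁', hθ₂', ?_⟩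
  intro T₁ T₂ φ₁₂ φ₂₁
  exact ⟨h₁, h₂, ⟨p.ψ₁₂, h₁₂⟩, ⟨p.ψ₂₁, h₂₁⟩, k₁₂, k₂₁⟩
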